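/- **Theorem 3.10.** Let $k$ be a commutative domain, $n\ge 0$, and let $p_{ij}\in k^\times$ ($1\le i,j\le n$) satisfy $p_{ii}=1$ and $p_{ji}=p_{ij}^{-1}$. Let $A=k_{p_{ij}}[x_1,\dots,x_n]$ be the skew polynomial ring, i.e. the $k$-algebra generated by $x_1,\dots,x_n$ subject to $x_jx_i=p_{ij}x_ix_j$ for $i<j$; let $C(A)$ be its center and $Y=\bigoplus_i kx_i$. Degrees in $A$ are taken with respect to the standard filtration $F_mA=(k+Y)^m$. Assume * (H1) no $x_i$ is central in $A$; * (H2) every $p_{ij}$ ($i<j$) is a root of unity; * the subgroup of $k^\times$ generated by $\{p_{ij}\mid i<j\}$ equals $\langle q\rangle$, where $q$ is a primitive $\ell$-th root of unity and $\ell$ is a prime number. Then the following are equivalent. 1. $\operatorname{Aut}(A)$ is affine: for every $k$-algebra automorphism $g$ of $A$, $\deg g(x_i)=1$ for all $i$. 2. For every commutative domain $C$ which is a flat $k$-algebra, every $k$-algebra automorphism $g$ of $A\otimes_k C$ is $C$-affine, i.e. $g(x_i)\in (Y\oplus k)\otimes C$ for all $i$. 3. $(k^\times)^n\subset\operatorname{Aut}(A)\subset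 S_n\ltimes(k^\times)^n$; that is, every substitution $x_i\mapsto c_ix_i$ with $c_i\in k^\times$ extends to an automorphism of $A$, and every automorphism of $A$ has the form $x_i\mapsto c_ix_{\sigma(i)}$ for some $\sigma\in S_n$ and $c_i\in k^\times$. 4. $C(A)$ is isomorphic, as a $k$-algebra, to a polynomial ring over $k$ (in finitely many variables). 5. $A$ is a free module over $C(A)$. 6. $\det(\phi_{ij})_{n\times n}$ is invertible in $\mathbb Z/(\ell)$, where the integers $\phi_{ij}$ (determined modulo $\ell$) are given by $p_{ij}=q^{\phi_{ij}}$ for all $i,j$. 7. The discriminant $d_w(A/C(A))$ is dominating, where $w=\operatorname{rk}(A/C(A))$. If $\mathbb Z\subset k$ (i.e. $k$ has characteristic $0$), then the above are also equivalent to 8. Every $k$-algebra automorphism $h$ of $A[t]$ is triangular: there are $g\in\operatorname{Aut}(A)$, $c\in k^\times$ and $r\in C(A)$ with $h(t)=ct+r$ and $h(a)=g(a)$ for all $a\in A$. 9. Every locally nilpotent $k$-linear derivation of $A$ is zero. In (7), let $F$ be the field of fractions of $C(A)$, let $w=\dim_F (F\otimes_{C(A)}A)$, and let $\operatorname{tr}(a)\in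 F$ be the trace of left multiplication by $a$ on $F\otimes_{C(A)}A$; the trace takes values in $C(A)$. Then $d_w(A/C(A))$ is the greatest common divisor in $A$ of all elements $\det(\operatorname{tr}(z_iz'_j))_{w\times w}$ with $z_1,\dots,z_w,z'_1,\dots,z'_w\in A$. Here $b$ divides $a$ if $a=cb$ for some $c\in A$, and common divisors and the gcd are required to be normal elements ($bA=Ab$). A nonzero $f\in A$ is *dominating* if for every $\mathbb N$-filtered PI $k$-algebra $T$ whose associated graded ring is a connected graded domain, and all $y_1,\dots,y_n\in T$ that are linearly independent in the $k$-module $T/F_0T$, there is a lift $\tilde f$ of $f$ to the free algebra $k\langle x_1,\dots,x_n\rangle$ such that either $\tilde f(y_1,\dots,y_n)=0$, or $\deg\tilde f(y_1,\dots,y_n)\ge\deg f$, with strict inequality if $\deg y_{i}>1$ for some $i$. -/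

import Mathlib

open scoped TensorProduct

universe u v

noncomputable section

namespace SkewPoly

/-! ### Skew polynomial rings -/

/-- The defining relations `x_j x_i = p_{ij} x_i x_j` for `i < j`. -/
inductive Rel {k : Type u} [CommRing k] {n : ℕ} (p : Fin n → Fin n → kˣ) :
    FreeAlgebra k (Fin n) → FreeAlgebra k (Fin n) → Prop
  | comm (i j : Fin n) (h : i < j) :
      Rel p (FreeAlgebra.ι k j * FreeAlgebra.ι k i)
        ((p i j : k) • (FreeAlgebra.ι k i * FreeAlgebra.ι k j))

/-- The skew polynomial ring `k_{p_ij}[x_1, …, x_n]`. -/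
abbrev Alg {k : Type u} [CommRing k] {n : ℕ} (p : Fin n → Fin n → kˣ) : Type u :=
  RingQuot (Rel p)

/-- The generators `x_1, …, x_n`. -/
def x {k : Type u} [CommRing k] {n : ℕ} (p : Fin n → Fin n → kˣ) (i : Fin n) : Alg p :=
  RingQuot.mkAlgHom k (Rel p) (FreeAlgebra.ι k i)

/-! ### Filtrations and degrees -/

/-- `F_0 ⊆ F_1 ⊆ ⋯` is an exhaustive multiplicative filtration of the `k`-algebra `T`. -/
structure IsAlgFiltration {k : Type*} {T : Type*} [CommRing k] [Ring T] [Algebra k T]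
    (F : ℕ → Submodule k T) : Prop where
  mono : Monotone F
  one_mem : (1 : T) ∈ F 0
  mul_mem : ∀ i j : ℕ, ∀ a ∈ F i, ∀ b ∈ F j, a * b ∈ F (i + j)
  exhaustive : ∀ a : T, ∃ m, a ∈ F m

/-- `F_{m-1}`, with `F_{-1} = 0`. -/
def below {k : Type*} {T : Type*} [CommRing k] [Ring T] [Algebra k T]
    (F : ℕ → Submodule k T) : ℕ → Submodule k T
  | 0 => ⊥
  | m + 1 => F m

/-- The associated graded ring `gr T = ⨁ F_m / F_{m-1}` of a filtered algebra is a connected graded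
domain: its degree `0` part `F_0` is `k` (that is, `k → F_0` is bijective), and the product of two
nonzero homogeneous classes `a + F_{i-1}` and `b + F_{j-1}`, which is the class
`a b + F_{i+j-1}`, is nonzero. -/
structure GrConnectedDomain {k : Type*} {T : Type*} [CommRing k] [Ring T] [Algebra k T]
    (F : ℕ → Submodule k T) : Prop where
  injective : Function.Injective (algebraMap k T)
  zero_eq : ∀ a : T, a ∈ F 0 ↔ a ∈ Set.range (algebraMap k T)
  domain : ∀ i j : ℕ, ∀ a ∈ F i, ∀ b ∈ F j, a ∉ below F i → b ∉ below F j →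
    a * b ∉ below F (i + j)

/-- The degree of a (nonzero) element with respect to a filtration: the least `m` such that
the element lies in `F_m`. -/
def deg {k : Type*} {T : Type*} [CommRing k] [Ring T] [Algebra k T]
    (F : ℕ → Submodule k T) (a : T) : ℕ :=
  sInf {m | a ∈ F m}

/-- The standard filtration `F_m A = (k + Y)^m`, where `Y` is spanned by `x_1, …, x_n`. -/
def stdFiltration {k : Type*} {A : Type*} [CommRing k] [Ring A] [Algebra k A] {n : ℕ}
    (x : Fin n → A) (m : ℕ) : Submodule k A :=
  (1 ⊔ Submodule.span k (Set.range x)) ^ m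

/-! ### Discriminants -/

/-- The regular trace `A → F` of a `k`-algebra `A` over its center `R`, where `F` is the field of
fractions of `R`: the trace of left multiplication by `a` on the `F`-module `F ⊗_R A`. -/
def regularTrace (k : Type*) {A : Type*} [CommRing k] [Ring A] [Algebra k A] (a : A) :
    FractionRing (Subalgebra.center k A) :=
  LinearMap.trace (FractionRing (Subalgebra.center k A))
    (FractionRing (Subalgebra.center k A) ⊗[Subalgebra.center k A] A)
    (LinearMap.baseChange (FractionRing (Subalgebra.center k A))
      ({ toFun := fun b => a * b
         map_add' := fun b c => mul_add a b c
         map_smul' := fun r b => by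
           simp only [Subalgebra.smul_def, smul_eq_mul, RingHom.id_apply, ← mul_assoc]
           rw [Subalgebra.mem_center_iff.mp r.2 a] } : A →ₗ[Subalgebra.center k A] A))

/-- The rank `rk(A/C(A))`, i.e. the dimension of `F ⊗_R A` over the field of fractions `F` of the
center `R`. -/
def centerRank (k : Type*) (A : Type*) [CommRing k] [Ring A] [Algebra k A] : ℕ :=
  Module.finrank (FractionRing (Subalgebra.center k A))
    (FractionRing (Subalgebra.center k A) ⊗[Subalgebra.center k A] A)

/-- The set of all discriminants `d_v(Z, Z' : tr) = det (tr (z_i z'_j))`, viewed in `A`; here `tr` is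
the regular trace over the center. -/
def discriminants (k : Type*) (A : Type*) [CommRing k] [Ring A] [Algebra k A] (m : ℕ) :
    Set A :=
  {d | ∃ (Z Z' : Fin m → A) (r : Subalgebra.center k A), (r : A) = d ∧
    algebraMap (Subalgebra.center k A) (FractionRing (Subalgebra.center k A)) r =
      (Matrix.of fun i j => regularTrace k (Z i * Z' j)).det}

/-- `b` is normal: `b A = A b`. -/
def IsNormalElt {A : Type*} [Ring A] (b : A) : Prop :=
  ∀ a : A, (∃ c, b * a = c * b) ∧ (∃ c, a * b = b * c)

/-- `b` divides `a`: `a = c b` for some `c`. -/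
def Divides {A : Type*} [Ring A] (b a : A) : Prop :=
  ∃ c, a = c * b

/-- `b` is a common divisor of `D`: a normal element dividing all elements of `D`. -/
def IsCommonDivisor {A : Type*} [Ring A] (D : Set A) (b : A) : Prop :=
  IsNormalElt b ∧ ∀ a ∈ D, Divides b a

/-- `b` is a greatest common divisor of `D`. -/
def IsGcd {A : Type*} [Ring A] (D : Set A) (b : A) : Prop :=
  IsCommonDivisor D b ∧ ∀ c, IsCommonDivisor D c → Divides c b

/-- `d` is (a representative of) the `m`-discriminant `d_m(A/C(A))`: the regular trace takes values
in the center, and `d` is a gcd in `A` of all the elements `d_m(Z, Z' : tr)`. -/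
def IsDiscriminant (k : Type*) {A : Type*} [CommRing k] [Ring A] [Algebra k A] (m : ℕ)
    (d : A) : Prop :=
  (∀ a : A, regularTrace k a ∈
    Set.range (algebraMap (Subalgebra.center k A) (FractionRing (Subalgebra.center k A)))) ∧
  IsGcd (discriminants k A m) d

/-! ### Dominating elements -/

/-- `T` is a PI ring: it satisfies a monic identity, i.e. a polynomial in noncommuting variables with
integer coefficients in which some monomial of highest length has coefficient `1`. -/
def IsPI (T : Type*) [Ring T] : Prop :=
  ∃ f : FreeAlgebra ℤ ℕ,
    (∃ m : FreeMonoid ℕ, (FreeAlgebra.equivMonoidAlgebraFreeMonoid f).coeff m = 1 ∧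
      ∀ m' : FreeMonoid ℕ, (FreeAlgebra.equivMonoidAlgebraFreeMonoid f).coeff m' ≠ 0 →
        m'.length ≤ m.length) ∧
    ∀ y : ℕ → T, FreeAlgebra.lift ℤ y f = 0

/-- A nonzero element `f` of an algebra `A` generated by `x_1, …, x_n` is dominating if, for every
filtered PI algebra `T` with `gr T` a connected graded domain and all `y_1, …, y_n ∈ T` that are
linearly independent modulo `F_0 T`, some lift `f'` of `f` to the free algebra satisfies:
`f'(y) = 0`, or `deg f'(y) ≥ deg f`, with strict inequality if `deg y_i > 1` for some `i`. -/
def IsDominating.{w, w'} {k : Type w} {A : Type w} [CommRing k] [Ring A] [Algebra k A]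
    {n : ℕ} (x : Fin n → A) (f : A) : Prop :=
  f ≠ 0 ∧
  ∀ (T : Type (max w w')) [Ring T] [Algebra k T] (F : ℕ → Submodule k T),
    IsPI T → IsAlgFiltration F → GrConnectedDomain F →
    ∀ y : Fin n → T, LinearIndependent k (fun i => (F 0).mkQ (y i)) →
      ∃ f' : FreeAlgebra k (Fin n), FreeAlgebra.lift k x f' = f ∧
        (FreeAlgebra.lift k y f' = 0 ∨
          (deg (stdFiltration (k := k) x) f ≤ deg F (FreeAlgebra.lift k y f') ∧
            ((∃ i, 1 < deg F (y i)) →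
              deg (stdFiltration (k := k) x) f < deg F (FreeAlgebra.lift k y f'))))

/-! ### Automorphisms and derivations -/

/-- `g` is affine: `deg g(x_i) = 1` for all `i`. -/
def IsAffine {k : Type*} {A : Type*} [CommRing k] [Ring A] [Algebra k A] {n : ℕ}
    (x : Fin n → A) (g : A ≃ₐ[k] A) : Prop :=
  ∀ i, deg (stdFiltration (k := k) x) (g (x i)) = 1

/-- An automorphism `g` of `A ⊗ C` is `C`-affine: `g(x_i) ∈ (Y ⊕ k) ⊗ C` for all `i`. -/
def IsAffineOver {k : Type*} {A : Type*} [CommRing k] [Ring A] [Algebra k A] {n : ℕ}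
    (x : Fin n → A) (C : Type*) [CommRing C] [Algebra k C] (g : (A ⊗[k] C) ≃ₐ[k] (A ⊗[k] C)) :
    Prop :=
  ∀ i, g (x i ⊗ₜ[k] (1 : C)) ∈
    LinearMap.range (TensorProduct.map
      (Submodule.subtype (1 ⊔ Submodule.span k (Set.range x) : Submodule k A))
      (LinearMap.id : C →ₗ[k] C))

/-- `g` is diagonal with scalars `c`, i.e. the element `c` of the torus `(k^×)^n`:
`g(x_i) = c_i x_i`. -/
def IsDiagonal {k : Type*} {A : Type*} [CommRing k] [Ring A] [Algebra k A] {n : ℕ}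
    (x : Fin n → A) (c : Fin n → kˣ) (g : A ≃ₐ[k] A) : Prop :=
  ∀ i, g (x i) = (c i : k) • x i

/-- `g` is in `S_n ⋉ (k^×)^n`: `g(x_i) = c_i x_{σ(i)}` for a permutation `σ` and units `c_i`. -/
def IsMonomial {k : Type*} {A : Type*} [CommRing k] [Ring A] [Algebra k A] {n : ℕ}
    (x : Fin n → A) (g : A ≃ₐ[k] A) : Prop :=
  ∃ (σ : Equiv.Perm (Fin n)) (c : Fin n → kˣ), ∀ i, g (x i) = (c i : k) • x (σ i)

/-- An automorphism `h` of `A[t]` is triangular: `h(a) = g(a)` for `a ∈ A` and `h(t) = c t + r`, with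
`g ∈ Aut(A)`, `c ∈ k^×` and `r` in the center of `A`. -/
def IsTriangular {k : Type*} {A : Type*} [CommRing k] [Ring A] [Algebra k A]
    (h : Polynomial A ≃ₐ[k] Polynomial A) : Prop :=
  ∃ (g : A ≃ₐ[k] A) (c : kˣ) (r : A), r ∈ Subalgebra.center k A ∧
    h Polynomial.X = (c : k) • Polynomial.X + Polynomial.C r ∧
    ∀ a : A, h (Polynomial.C a) = Polynomial.C (g a)

/-- `δ` is a locally nilpotent derivation of the (noncommutative) `k`-algebra `A`. -/
def IsLND {k : Type*} {A : Type*} [CommRing k] [Ring A] [Algebra k A] (δ : A →ₗ[k] A) :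
    Prop :=
  (∀ a b : A, δ (a * b) = δ a * b + a * δ b) ∧ ∀ a : A, ∃ m : ℕ, (δ ^ m) a = 0

end SkewPoly

end

noncomputable section

namespace SkewPoly

/-! Every condition is compared with one statement K: a monomial x^a is central only if ℓ divides
every a_i. With p_ij = q^φ_ij, the monomial x^a is central iff a lies in the left kernel of φ modulo
ℓ, so K is the determinant condition. The ℓ-th powers of monomials are central in any case.

Most arguments need only a basis of monomials that multiply up to units (`MonomialBasis`). Since ℕ^n
has unique sums, such an algebra is a domain, and a factor of a monomial is a scalar times a
monomial (`factors_of_mul_eq`).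

Assume K. Then A is free over its center on the monomials with exponents below ℓ, and the center is
the polynomial ring in the x_i^ℓ. Let π be the projection to the center killing the noncentral
monomials. A noncentral monomial becomes a commutator after multiplication by a nonzero central
element (`eq_zero_of_proj_eq_zero`). Hence π commutes with ring automorphisms, and the regular trace
is the rank times π. In the determinant of π(z_i z_j) over the reduced monomials a single
permutation contributes, so it is a unit times a monomial containing every variable (`coe_resDet`).
An automorphism g sends it to a divisor of itself, so each g(x_i) divides a monomial and is a
monomial up to a unit; comparing degrees, it is a variable (`exists_perm_of_ringEquiv`). Applied to
A, A ⊗ C and A ⊗ k[t], this gives the statements about automorphisms. The discriminant is the same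
monomial up to a nonzero scalar, hence dominating; conversely, a dominating discriminant, preserved
by g up to a unit, bounds the degrees of the g(x_i). For a locally nilpotent δ, δ(x_s^ℓ) is central
and divisible by x_s^(ℓ-1), hence by x_s^ℓ, and so vanishes in characteristic 0.

If K fails, some monomial m without x_s commutes with the variables exactly as x_s does
(`exists_commutesLike`). Sending x_s to x_s + c m, with c = 1, t or ε, gives a non-affine
automorphism of A, a non-triangular automorphism of A[t], and a nonzero locally nilpotent derivation
(`elementaryHom`).

Freeness and polynomiality of the center imply K directly: the first by comparing coordinates in the
relation between x_s and m (`dvd_of_free_center`), the second because the x_i^ℓ become primes in a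
factorial ring (`dvd_of_center_algEquiv`). -/

/-- A basis of `B` indexed by exponent vectors which is multiplicative up to units of `k`. -/
structure MonomialBasis (k : Type*) (B : Type*) [CommRing k] [Ring B] [Algebra k B] (n : ℕ) where
  /-- the monomial with a given exponent vector -/
  e : Module.Basis (Fin n →₀ ℕ) k B
  /-- the cocycle -/
  χ : (Fin n →₀ ℕ) → (Fin n →₀ ℕ) → kˣ
  mul : ∀ a b, e a * e b = (χ a b : k) • e (a + b)
  one : e 0 = 1

/-! ### Algebras with a monomial basis: products, factorizations of monomials, projection to the
center -/

namespace MonomialBasis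

variable {k B : Type*} [CommRing k] [Ring B] [Algebra k B] {n : ℕ} (M : MonomialBasis k B n)

/-- The monomial with exponent vector `a` is central. -/
def IsCentral (a : Fin n →₀ ℕ) : Prop := ∀ b, M.χ a b = M.χ b a

theorem eq_sum (f : B) : f = ∑ a ∈ (M.e.repr f).support, M.e.repr f a • M.e a := by
  conv_lhs => rw [← M.e.linearCombination_repr f, Finsupp.linearCombination_apply, Finsupp.sum]

theorem repr_mul (f g : B) (c : Fin n →₀ ℕ) :
    M.e.repr (f * g) c = ∑ a ∈ (M.e.repr f).support, ∑ b ∈ (M.e.repr g).support,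
      if a + b = c then M.e.repr f a * M.e.repr g b * (M.χ a b : k) else 0 := by
  conv_lhs => rw [M.eq_sum f, M.eq_sum g, Finset.sum_mul_sum]
  simp only [map_sum, Finsupp.finsetSum_apply]
  refine Finset.sum_congr rfl fun a _ => Finset.sum_congr rfl fun b _ => ?_
  rw [smul_mul_smul_comm, M.mul, smul_smul, map_smul, M.e.repr_self, Finsupp.smul_single,
    Finsupp.single_apply]
  split_ifs <;> simp

/-- Only one pair of exponents contributes to this coefficient. Unique sums play the role of leading
terms, with no monomial order to choose. -/
theorem repr_mul_of_uniqueAdd {f g : B} {a b : Fin n →₀ ℕ}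
    (h : UniqueAdd (M.e.repr f).support (M.e.repr g).support a b) :
    M.e.repr (f * g) (a + b) = M.e.repr f a * M.e.repr g b * (M.χ a b : k) := by
  rw [M.repr_mul]
  rw [Finset.sum_eq_single a, Finset.sum_eq_single b, if_pos rfl]
  · intro b' hb' hne
    split_ifs with h'
    · exact absurd (add_left_cancel h') hne
    · rfl
  · intro hb
    rw [if_pos rfl, Finsupp.notMem_support_iff.mp hb]; simp
  · intro a' ha' hne
    refine Finset.sum_eq_zero fun b' hb' => ?_
    split_ifs with h'
    · exact absurd (h ha' hb' h').1 hne
    · rfl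
  · intro ha
    refine Finset.sum_eq_zero fun b' hb' => ?_
    split_ifs with h'
    · rw [Finsupp.notMem_support_iff.mp ha]; simp
    · rfl

theorem exists_of_repr_mul_ne_zero {f g : B} {c : Fin n →₀ ℕ} (h : M.e.repr (f * g) c ≠ 0) :
    ∃ a b, M.e.repr f a ≠ 0 ∧ M.e.repr g b ≠ 0 ∧ a + b = c := by
  rw [M.repr_mul] at h
  obtain ⟨a, ha, h⟩ := Finset.exists_ne_zero_of_sum_ne_zero h
  obtain ⟨b, hb, h⟩ := Finset.exists_ne_zero_of_sum_ne_zero h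
  refine ⟨a, b, Finsupp.mem_support_iff.mp ha, Finsupp.mem_support_iff.mp hb, ?_⟩
  by_contra hne
  exact h (if_neg hne)

theorem repr_mul_e (f : B) (a b : Fin n →₀ ℕ) :
    M.e.repr (f * M.e b) (a + b) = M.e.repr f a * (M.χ a b : k) := by
  classical
  nontriviality k
  have := M.repr_mul_of_uniqueAdd (f := f) (g := M.e b) (a := a) (b := b) (by
    intro a' b' _ hb' h
    rw [M.e.repr_self, Finsupp.support_single _ one_ne_zero, Finset.mem_singleton] at hb'
    subst hb'
    exact ⟨add_right_cancel h, rfl⟩)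
  rw [this]; simp

theorem repr_e_mul (f : B) (a b : Fin n →₀ ℕ) :
    M.e.repr (M.e a * f) (a + b) = M.e.repr f b * (M.χ a b : k) := by
  classical
  nontriviality k
  have := M.repr_mul_of_uniqueAdd (f := M.e a) (g := f) (a := a) (b := b) (by
    intro a' b' ha' _ h
    rw [M.e.repr_self, Finsupp.support_single _ one_ne_zero, Finset.mem_singleton] at ha'
    subst ha'
    exact ⟨rfl, add_left_cancel h⟩)
  rw [this]; simp

theorem exists_eq_e_mul {f : B} {v : Fin n →₀ ℕ} (h : ∀ a, M.e.repr f a ≠ 0 → v ≤ a) :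
    ∃ g, f = M.e v * g := by
  refine ⟨∑ a ∈ (M.e.repr f).support,
    (M.e.repr f a * ((M.χ v (a - v))⁻¹ : kˣ)) • M.e (a - v), ?_⟩
  conv_lhs => rw [M.eq_sum f]
  rw [Finset.mul_sum]
  refine Finset.sum_congr rfl fun a ha => ?_
  rw [mul_smul_comm, M.mul, smul_smul, mul_assoc, Units.inv_mul, mul_one,
    add_tsub_cancel_of_le (h a (Finsupp.mem_support_iff.mp ha))]

theorem e_pow (a : Fin n →₀ ℕ) (m : ℕ) : ∃ u : kˣ, M.e a ^ m = (u : k) • M.e (m • a) := by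
  induction m with
  | zero => exact ⟨1, by simp [M.one]⟩
  | succ m ih =>
    obtain ⟨u, hu⟩ := ih
    refine ⟨u * M.χ (m • a) a, ?_⟩
    rw [pow_succ, hu, smul_mul_assoc, M.mul, smul_smul, succ_nsmul, Units.val_mul]

theorem e_ne_zero [Nontrivial k] (a : Fin n →₀ ℕ) : M.e a ≠ 0 := M.e.ne_zero a

section Domain

variable [IsDomain k]

include M in
theorem noZeroDivisors : NoZeroDivisors B where
  eq_zero_or_eq_zero_of_mul_eq_zero {f g} h := by
    by_contra! hne
    have hf : (M.e.repr f).support.Nonempty := by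
      rw [Finsupp.support_nonempty_iff]; simpa using hne.1
    have hg : (M.e.repr g).support.Nonempty := by
      rw [Finsupp.support_nonempty_iff]; simpa using hne.2
    obtain ⟨a, ha, b, hb, hu⟩ := UniqueSums.uniqueAdd_of_nonempty hf hg
    have := M.repr_mul_of_uniqueAdd hu
    rw [h] at this
    rw [Finsupp.mem_support_iff] at ha hb
    simp [ha, hb] at this

include M in
theorem isDomain : IsDomain B := by
  have := M.noZeroDivisors
  have : Nontrivial B := ⟨⟨M.e 0, 0, M.e_ne_zero 0⟩⟩
  exact NoZeroDivisors.to_isDomain B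

/-- A factorization of a monomial is a factorization into monomials. -/
theorem factors_of_mul_eq {f g : B} {c : k} {v : Fin n →₀ ℕ} (hc : c ≠ 0)
    (h : f * g = c • M.e v) :
    ∃ (a b : Fin n →₀ ℕ) (r s : k), f = r • M.e a ∧ g = s • M.e b ∧ a + b = v ∧
      r * s * (M.χ a b : k) = c := by
  classical
  have := M.isDomain
  have h0 : f * g ≠ 0 := by
    rw [h]
    intro h'
    have := congrArg (fun z => M.e.repr z v) h'
    simp [hc] at this
  have hf : (M.e.repr f).support.Nonempty := by
    rw [Finsupp.support_nonempty_iff]; simpa using left_ne_zero_of_mul h0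
  have hg : (M.e.repr g).support.Nonempty := by
    rw [Finsupp.support_nonempty_iff]; simpa using right_ne_zero_of_mul h0
  have key : ∀ a ∈ (M.e.repr f).support, ∀ b ∈ (M.e.repr g).support,
      UniqueAdd (M.e.repr f).support (M.e.repr g).support a b → a + b = v := by
    intro a ha b hb hu
    have := M.repr_mul_of_uniqueAdd hu
    rw [h] at this
    rw [Finsupp.mem_support_iff] at ha hb
    by_contra hne
    have h2 : v ≠ a + b := fun h => hne h.symm
    simp [ha, hb, h2] at this
  -- If either support had two elements, two different pairs of exponents would have uniquely
  -- represented sums. Both sums would equal v, which contradicts uniqueness.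
  have hcard : ¬ 1 < (M.e.repr f).support.card * (M.e.repr g).support.card := by
    intro hlt
    obtain ⟨p1, hp1, p2, hp2, hne, h1, h2⟩ := TwoUniqueSums.uniqueAdd_of_one_lt_card hlt
    rw [Finset.mem_product] at hp1 hp2
    have e1 := key _ hp1.1 _ hp1.2 h1
    have e2 := key _ hp2.1 _ hp2.2 h2
    exact hne (Prod.ext_iff.mpr ((h1 hp2.1 hp2.2 (e2.trans e1.symm)).imp Eq.symm Eq.symm))
  have hf1 := Finset.card_pos.mpr hf
  have hg1 := Finset.card_pos.mpr hg
  have hfc : (M.e.repr f).support.card = 1 := by nlinarith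
  have hgc : (M.e.repr g).support.card = 1 := by nlinarith
  obtain ⟨a, ha⟩ := Finset.card_eq_one.mp hfc
  obtain ⟨b, hb⟩ := Finset.card_eq_one.mp hgc
  have ef := M.eq_sum f
  have eg := M.eq_sum g
  rw [ha, Finset.sum_singleton] at ef
  rw [hb, Finset.sum_singleton] at eg
  have hu : UniqueAdd (M.e.repr f).support (M.e.repr g).support a b := by
    intro a' b' ha' hb' _
    rw [ha, Finset.mem_singleton] at ha'
    rw [hb, Finset.mem_singleton] at hb'
    exact ⟨ha', hb'⟩
  have hab := key a (by simp [ha]) b (by simp [hb]) hu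
  refine ⟨a, b, _, _, ef, eg, hab, ?_⟩
  rw [← M.repr_mul_of_uniqueAdd hu, h, hab]
  simp

-- The factorization lemma at v = 0: exponents adding up to 0 vanish, so even one-sided units are
-- constants.
include M in
theorem exists_eq_smul_one_of_mul_eq_one {f g : B} (h : f * g = 1) :
    ∃ u : kˣ, f = (u : k) • (1 : B) := by
  obtain ⟨a, b, r, s, hf, -, hab, hrs⟩ := M.factors_of_mul_eq (c := 1) (v := 0) one_ne_zero
    (by rw [h, one_smul, M.one])
  have ha : a = 0 := by
    ext i
    have := DFunLike.congr_fun hab i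
    simp at this
    simp [this.1]
  refine ⟨Units.mkOfMulEqOne r (s * (M.χ a b : k)) (by rw [← mul_assoc, hrs]), ?_⟩
  subst ha
  rw [hf, M.one]; rfl

/-! ### The center -/

/-- Monomials commute up to scalars, so comparing f with its conjugates by monomials can be done one
coefficient at a time, and a nonzero coefficient cancels. -/
theorem mem_center_iff {f : B} :
    f ∈ Subalgebra.center k B ↔ ∀ a, M.e.repr f a ≠ 0 → M.IsCentral a := by
  rw [Subalgebra.mem_center_iff]
  constructor
  · intro h a ha b
    have h1 := M.repr_mul_e f a b
    have h2 := M.repr_e_mul f b a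
    rw [h, add_comm, h1] at h2
    exact Units.ext (mul_left_cancel₀ ha h2)
  · intro h g
    conv_lhs => rw [M.eq_sum f, M.eq_sum g]
    conv_rhs => rw [M.eq_sum f, M.eq_sum g]
    rw [Finset.sum_mul_sum, Finset.sum_mul_sum, Finset.sum_comm]
    refine Finset.sum_congr rfl fun a ha => Finset.sum_congr rfl fun b _ => ?_
    rw [smul_mul_smul_comm, smul_mul_smul_comm, M.mul, M.mul,
      h a (Finsupp.mem_support_iff.mp ha) b, add_comm a b, mul_comm]

theorem e_mem_center_iff {a : Fin n →₀ ℕ} :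
    M.e a ∈ Subalgebra.center k B ↔ M.IsCentral a := by
  classical
  rw [M.mem_center_iff]
  constructor
  · intro h; exact h a (by simp)
  · intro h b hb
    rw [M.e.repr_self, Finsupp.single_apply] at hb
    by_cases hab : a = b
    · exact hab ▸ h
    · simp [hab] at hb

/-- `χ` is not assumed bimultiplicative; centrality is transferred inside the domain B by cancelling
the central element `M.e a`. -/
theorem isCentral_add_iff {a b : Fin n →₀ ℕ} (ha : M.IsCentral a) :
    M.IsCentral (a + b) ↔ M.IsCentral b := by
  have := M.isDomain
  rw [← e_mem_center_iff, ← e_mem_center_iff]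
  have ha' := M.e_mem_center_iff.mpr ha
  have e : M.e (a + b) = (((M.χ a b)⁻¹ : kˣ) : k) • (M.e a * M.e b) := by
    rw [M.mul, smul_smul, Units.inv_mul, one_smul]
  constructor
  · intro h
    have h' : M.e a * M.e b ∈ Subalgebra.center k B := by
      rw [M.mul]; exact Subalgebra.smul_mem _ h _
    rw [Subalgebra.mem_center_iff] at h' ha' ⊢
    intro g
    apply mul_left_cancel₀ (M.e_ne_zero a)
    rw [← mul_assoc, ← mul_assoc, ← h' g, ← ha' g, mul_assoc]
  · intro h
    rw [e]
    exact Subalgebra.smul_mem _ (mul_mem ha' h) _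

open Classical in
/-- The projection onto the center along the noncentral monomials. -/
def proj : B →ₗ[k] B := M.e.constr k fun a => if M.IsCentral a then M.e a else 0

omit [IsDomain k] in
theorem proj_e_of_central {a : Fin n →₀ ℕ} (h : M.IsCentral a) : M.proj (M.e a) = M.e a := by
  rw [proj, Module.Basis.constr_basis, if_pos h]

omit [IsDomain k] in
theorem proj_e_of_not_central {a : Fin n →₀ ℕ} (h : ¬ M.IsCentral a) : M.proj (M.e a) = 0 := by
  rw [proj, Module.Basis.constr_basis, if_neg h]

theorem proj_mem_center (f : B) : M.proj f ∈ Subalgebra.center k B := by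
  rw [M.eq_sum f, map_sum]
  refine sum_mem fun a _ => ?_
  rw [map_smul]
  refine Subalgebra.smul_mem _ ?_ _
  by_cases h : M.IsCentral a
  · rw [M.proj_e_of_central h]; exact M.e_mem_center_iff.mpr h
  · rw [M.proj_e_of_not_central h]; exact zero_mem _

theorem proj_of_mem_center {f : B} (hf : f ∈ Subalgebra.center k B) : M.proj f = f := by
  rw [M.mem_center_iff] at hf
  conv_lhs => rw [M.eq_sum f]
  conv_rhs => rw [M.eq_sum f]
  rw [map_sum]
  refine Finset.sum_congr rfl fun a ha => ?_
  rw [map_smul, M.proj_e_of_central (hf a (Finsupp.mem_support_iff.mp ha))]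

theorem proj_mul_of_mem_center {r : B} (hr : r ∈ Subalgebra.center k B) (f : B) :
    M.proj (r * f) = r * M.proj f := by
  rw [M.mem_center_iff] at hr
  rw [M.eq_sum r, M.eq_sum f, Finset.sum_mul_sum, map_sum, map_sum, Finset.sum_mul_sum]
  refine Finset.sum_congr rfl fun a ha => ?_
  rw [map_sum]
  refine Finset.sum_congr rfl fun b _ => ?_
  have hra := hr a (Finsupp.mem_support_iff.mp ha)
  rw [map_smul, smul_mul_smul_comm, smul_mul_smul_comm, map_smul, M.mul, map_smul]
  by_cases h : M.IsCentral b
  · rw [M.proj_e_of_central h, M.proj_e_of_central ((M.isCentral_add_iff hra).mpr h), M.mul]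
  · rw [M.proj_e_of_not_central h,
      M.proj_e_of_not_central (fun h' => h ((M.isCentral_add_iff hra).mp h'))]
    simp

/-- When a + b is central, e_a commutes with e_a e_b, and cancelling e_a gives e_a e_b = e_b e_a.
Otherwise both products project to 0. -/
theorem proj_mul_comm (f g : B) : M.proj (f * g) = M.proj (g * f) := by
  have := M.isDomain
  rw [M.eq_sum f, M.eq_sum g, Finset.sum_mul_sum, Finset.sum_mul_sum, map_sum, map_sum]
  simp_rw [map_sum]
  rw [Finset.sum_comm]
  refine Finset.sum_congr rfl fun b _ => Finset.sum_congr rfl fun a _ => ?_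
  rw [smul_mul_smul_comm, smul_mul_smul_comm, map_smul, map_smul, mul_comm (M.e.repr g b)]
  congr 1
  by_cases h : M.IsCentral (a + b)
  · congr 1
    have h' : M.e a * M.e b ∈ Subalgebra.center k B := by
      rw [M.mul]; exact Subalgebra.smul_mem _ (M.e_mem_center_iff.mpr h) _
    apply mul_left_cancel₀ (M.e_ne_zero a)
    rw [Subalgebra.mem_center_iff.mp h' (M.e a), mul_assoc]
  · rw [M.mul, M.mul, add_comm b a, map_smul, map_smul, M.proj_e_of_not_central h, smul_zero,
      smul_zero]

/-- A trace-like additive map which is torsion-free over the center vanishes on the kernel of the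
projection to the center. -/
theorem eq_zero_of_proj_eq_zero {V : Type*} [AddCommGroup V] (τ : B →+ V) {ℓ : ℕ} (hℓ : 0 < ℓ)
    (hexp : ∀ b, M.IsCentral (ℓ • b)) (hcomm : ∀ a b, τ (a * b) = τ (b * a))
    (htors : ∀ r ∈ Subalgebra.center k B, r ≠ 0 → ∀ h, τ (r * h) = 0 → τ h = 0) {h : B}
    (h0 : M.proj h = 0) : τ h = 0 := by
  have := M.isDomain
  have hsupp : ∀ a, M.e.repr h a ≠ 0 → ¬ M.IsCentral a := by
    intro a ha hc
    have : M.e.repr (M.proj h) a = M.e.repr h a := by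
      conv_lhs => rw [M.eq_sum h]
      simp only [map_sum, map_smul, Finsupp.finsetSum_apply, Finsupp.smul_apply]
      rw [Finset.sum_eq_single a]
      · rw [M.proj_e_of_central hc]; simp
      · intro b _ hb
        by_cases hcb : M.IsCentral b
        · rw [M.proj_e_of_central hcb]; simp [hb]
        · rw [M.proj_e_of_not_central hcb]; simp
      · intro hn
        exact absurd (Finsupp.mem_support_iff.mpr ha) hn
    rw [h0] at this
    exact ha (by simpa using this.symm)
  rw [M.eq_sum h, map_sum]
  refine Finset.sum_eq_zero fun a ha => ?_
  have hna := hsupp a (Finsupp.mem_support_iff.mp ha)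
  -- τ is only additive, so the coefficient has to stay attached to its monomial.
  generalize M.e.repr h a = c
  obtain ⟨b, hb⟩ := not_forall.mp hna
  obtain ⟨w, hw⟩ := M.e_pow b ℓ
  have hbℓ : M.e b ^ ℓ ∈ Subalgebra.center k B := by
    rw [hw]; exact Subalgebra.smul_mem _ (M.e_mem_center_iff.mpr (hexp b)) _
  -- With b a = (1 + t) a b and t ≠ 0, the element t b^ℓ · a is the commutator of b with a b^(ℓ-1).
  -- So τ kills it, and the nonzero central factor t b^ℓ can be removed.
  set t : k := ((M.χ b a * (M.χ a b)⁻¹ : kˣ) : k) - 1 with ht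
  have ht0 : t ≠ 0 := by
    intro h
    rw [ht, sub_eq_zero, Units.val_eq_one, mul_inv_eq_one] at h
    exact hb h.symm
  have hba : M.e b * M.e a = ((M.χ b a * (M.χ a b)⁻¹ : kˣ) : k) • (M.e a * M.e b) := by
    rw [M.mul, M.mul, smul_smul, ← Units.val_mul, inv_mul_cancel_right, add_comm]
  refine htors (t • M.e b ^ ℓ) (Subalgebra.smul_mem _ hbℓ _) ?_ _ ?_
  · intro h
    have h2 := congrArg (fun z => M.e.repr z (ℓ • b)) h
    rw [hw, smul_smul] at h2
    simp [ht0] at h2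
  · have e1 : (t • M.e b ^ ℓ) * (c • M.e a) =
        M.e b * (c • M.e a * M.e b ^ (ℓ - 1)) - (c • M.e a * M.e b ^ (ℓ - 1)) * M.e b := by
      have e2 : M.e b ^ (ℓ - 1) * M.e b = M.e b ^ ℓ := by
        rw [← pow_succ, Nat.sub_add_cancel hℓ]
      have e3 : M.e b * M.e b ^ (ℓ - 1) = M.e b ^ ℓ := by
        rw [← pow_succ', Nat.sub_add_cancel hℓ]
      have e4 : M.e b ^ ℓ * M.e a = M.e a * M.e b ^ ℓ :=
        (Subalgebra.mem_center_iff.mp hbℓ (M.e a)).symm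
      have e5 : M.e b * (M.e a * M.e b ^ (ℓ - 1)) = (t + 1) • (M.e a * M.e b ^ ℓ) := by
        rw [← mul_assoc, hba, smul_mul_assoc, mul_assoc, e3, ht, sub_add_cancel]
      rw [smul_mul_smul_comm, e4, smul_mul_assoc, mul_smul_comm, e5, smul_mul_assoc, mul_assoc,
        e2, smul_smul, ← sub_smul]
      congr 1
      ring
    rw [e1, map_sub, hcomm, sub_self]

end Domain

end MonomialBasis


/-! ### The monomial basis of the skew polynomial ring -/

section Alg

variable {k : Type u} [CommRing k] {n : ℕ} (p : Fin n → Fin n → kˣ)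

theorem x_mul_x_of_lt {i j : Fin n} (h : i < j) :
    x p j * x p i = (p i j : k) • (x p i * x p j) := by
  have := RingQuot.mkAlgHom_rel k (Rel.comm (p := p) i j h)
  simpa [x] using this

theorem x_mul_x (hp_diag : ∀ i, p i i = 1) (hp_inv : ∀ i j, p j i = (p i j)⁻¹) (i j : Fin n) :
    x p j * x p i = (p i j : k) • (x p i * x p j) := by
  rcases lt_trichotomy i j with h | h | h
  · exact x_mul_x_of_lt p h
  · subst h; simp [hp_diag]
  · rw [x_mul_x_of_lt p h, smul_smul, hp_inv i j, Units.mul_inv, one_smul]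

/-- The universal property of the skew polynomial ring. -/
def liftHom {S : Type*} [Ring S] [Algebra k S] (y : Fin n → S)
    (hy : ∀ i j, i < j → y j * y i = (p i j : k) • (y i * y j)) : Alg p →ₐ[k] S :=
  RingQuot.liftAlgHom k ⟨FreeAlgebra.lift k y, by
    rintro _ _ ⟨i, j, h⟩
    simpa using hy i j h⟩

@[simp]
theorem liftHom_x {S : Type*} [Ring S] [Algebra k S] (y : Fin n → S)
    (hy : ∀ i j, i < j → y j * y i = (p i j : k) • (y i * y j)) (i : Fin n) :
    liftHom p y hy (x p i) = y i := by
  simp [liftHom, x]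

theorem adjoin_range_x : Algebra.adjoin k (Set.range (x p)) = ⊤ := by
  have h1 : Set.range (x p) = (RingQuot.mkAlgHom k (Rel p)) '' Set.range (FreeAlgebra.ι k) := by
    rw [← Set.range_comp]; rfl
  rw [h1, ← AlgHom.map_adjoin, FreeAlgebra.adjoin_range_ι, Algebra.map_top,
    AlgHom.range_eq_top]
  exact RingQuot.mkAlgHom_surjective k (Rel p)

theorem algHom_ext {S : Type*} [Ring S] [Algebra k S] {f g : Alg p →ₐ[k] S}
    (h : ∀ i, f (x p i) = g (x p i)) : f = g := by
  apply AlgHom.ext_of_adjoin_eq_top (adjoin_range_x p)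
  rintro _ ⟨i, rfl⟩
  exact h i

/-- The product of the generators along a word. -/
def word (L : List (Fin n)) : Alg p := (L.map (x p)).prod

theorem word_append (L L' : List (Fin n)) : word p (L ++ L') = word p L * word p L' := by
  simp [word]

/-- Adjacent swaps generate all rearrangements, and each costs a unit. Monomials therefore need to
be fixed only up to units, whatever the order of the letters. -/
theorem word_perm (hp_diag : ∀ i, p i i = 1) (hp_inv : ∀ i j, p j i = (p i j)⁻¹)
    {L L' : List (Fin n)} (h : L.Perm L') : ∃ u : kˣ, word p L = (u : k) • word p L' := by
  induction h with
  | nil => exact ⟨1, by simp⟩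
  | cons i _ ih =>
    obtain ⟨u, hu⟩ := ih
    refine ⟨u, ?_⟩
    simp only [word, List.map_cons, List.prod_cons] at hu ⊢
    rw [hu, mul_smul_comm]
  | swap i j L =>
    refine ⟨p i j, ?_⟩
    simp only [word, List.map_cons, List.prod_cons]
    rw [← mul_assoc, x_mul_x p hp_diag hp_inv, smul_mul_assoc, mul_assoc]
  | trans _ _ h1 h2 =>
    obtain ⟨u, hu⟩ := h1
    obtain ⟨v, hv⟩ := h2
    exact ⟨u * v, by rw [hu, hv, smul_smul, Units.val_mul]⟩

theorem x_mul_word (hp_diag : ∀ i, p i i = 1) (hp_inv : ∀ i j, p j i = (p i j)⁻¹)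
    (i : Fin n) (L : List (Fin n)) :
    x p i * word p L = (((L.map fun j => p j i).prod : kˣ) : k) • (word p L * x p i) := by
  induction L with
  | nil => simp [word]
  | cons j L ih =>
    simp only [word, List.map_cons, List.prod_cons] at ih ⊢
    rw [← mul_assoc, x_mul_x p hp_diag hp_inv, smul_mul_assoc, mul_assoc, ih, mul_smul_comm,
      smul_smul, mul_assoc, Units.val_mul]

/-- The scalar by which the operator of `x_i` acts on the monomial of exponent `b`. -/
def theta (i : Fin n) (b : Fin n →₀ ℕ) : kˣ := ∏ j, if j < i then p j i ^ b j else 1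

theorem theta_add_single_of_lt {i j : Fin n} (h : i < j) (b : Fin n →₀ ℕ) :
    theta p j (b + Finsupp.single i 1) = theta p j b * p i j := by
  rw [theta, theta, ← Finset.prod_erase_mul _ _ (Finset.mem_univ i),
    ← Finset.prod_erase_mul Finset.univ (fun l => if l < j then p l j ^ b l else 1)
      (Finset.mem_univ i), mul_assoc]
  congr 1
  · refine Finset.prod_congr rfl fun l hl => ?_
    have : i ≠ l := fun h => Finset.ne_of_mem_erase hl h.symm
    simp [this]
  · simp [h, pow_succ]

theorem theta_add_single_of_not_lt {i j : Fin n} (h : ¬ j < i) (b : Fin n →₀ ℕ) :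
    theta p i (b + Finsupp.single j 1) = theta p i b := by
  refine Finset.prod_congr rfl fun l _ => ?_
  split_ifs with hl
  · have : j ≠ l := by rintro rfl; exact h hl
    simp [this]
  · rfl

/-- The operator of left multiplication by `x_i` on ordered monomials. -/
def leftOp (i : Fin n) : Module.End k ((Fin n →₀ ℕ) →₀ k) :=
  Finsupp.linearCombination k fun b =>
    Finsupp.single (b + Finsupp.single i 1) (theta p i b : k)

theorem leftOp_single (i : Fin n) (b : Fin n →₀ ℕ) (c : k) :
    leftOp p i (Finsupp.single b c) =
      Finsupp.single (b + Finsupp.single i 1) (c * (theta p i b : k)) := by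
  simp [leftOp]

theorem leftOp_mul {i j : Fin n} (h : i < j) :
    leftOp p j * leftOp p i = (p i j : k) • (leftOp p i * leftOp p j) := by
  refine Finsupp.lhom_ext fun b c => ?_
  simp only [Module.End.mul_apply, LinearMap.smul_apply, leftOp_single,
    theta_add_single_of_lt p h, theta_add_single_of_not_lt p h.not_gt, Finsupp.smul_single,
    smul_eq_mul, Units.val_mul]
  rw [add_right_comm]
  congr 1
  ring

/-- The action of the skew polynomial ring on a free module with basis the ordered monomials. -/
def leftRep : Alg p →ₐ[k] Module.End k ((Fin n →₀ ℕ) →₀ k) :=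
  liftHom p (leftOp p) fun _ _ h => leftOp_mul p h

theorem leftRep_word (L : List (Fin n)) :
    ∃ u : kˣ, leftRep p (word p L) (Finsupp.single 0 1) =
      Finsupp.single (Multiset.toFinsupp (L : Multiset (Fin n))) (u : k) := by
  induction L with
  | nil => exact ⟨1, by simp [word]⟩
  | cons i L ih =>
    obtain ⟨u, hu⟩ := ih
    refine ⟨u * theta p i (Multiset.toFinsupp (L : Multiset (Fin n))), ?_⟩
    simp only [word, List.map_cons, List.prod_cons, map_mul] at hu ⊢
    rw [Module.End.mul_apply, hu]
    have : leftRep p (x p i) = leftOp p i := by simp [leftRep]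
    rw [this, leftOp_single, ← Multiset.cons_coe, ← Multiset.singleton_add, map_add,
      Multiset.toFinsupp_singleton, add_comm, Units.val_mul]

/-- A monomial with prescribed exponent vector. -/
def monomial (a : Fin n →₀ ℕ) : Alg p := word p (Finsupp.toMultiset a).toList

/-- In the representation by the operators `leftOp`, the monomial of exponent a sends the basis
vector at 0 to a unit times the basis vector at a. This replaces a confluence argument for the
relations. -/
theorem linearIndependent_monomial : LinearIndependent k (monomial p) := by
  have h : ∀ a, ∃ u : kˣ, leftRep p (monomial p a) (Finsupp.single 0 1) =
      Finsupp.single a (u : k) := by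
    intro a
    obtain ⟨u, hu⟩ := leftRep_word p (Finsupp.toMultiset a).toList
    exact ⟨u, by simpa [monomial] using hu⟩
  choose u hu using h
  apply LinearIndependent.of_comp
    ((LinearMap.applyₗ (Finsupp.single 0 1)) ∘ₗ (leftRep p).toLinearMap)
  have h2 := (Finsupp.basisSingleOne (R := k) (ι := Fin n →₀ ℕ)).linearIndependent.units_smul u
  convert h2 using 1
  ext1 a
  simp [hu, Units.smul_def]

theorem span_monomial (hp_diag : ∀ i, p i i = 1) (hp_inv : ∀ i j, p j i = (p i j)⁻¹) :
    ⊤ ≤ Submodule.span k (Set.range (monomial p)) := by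
  rw [← Algebra.top_toSubmodule, ← adjoin_range_x p, Algebra.adjoin_eq_span, Submodule.span_le]
  intro z hz
  obtain ⟨l, hl, rfl⟩ := Submonoid.exists_list_of_mem_closure hz
  have : ∃ L : List (Fin n), l.prod = word p L := by
    clear hz
    induction l with
    | nil => exact ⟨[], rfl⟩
    | cons y l ih =>
      obtain ⟨L, hL⟩ := ih fun y hy => hl y (List.mem_cons_of_mem _ hy)
      obtain ⟨i, rfl⟩ := hl y List.mem_cons_self
      exact ⟨i :: L, by simp [hL, word]⟩
  obtain ⟨L, hL⟩ := this
  have hperm : L.Perm (Finsupp.toMultiset (Multiset.toFinsupp (L : Multiset (Fin n)))).toList := by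
    rw [← Multiset.coe_eq_coe]; simp
  obtain ⟨u, hu⟩ := word_perm p hp_diag hp_inv hperm
  rw [hL, hu]
  exact Submodule.smul_mem _ _ (Submodule.subset_span ⟨_, rfl⟩)

theorem exists_monomial_mul (hp_diag : ∀ i, p i i = 1) (hp_inv : ∀ i j, p j i = (p i j)⁻¹)
    (a b : Fin n →₀ ℕ) :
    ∃ u : kˣ, monomial p a * monomial p b = (u : k) • monomial p (a + b) := by
  rw [monomial, monomial, ← word_append]
  apply word_perm p hp_diag hp_inv
  rw [← Multiset.coe_eq_coe, ← Multiset.coe_add]; simp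

/-- The monomial basis of the skew polynomial ring. -/
def algBasis (hp_diag : ∀ i, p i i = 1) (hp_inv : ∀ i j, p j i = (p i j)⁻¹) :
    MonomialBasis k (Alg p) n where
  e := Module.Basis.mk (linearIndependent_monomial p) (span_monomial p hp_diag hp_inv)
  -- An arbitrary choice suffices: centrality is computed below from commutation with the
  -- generators.
  χ a b := (exists_monomial_mul p hp_diag hp_inv a b).choose
  mul a b := by
    simp only [Module.Basis.mk_apply]
    exact (exists_monomial_mul p hp_diag hp_inv a b).choose_spec
  one := by simp [monomial, word]

theorem algBasis_single (hp_diag : ∀ i, p i i = 1) (hp_inv : ∀ i j, p j i = (p i j)⁻¹)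
    (i : Fin n) : (algBasis p hp_diag hp_inv).e (Finsupp.single i 1) = x p i := by
  simp [algBasis, monomial, word]

theorem x_mul_algBasis (hp_diag : ∀ i, p i i = 1) (hp_inv : ∀ i j, p j i = (p i j)⁻¹)
    (i : Fin n) (a : Fin n →₀ ℕ) :
    x p i * (algBasis p hp_diag hp_inv).e a =
      ((∏ j, p j i ^ a j : kˣ) : k) • ((algBasis p hp_diag hp_inv).e a * x p i) := by
  simp only [algBasis, Module.Basis.mk_apply, monomial]
  rw [x_mul_word p hp_diag hp_inv]
  congr 2
  rw [← Multiset.prod_coe, ← Multiset.map_coe, Multiset.coe_toList, Finset.prod_multiset_map_count]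
  refine Finset.prod_subset (Finset.subset_univ _) (fun j _ hj => ?_) |>.trans ?_
  · rw [Multiset.mem_toFinset, ← Multiset.count_eq_zero] at hj
    rw [hj, pow_zero]
  · simp

/-- Centrality can be tested on the generators, and moving x_i past the monomial of exponent a costs
exactly the product of the p_ji^(a_j). -/
theorem isCentral_algBasis_iff [IsDomain k] (hp_diag : ∀ i, p i i = 1)
    (hp_inv : ∀ i j, p j i = (p i j)⁻¹) (a : Fin n →₀ ℕ) :
    (algBasis p hp_diag hp_inv).IsCentral a ↔ ∀ i, ∏ j, p j i ^ a j = 1 := by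
  set M := algBasis p hp_diag hp_inv with hM
  have := M.isDomain
  rw [← M.e_mem_center_iff]
  constructor
  · intro h i
    have h1 := x_mul_algBasis p hp_diag hp_inv i a
    rw [← hM, Subalgebra.mem_center_iff.mp h] at h1
    rw [← algBasis_single p hp_diag hp_inv i, ← hM, M.mul] at h1
    have h3 := congrArg (fun z => M.e.repr z (a + Finsupp.single i 1)) h1
    simp only [map_smul, Module.Basis.repr_self, Finsupp.smul_single, smul_eq_mul, mul_one,
      Finsupp.single_eq_same] at h3
    rw [← Units.val_mul, Units.val_inj] at h3
    exact right_eq_mul.mp h3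
  · intro h
    have h1 : Algebra.adjoin k (Set.range (x p)) ≤ Subalgebra.centralizer k {M.e a} := by
      refine Algebra.adjoin_le ?_
      rintro _ ⟨i, rfl⟩
      rw [SetLike.mem_coe, Subalgebra.mem_centralizer_iff]
      rintro _ rfl
      have h1 := x_mul_algBasis p hp_diag hp_inv i a
      rw [h i, Units.val_one, one_smul] at h1
      exact h1.symm
    rw [adjoin_range_x] at h1
    rw [Subalgebra.mem_center_iff]
    intro b
    exact (Subalgebra.mem_centralizer_iff k |>.mp (h1 (Algebra.mem_top (x := b))) _ rfl).symm

end Alg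


/-! ### Ring automorphisms and the center -/

theorem center_smul_mul_smul {k B : Type*} [CommRing k] [Ring B] [Algebra k B]
    (r s : Subalgebra.center k B) (a b : B) : (r • a) * (s • b) = (r * s) • (a * b) := by
  simp only [Subalgebra.smul_def, MulMemClass.coe_mul, smul_eq_mul]
  rw [mul_assoc, ← mul_assoc a, Subalgebra.mem_center_iff.mp s.2 a, mul_assoc, mul_assoc]

/-- Ring automorphisms are the right generality: a k-automorphism of A ⊗ C need not be C-linear,
while the monomial basis there is over C. -/
theorem map_mem_center {k B : Type*} [CommRing k] [Ring B] [Algebra k B] (g : B ≃+* B) {r : B}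
    (hr : r ∈ Subalgebra.center k B) : g r ∈ Subalgebra.center k B :=
  Subalgebra.mem_center_iff.mpr fun b => by
    rw [← g.apply_symm_apply b, ← map_mul, ← map_mul, Subalgebra.mem_center_iff.mp hr]

/-- A ring automorphism restricted to the center. -/
def centerMap (k : Type*) {B : Type*} [CommRing k] [Ring B] [Algebra k B] (g : B ≃+* B) :
    Subalgebra.center k B →+* Subalgebra.center k B where
  toFun r := ⟨g r, map_mem_center g r.2⟩
  map_one' := Subtype.ext (map_one g)
  map_zero' := Subtype.ext (map_zero g)
  map_mul' _ _ := Subtype.ext (map_mul g _ _)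
  map_add' _ _ := Subtype.ext (map_add g _ _)

theorem coe_centerMap {k B : Type*} [CommRing k] [Ring B] [Algebra k B] (g : B ≃+* B)
    (r : Subalgebra.center k B) : (centerMap k g r : B) = g r := rfl

namespace MonomialBasis

variable {k B : Type*} [CommRing k] [Ring B] [Algebra k B] {n : ℕ} (M : MonomialBasis k B n)

theorem coe_prod_center {ι : Type*} (s : Finset ι) (z : ι → Subalgebra.center k B)
    (a : ι → Fin n →₀ ℕ) (hz : ∀ i, ∃ u : kˣ, (z i : B) = (u : k) • M.e (a i)) :
    ∃ u : kˣ, ((∏ i ∈ s, z i : Subalgebra.center k B) : B) = (u : k) • M.e (∑ i ∈ s, a i) := by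
  classical
  induction s using Finset.induction_on with
  | empty => exact ⟨1, by simp [M.one]⟩
  | insert i s hi ih =>
    obtain ⟨u, hu⟩ := ih
    obtain ⟨w, hw⟩ := hz i
    refine ⟨w * u * M.χ (a i) (∑ i ∈ s, a i), ?_⟩
    rw [Finset.prod_insert hi, Finset.sum_insert hi, MulMemClass.coe_mul, hu, hw,
      smul_mul_smul_comm, M.mul, smul_smul, Units.val_mul, Units.val_mul]

section Domain

variable [IsDomain k]

/-- The projection to the center, as a linear map over the center. -/
def projCenter : B →ₗ[Subalgebra.center k B] Subalgebra.center k B where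
  toFun f := ⟨M.proj f, M.proj_mem_center f⟩
  map_add' _ _ := Subtype.ext (map_add _ _ _)
  map_smul' r f := Subtype.ext (M.proj_mul_of_mem_center r.2 f)

theorem coe_projCenter (f : B) : (M.projCenter f : B) = M.proj f := rfl

/-- The projection to the center commutes with ring automorphisms. -/
theorem proj_map {ℓ : ℕ} (hℓ : 0 < ℓ) (hexp : ∀ b, M.IsCentral (ℓ • b)) (g : B ≃+* B) (f : B) :
    M.proj (g f) = g (M.proj f) := by
  have := M.isDomain
  have h0 : M.proj (f - M.proj f) = 0 := by
    rw [map_sub, M.proj_of_mem_center (M.proj_mem_center f), sub_self]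
  have h1 := M.eq_zero_of_proj_eq_zero (M.proj.toAddMonoidHom.comp (g : B →+ B)) hℓ hexp
    (fun a b => by simp [M.proj_mul_comm (g a) (g b)])
    (fun r hr hr0 h hh => by
      simp only [AddMonoidHom.comp_apply, AddMonoidHom.coe_coe, map_mul,
        LinearMap.toAddMonoidHom_coe] at hh ⊢
      rw [M.proj_mul_of_mem_center (map_mem_center g hr)] at hh
      exact (mul_eq_zero.mp hh).resolve_left (by simpa using hr0)) h0
  simp only [AddMonoidHom.comp_apply, AddMonoidHom.coe_coe, map_sub,
    LinearMap.toAddMonoidHom_coe] at h1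
  rw [sub_eq_zero.mp h1, M.proj_of_mem_center (map_mem_center g (M.proj_mem_center f))]

theorem centerMap_projCenter {ℓ : ℕ} (hℓ : 0 < ℓ) (hexp : ∀ b, M.IsCentral (ℓ • b))
    (g : B ≃+* B) (f : B) : centerMap k g (M.projCenter f) = M.projCenter (g f) :=
  Subtype.ext (M.proj_map hℓ hexp g f).symm

theorem centerMap_det {ℓ : ℕ} (hℓ : 0 < ℓ) (hexp : ∀ b, M.IsCentral (ℓ • b))
    (g : B ≃+* B) {ι : Type*} [Fintype ι] [DecidableEq ι] (z z' : ι → B) :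
    centerMap k g (Matrix.of fun i j => M.projCenter (z i * z' j)).det =
      (Matrix.of fun i j => M.projCenter (g (z i) * g (z' j))).det := by
  rw [RingHom.map_det]
  congr 1
  ext1 i j
  simp [M.centerMap_projCenter hℓ hexp]

/-! ### The case of center generated by powers of the variables -/

variable {ℓ : ℕ} [NeZero ℓ]

/-- The reduced exponent vector of a residue class. -/
def res (a : Fin n → ZMod ℓ) : Fin n →₀ ℕ := Finsupp.equivFunOnFinite.symm fun i => (a i).val

omit [NeZero ℓ] in
@[simp] theorem res_apply (a : Fin n → ZMod ℓ) (i : Fin n) : res a i = (a i).val := rfl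

/-- Exponents of central elements vanish modulo ℓ, so the residue class of an exponent tells which
reduced monomial it comes from, and different terms of a relation cannot cancel. -/
theorem linearIndependent_res (hK : ∀ a, M.IsCentral a ↔ ∀ i, ℓ ∣ a i) :
    LinearIndependent (Subalgebra.center k B) fun a : Fin n → ZMod ℓ => M.e (res a) := by
  classical
  rw [Fintype.linearIndependent_iff]
  intro r hr a
  by_contra hne
  have hne' : M.e.repr (r a : B) ≠ 0 := by
    simpa using hne
  obtain ⟨t, ht⟩ := Finsupp.ne_iff.mp hne'
  have hsum := congrArg (fun z => M.e.repr z (t + res a)) hr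
  simp only [map_sum, Finsupp.finsetSum_apply, Subalgebra.smul_def, smul_eq_mul, map_zero,
    Finsupp.coe_zero, Pi.zero_apply] at hsum
  have hdvd : ∀ (b : Fin n → ZMod ℓ) (s : Fin n →₀ ℕ), M.e.repr (r b : B) s ≠ 0 →
      ∀ i, ((s i : ℕ) : ZMod ℓ) = 0 := fun b s hs i =>
    (ZMod.natCast_eq_zero_iff _ _).mpr ((hK s).mp (M.mem_center_iff.mp (r b).2 s hs) i)
  rw [Finset.sum_eq_single a, M.repr_mul_e] at hsum
  · exact ht (by simpa using hsum)
  · intro b _ hb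
    by_contra h
    obtain ⟨s, c, hs, hc, hsc⟩ := M.exists_of_repr_mul_ne_zero h
    have hc' : c = res b := by
      by_contra hcb
      exact hc (by simp [Ne.symm hcb])
    subst hc'
    apply hb
    funext i
    have h1 := congrArg (Nat.cast (R := ZMod ℓ)) (DFunLike.congr_fun hsc i)
    simpa [hdvd b s hs i, hdvd a t ht i] using h1
  · simp

-- Division with remainder on exponents. Only centrality of ℓ-th powers enters, so this also yields
-- finiteness over the center when the center is larger.
omit [NeZero ℓ] in
theorem span_res (hexp : ∀ b, M.IsCentral (ℓ • b)) :
    ⊤ ≤ Submodule.span (Subalgebra.center k B)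
      (Set.range fun a : Fin n → ZMod ℓ => M.e (res a)) := by
  intro f _
  rw [M.eq_sum f]
  refine sum_mem fun c _ => ?_
  generalize M.e.repr f c = s
  set t : Fin n →₀ ℕ := ℓ • Finsupp.equivFunOnFinite.symm fun i => c i / ℓ with ht
  set a : Fin n → ZMod ℓ := fun i => (c i : ZMod ℓ) with ha
  have hc : t + res a = c := by
    ext i
    simp only [Finsupp.add_apply, res_apply, ha, ht, Finsupp.smul_apply, smul_eq_mul,
      Finsupp.equivFunOnFinite_symm_apply_apply, ZMod.val_natCast]
    exact Nat.div_add_mod _ _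
  have htc : M.e t ∈ Subalgebra.center k B :=
    M.e_mem_center_iff.mpr (hexp _)
  have : s • M.e c = (⟨_, Subalgebra.smul_mem _ htc (s * ((M.χ t (res a))⁻¹ : kˣ))⟩ :
      Subalgebra.center k B) • M.e (res a) := by
    rw [Subalgebra.smul_def, smul_eq_mul, smul_mul_assoc, M.mul, smul_smul, mul_assoc,
      Units.inv_mul, mul_one, hc]
  rw [this]
  exact Submodule.smul_mem _ _ (Submodule.subset_span ⟨a, rfl⟩)

/-- The algebra is free over its center on the reduced monomials. -/
def centerBasis (hK : ∀ a, M.IsCentral a ↔ ∀ i, ℓ ∣ a i) :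
    Module.Basis (Fin n → ZMod ℓ) (Subalgebra.center k B) B :=
  Module.Basis.mk (M.linearIndependent_res hK) (M.span_res fun b => (hK _).mpr fun i => by simp)

variable (ℓ) in
/-- The determinant of the projected multiplication table of the reduced monomials. -/
def resDet : Subalgebra.center k B :=
  (Matrix.of fun a b : Fin n → ZMod ℓ => M.projCenter (M.e (res a) * M.e (res b))).det

/-- Change of basis for the center-valued bilinear form (a, b) ↦ π(ab): the matrix is Z D Zʹᵀ, with
D the table of the reduced monomials. Thus `resDet` divides all such determinants. -/
theorem det_eq_mul_resDet (hK : ∀ a, M.IsCentral a ↔ ∀ i, ℓ ∣ a i)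
    (z z' : (Fin n → ZMod ℓ) → B) :
    ∃ r : Subalgebra.center k B,
      (Matrix.of fun i j => M.projCenter (z i * z' j)).det = r * M.resDet ℓ := by
  set Z : Matrix (Fin n → ZMod ℓ) (Fin n → ZMod ℓ) (Subalgebra.center k B) :=
    Matrix.of fun i a => (M.centerBasis hK).repr (z i) a with hZ
  set Z' : Matrix (Fin n → ZMod ℓ) (Fin n → ZMod ℓ) (Subalgebra.center k B) :=
    Matrix.of fun i a => (M.centerBasis hK).repr (z' i) a with hZ'
  set D : Matrix (Fin n → ZMod ℓ) (Fin n → ZMod ℓ) (Subalgebra.center k B) :=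
    Matrix.of fun a b : Fin n → ZMod ℓ => M.projCenter (M.e (res a) * M.e (res b)) with hD
  have h : (Matrix.of fun i j => M.projCenter (z i * z' j)) = Z * D * Z'.transpose := by
    ext1 i j
    rw [Matrix.of_apply, Matrix.mul_apply]
    conv_lhs => rw [← (M.centerBasis hK).sum_repr (z i), ← (M.centerBasis hK).sum_repr (z' j),
      Finset.sum_mul_sum, Finset.sum_comm, map_sum]
    refine Finset.sum_congr rfl fun b _ => ?_
    rw [Matrix.mul_apply, map_sum, Finset.sum_mul]
    refine Finset.sum_congr rfl fun a _ => ?_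
    rw [center_smul_mul_smul, map_smul, smul_eq_mul]
    simp only [hZ, hZ', hD, Matrix.of_apply, Matrix.transpose_apply, centerBasis,
      Module.Basis.mk_apply]
    ring
  refine ⟨Z.det * Z'.transpose.det, ?_⟩
  rw [h, Matrix.det_mul, Matrix.det_mul, resDet]
  ring

/-- The entry at (b, a) is nonzero only for b = -a modulo ℓ, so in the Leibniz expansion only the
permutation a ↦ -a survives, and it gives a product of central monomials. -/
theorem coe_resDet [Fact (1 < ℓ)] (hK : ∀ a, M.IsCentral a ↔ ∀ i, ℓ ∣ a i) :
    ∃ (u : kˣ) (v : Fin n →₀ ℕ), (∀ i, 1 ≤ v i) ∧ (M.resDet ℓ : B) = (u : k) • M.e v := by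
  classical
  have hne : ∀ a b : Fin n → ZMod ℓ, b ≠ -a →
      M.projCenter (M.e (res b) * M.e (res a)) = 0 := by
    intro a b hab
    apply Subtype.ext
    rw [coe_projCenter, M.mul, map_smul, M.proj_e_of_not_central, smul_zero]
    · rfl
    · intro h
      apply hab
      funext i
      have h1 := (ZMod.natCast_eq_zero_iff _ _).mpr ((hK _).mp h i)
      simp only [Finsupp.add_apply, res_apply, Nat.cast_add, ZMod.natCast_val,
        ZMod.cast_id', id] at h1
      exact eq_neg_of_add_eq_zero_left h1
  have heq : ∀ a : Fin n → ZMod ℓ, M.IsCentral (res (-a) + res a) := by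
    intro a
    rw [hK]
    intro i
    rw [← ZMod.natCast_eq_zero_iff]
    simp
  have hdet : M.resDet ℓ = (((Equiv.Perm.sign (Equiv.neg (Fin n → ZMod ℓ)) : ℤˣ) : ℤ) :
      Subalgebra.center k B) * ∏ a : Fin n → ZMod ℓ, M.projCenter (M.e (res (-a)) * M.e (res a)) := by
    rw [resDet, Matrix.det_apply', Finset.sum_eq_single (Equiv.neg (Fin n → ZMod ℓ))]
    · rfl
    · intro σ _ hσ
      have : ∃ a, σ a ≠ -a := by
        by_contra! h
        exact hσ (Equiv.ext h)
      obtain ⟨a, ha⟩ := this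
      rw [Finset.prod_eq_zero (Finset.mem_univ a), mul_zero]
      exact hne a (σ a) ha
    · simp
  obtain ⟨u, hu⟩ := M.coe_prod_center Finset.univ
    (fun a : Fin n → ZMod ℓ => M.projCenter (M.e (res (-a)) * M.e (res a)))
    (fun a => res (-a) + res a) (fun a => ⟨M.χ (res (-a)) (res a), by
      rw [coe_projCenter, M.mul, map_smul, M.proj_e_of_central (heq a)]⟩)
  refine ⟨Units.map (Int.castRingHom k).toMonoidHom
    (Equiv.Perm.sign (Equiv.neg (Fin n → ZMod ℓ))) * u,
    ∑ a : Fin n → ZMod ℓ, (res (-a) + res a), ?_, ?_⟩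
  swap
  · rw [hdet, MulMemClass.coe_mul, hu, Units.val_mul, mul_smul, Algebra.smul_def
      (((Units.map (Int.castRingHom k).toMonoidHom _ : kˣ) : k))]
    congr 1
    rw [Units.coe_map]
    simp
  · intro i
    rw [Finsupp.finsetSum_apply]
    -- The class (1, …, 1) alone already contributes every variable; 1 < ℓ is needed for its
    -- representative to be 1.
    refine le_trans ?_ (Finset.single_le_sum (fun a _ => Nat.zero_le _)
      (Finset.mem_univ (fun _ => (1 : ZMod ℓ))))
    simp [ZMod.val_one]

include M in
/-- A ring automorphism maps scalar multiples by units to scalar multiples by units. -/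
theorem exists_map_smul (g : B ≃+* B) (u : kˣ) :
    ∃ w : kˣ, ∀ z, g ((u : k) • z) = (w : k) • g z := by
  have h : g ((u : k) • 1) * g (((u⁻¹ : kˣ) : k) • 1) = 1 := by
    rw [← map_mul, smul_mul_smul_comm, Units.mul_inv, one_smul, one_mul, map_one]
  obtain ⟨w, hw⟩ := M.exists_eq_smul_one_of_mul_eq_one h
  refine ⟨w, fun z => ?_⟩
  rw [← smul_one_mul, map_mul, hw, smul_one_mul]

omit [IsDomain k] in
theorem eq_of_smul_e_eq {r s : k} {a b : Fin n →₀ ℕ} (hr : r ≠ 0)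
    (h : r • M.e a = s • M.e b) : a = b := by
  classical
  by_contra hab
  have := congrArg (fun z => M.e.repr z a) h
  simp [Ne.symm hab, hr] at this

/-- If exactly the `ℓ`-th powers of monomials are central, then every ring automorphism permutes
the variables up to units. -/
theorem exists_perm_of_ringEquiv [Fact (1 < ℓ)] (hK : ∀ a, M.IsCentral a ↔ ∀ i, ℓ ∣ a i)
    (g : B ≃+* B) :
    ∃ (σ : Equiv.Perm (Fin n)) (c : Fin n → kˣ), ∀ i,
      g (M.e (Finsupp.single i 1)) = (c i : k) • M.e (Finsupp.single (σ i) 1) := by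
  classical
  have := M.isDomain
  have hℓ : 0 < ℓ := NeZero.pos ℓ
  have hexp : ∀ b, M.IsCentral (ℓ • b) := fun b => (hK _).mpr fun i => by simp
  obtain ⟨u, v, hv, hd⟩ := M.coe_resDet hK
  -- The image of `resDet` under g⁻¹ is the determinant of the transported family, hence a multiple
  -- of `resDet`. Applying g shows that g(`resDet`) divides `resDet`.
  obtain ⟨s, hs⟩ : ∃ s, g (M.resDet ℓ) * s = M.resDet ℓ := by
    have h1 := M.centerMap_det hℓ hexp g.symm (fun a : Fin n → ZMod ℓ => M.e (res a))
      (fun a => M.e (res a))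
    obtain ⟨r, hr⟩ := M.det_eq_mul_resDet hK (fun a : Fin n → ZMod ℓ => g.symm (M.e (res a)))
      (fun a => g.symm (M.e (res a)))
    rw [hr] at h1
    have h2 := congrArg (fun z : Subalgebra.center k B => g (z : B)) h1
    refine ⟨g r, ?_⟩
    change _ = g ↑(r * M.resDet ℓ) at h2
    rw [coe_centerMap, g.apply_symm_apply, MulMemClass.coe_mul, map_mul] at h2
    have h3 : g (M.resDet ℓ) * g r = g r * g (M.resDet ℓ) := by
      rw [← map_mul, ← map_mul, Subalgebra.mem_center_iff.mp r.2]
    rw [h3]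
    exact h2.symm
  -- Every variable divides `resDet`, so g(x_i) divides g(`resDet`), which divides a monomial; a
  -- factor of a monomial is a monomial.
  have hx : ∀ i, ∃ (c : kˣ) (α : Fin n →₀ ℕ),
      g (M.e (Finsupp.single i 1)) = (c : k) • M.e α := by
    intro i
    have hle : Finsupp.single i 1 ≤ v := by
      rw [Finsupp.single_le_iff]; exact hv i
    have h1 : M.e (Finsupp.single i 1) * M.e (v - Finsupp.single i 1) =
        (M.χ (Finsupp.single i 1) (v - Finsupp.single i 1) : k) • M.e v := by
      rw [M.mul, add_tsub_cancel_of_le hle]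
    obtain ⟨w, hw⟩ := M.exists_map_smul g
      (u * (M.χ (Finsupp.single i 1) (v - Finsupp.single i 1))⁻¹)
    have h2 : g (M.e (Finsupp.single i 1)) *
        ((w : k) • g (M.e (v - Finsupp.single i 1)) * s) = (u : k) • M.e v := by
      rw [← hd, ← hs, hd, ← mul_assoc, mul_smul_comm, ← map_mul, ← hw, h1, smul_smul,
        Units.val_mul, mul_assoc, Units.inv_mul, mul_one]
    obtain ⟨a, b, r, t, hr, -, -, hrt⟩ := M.factors_of_mul_eq u.ne_zero h2
    refine ⟨Units.mkOfMulEqOne r (t * M.χ a b * (u⁻¹ : kˣ)) ?_, a, hr⟩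
    rw [← mul_assoc, ← mul_assoc, hrt, Units.mul_inv]
  choose c α hcα using hx
  -- Exponent 0 would make g(x_i), and hence x_i, invertible.
  have hα : ∀ i, 1 ≤ (α i).degree := by
    intro i
    rw [Nat.one_le_iff_ne_zero, Ne, Finsupp.degree_eq_zero_iff]
    intro h0
    have h1 := hcα i
    rw [h0, M.one] at h1
    have h2 : g (M.e (Finsupp.single i 1)) * ((((c i)⁻¹ : kˣ) : k) • 1) = 1 := by
      rw [h1, smul_mul_smul_comm, Units.mul_inv, one_smul, one_mul]
    have h3 : M.e (Finsupp.single i 1) * g.symm ((((c i)⁻¹ : kˣ) : k) • 1) = 1 := by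
      apply g.injective
      rw [map_mul, g.apply_symm_apply, h2, map_one]
    obtain ⟨w, hw⟩ := M.exists_eq_smul_one_of_mul_eq_one h3
    rw [← M.one, ← one_smul k (M.e (Finsupp.single i 1))] at hw
    have := DFunLike.congr_fun (M.eq_of_smul_e_eq one_ne_zero hw) i
    simp at this
  -- On exponents g acts by the additive map sending the i-th unit vector to α_i.
  have hmon : ∀ a : Fin n →₀ ℕ, ∃ r : kˣ,
      g (M.e a) = (r : k) • M.e (Finsupp.linearCombination ℕ α a) := by
    intro a
    induction a using Finsupp.induction_linear with
    | zero => exact ⟨1, by simp [M.one]⟩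
    | add a b ha hb =>
      obtain ⟨r, hr⟩ := ha
      obtain ⟨t, ht⟩ := hb
      obtain ⟨w, hw⟩ := M.exists_map_smul g (M.χ a b)⁻¹
      refine ⟨w * (r * t * M.χ (Finsupp.linearCombination ℕ α a) (Finsupp.linearCombination ℕ α b)),
        ?_⟩
      have h1 : M.e (a + b) = (((M.χ a b)⁻¹ : kˣ) : k) • (M.e a * M.e b) := by
        rw [M.mul, smul_smul, Units.inv_mul, one_smul]
      rw [h1, hw, map_mul, hr, ht, smul_mul_smul_comm, M.mul, smul_smul, smul_smul,
        (Finsupp.linearCombination ℕ α).map_add, Units.val_mul, Units.val_mul, Units.val_mul,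
        mul_assoc]
    | single i m =>
      obtain ⟨r, hr⟩ := M.e_pow (Finsupp.single i 1) m
      obtain ⟨t, ht⟩ := M.e_pow (α i) m
      obtain ⟨w, hw⟩ := M.exists_map_smul g r⁻¹
      refine ⟨w * (c i ^ m * t), ?_⟩
      have h1 : M.e (Finsupp.single i m) =
          ((r⁻¹ : kˣ) : k) • M.e (Finsupp.single i 1) ^ m := by
        rw [hr, smul_smul, Units.inv_mul, one_smul, Finsupp.smul_single, smul_eq_mul, mul_one]
      rw [h1, hw, map_pow, hcα, smul_pow, ht, smul_smul, smul_smul,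
        Finsupp.linearCombination_single, Units.val_mul, Units.val_mul, Units.val_pow_eq_pow_val,
        mul_assoc]
  obtain ⟨r, hr⟩ := hmon v
  obtain ⟨w, hw⟩ := M.exists_map_smul g u
  rw [hd, hw, hr, smul_smul] at hs
  obtain ⟨a, b, r', t', hr', -, hab, -⟩ := M.factors_of_mul_eq u.ne_zero hs
  have ha := M.eq_of_smul_e_eq ((Units.val_mul w r) ▸ (w * r).ne_zero) hr'
  -- Since g(x^v) divides x^v, Σ v_i deg α_i ≤ Σ v_i. With all v_i and deg α_i at least 1, this
  -- forces deg α_i = 1.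
  have hdeg : (Finsupp.linearCombination ℕ α v).degree ≤ v.degree := by
    rw [ha, ← hab, map_add]; exact Nat.le_add_right _ _
  have hdeg2 : (Finsupp.linearCombination ℕ α v).degree = ∑ i, v i * (α i).degree := by
    rw [Finsupp.linearCombination_apply, Finsupp.sum_fintype _ _ (by simp), map_sum]
    simp only [map_nsmul, smul_eq_mul]
  rw [hdeg2, Finsupp.degree_eq_sum] at hdeg
  have hα1 : ∀ i, (α i).degree = 1 := by
    intro i
    by_contra hne
    have hlt : ∑ i, v i < ∑ i, v i * (α i).degree := by
      apply Finset.sum_lt_sum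
      · intro j _
        exact Nat.le_mul_of_pos_right _ (hα j)
      · refine ⟨i, Finset.mem_univ i, ?_⟩
        have h2 : 2 ≤ (α i).degree := by have := hα i; omega
        have := hv i
        nlinarith
    omega
  have hσ : ∀ i, ∃ j, α i = Finsupp.single j 1 := by
    intro i
    have := hα1 i
    rw [← Set.mem_ofPred_eq (p := fun d : Fin n →₀ ℕ => d.degree = 1),
      ← Finsupp.range_single_one] at this
    obtain ⟨j, hj⟩ := this
    exact ⟨j, hj.symm⟩
  choose σ hσ using hσ
  have hinj : Function.Injective σ := by
    intro i j hij
    obtain ⟨w, hw⟩ := M.exists_map_smul g.symm (c i * (c j)⁻¹)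
    have h1 : g (M.e (Finsupp.single i 1)) =
        ((c i * (c j)⁻¹ : kˣ) : k) • g (M.e (Finsupp.single j 1)) := by
      rw [hcα, hcα, hσ, hσ, hij, smul_smul, ← Units.val_mul, inv_mul_cancel_right]
    have h2 := congrArg g.symm h1
    rw [hw, g.symm_apply_apply, g.symm_apply_apply,
      ← one_smul k (M.e (Finsupp.single i 1))] at h2
    exact (Finsupp.single_left_inj one_ne_zero).mp (M.eq_of_smul_e_eq one_ne_zero h2)
  refine ⟨Equiv.ofBijective σ (Finite.injective_iff_bijective.mp hinj), c, fun i => ?_⟩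
  rw [hcα, hσ]; rfl

end Domain

end MonomialBasis


/-! ### Degrees in filtered algebras -/

section Filtration

variable {k T : Type*} [CommRing k] [Ring T] [Algebra k T] {F : ℕ → Submodule k T}

theorem deg_le_of_mem {a : T} {m : ℕ} (h : a ∈ F m) : deg F a ≤ m := Nat.sInf_le h

theorem IsAlgFiltration.mem_deg (hF : IsAlgFiltration F) (a : T) : a ∈ F (deg F a) :=
  Nat.sInf_mem (s := {m | a ∈ F m}) (hF.exhaustive a)

theorem IsAlgFiltration.notMem_below_deg (hF : IsAlgFiltration F) {a : T} (ha : a ≠ 0) :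
    a ∉ below F (deg F a) := by
  have h := hF.mem_deg a
  cases hd : deg F a with
  | zero => simpa [below] using ha
  | succ m =>
    intro h'
    have := deg_le_of_mem (show a ∈ F m from h')
    omega

theorem IsAlgFiltration.deg_eq (hF : IsAlgFiltration F) {a : T} {m : ℕ} (h : a ∈ F m)
    (h' : a ∉ below F m) : deg F a = m := by
  refine le_antisymm (deg_le_of_mem h) ?_
  cases m with
  | zero => exact Nat.zero_le _
  | succ m =>
    by_contra hlt
    exact h' (hF.mono (by omega : deg F a ≤ m) (hF.mem_deg a))

theorem GrConnectedDomain.mul_ne_zero (hF : IsAlgFiltration F) (hG : GrConnectedDomain F)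
    {a b : T} (ha : a ≠ 0) (hb : b ≠ 0) : a * b ≠ 0 := by
  intro h
  have := hG.domain _ _ a (hF.mem_deg a) b (hF.mem_deg b) (hF.notMem_below_deg ha)
    (hF.notMem_below_deg hb)
  exact this (h ▸ zero_mem _)

theorem GrConnectedDomain.deg_mul (hF : IsAlgFiltration F) (hG : GrConnectedDomain F)
    {a b : T} (ha : a ≠ 0) (hb : b ≠ 0) : deg F (a * b) = deg F a + deg F b :=
  hF.deg_eq (hF.mul_mem _ _ a (hF.mem_deg a) b (hF.mem_deg b))
    (hG.domain _ _ a (hF.mem_deg a) b (hF.mem_deg b) (hF.notMem_below_deg ha)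
      (hF.notMem_below_deg hb))

theorem GrConnectedDomain.deg_pow (hF : IsAlgFiltration F) (hG : GrConnectedDomain F)
    {a : T} (ha : a ≠ 0) (m : ℕ) : a ^ m ≠ 0 ∧ deg F (a ^ m) = m * deg F a := by
  have : Nontrivial T := ⟨⟨a, 0, ha⟩⟩
  induction m with
  | zero =>
    have : deg F (1 : T) ≤ 0 := deg_le_of_mem hF.one_mem
    refine ⟨by simp, ?_⟩
    rw [pow_zero]; omega
  | succ m ih =>
    rw [pow_succ]
    refine ⟨hG.mul_ne_zero hF ih.1 ha, ?_⟩
    rw [hG.deg_mul hF ih.1 ha, ih.2]; ring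

theorem GrConnectedDomain.deg_list_prod (hF : IsAlgFiltration F) (hG : GrConnectedDomain F)
    [Nontrivial T] {ι : Type*} (L : List ι) (y : ι → T) (hy : ∀ i, y i ≠ 0) :
    (L.map y).prod ≠ 0 ∧ deg F (L.map y).prod = (L.map fun i => deg F (y i)).sum := by
  induction L with
  | nil =>
    have : deg F (1 : T) ≤ 0 := deg_le_of_mem hF.one_mem
    refine ⟨by simp, ?_⟩
    simp only [List.map_nil, List.prod_nil, List.sum_nil]; omega
  | cons i L ih =>
    rw [List.map_cons, List.prod_cons, List.map_cons, List.sum_cons]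
    exact ⟨hG.mul_ne_zero hF (hy i) ih.1, by rw [hG.deg_mul hF (hy i) ih.1, ih.2]⟩

end Filtration

/-! ### The standard filtration and dominating monomials -/

namespace MonomialBasis

variable {k B : Type*} [CommRing k] [Ring B] [Algebra k B] {n : ℕ} (M : MonomialBasis k B n)

theorem smul_e_add (a b : Fin n →₀ ℕ) :
    M.e (a + b) = (((M.χ a b)⁻¹ : kˣ) : k) • (M.e a * M.e b) := by
  rw [M.mul, smul_smul, Units.inv_mul, one_smul]

variable {x : Fin n → B} (hx : ∀ i, M.e (Finsupp.single i 1) = x i)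

include hx

theorem e_mem_stdFiltration (a : Fin n →₀ ℕ) : M.e a ∈ stdFiltration (k := k) x a.degree := by
  induction a using Finsupp.induction_linear with
  | zero =>
    rw [M.one, map_zero, stdFiltration, pow_zero]
    exact Submodule.one_le.mp le_rfl
  | add a b ha hb =>
    rw [M.smul_e_add, map_add, stdFiltration, pow_add]
    exact Submodule.smul_mem _ _ (Submodule.mul_mem_mul ha hb)
  | single i m =>
    obtain ⟨u, hu⟩ := M.e_pow (Finsupp.single i 1) m
    have h1 : M.e (Finsupp.single i m) = ((u⁻¹ : kˣ) : k) • M.e (Finsupp.single i 1) ^ m := by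
      rw [hu, smul_smul, Units.inv_mul, one_smul, Finsupp.smul_single, smul_eq_mul, mul_one]
    rw [h1, hx, Finsupp.degree_single]
    refine Submodule.smul_mem _ _ (Submodule.pow_mem_pow _ ?_ _)
    exact Submodule.mem_sup_right (Submodule.subset_span ⟨i, rfl⟩)

/-- Exponents add under multiplication, which bounds the degrees in (k + Y)^m. Conversely a monomial
of smaller degree is padded with factors 1 from k + Y. -/
theorem mem_stdFiltration {f : B} {m : ℕ} :
    f ∈ stdFiltration (k := k) x m ↔ ∀ a, M.e.repr f a ≠ 0 → a.degree ≤ m := by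
  classical
  constructor
  · intro hf
    suffices h : stdFiltration (k := k) x m ≤
        (Finsupp.supported k k {a : Fin n →₀ ℕ | a.degree ≤ m}).comap
          (M.e.repr : B →ₗ[k] (Fin n →₀ ℕ) →₀ k) by
      intro a ha
      have := h hf
      rw [Submodule.mem_comap, Finsupp.mem_supported] at this
      exact this (Finsupp.mem_support_iff.mpr ha)
    clear hf
    induction m with
    | zero =>
      rw [stdFiltration, pow_zero, Submodule.one_le, Submodule.mem_comap, Finsupp.mem_supported]
      intro a ha
      rw [LinearEquiv.coe_coe, ← M.one, M.e.repr_self, Finset.mem_coe, Finsupp.mem_support_iff,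
        Finsupp.single_apply_ne_zero] at ha
      rw [ha.1]
      exact (map_zero (Finsupp.degree (σ := Fin n) (R := ℕ))).le
    | succ m ih =>
      rw [stdFiltration, pow_succ, Submodule.mul_le]
      intro f hf g hg
      have hf' := ih hf
      rw [Submodule.mem_comap, Finsupp.mem_supported] at hf' ⊢
      intro c hc
      obtain ⟨a, b, ha, hb, rfl⟩ := M.exists_of_repr_mul_ne_zero (Finsupp.mem_support_iff.mp hc)
      have ha' : a.degree ≤ m := hf' (Finsupp.mem_support_iff.mpr ha)
      have hb' : b.degree ≤ 1 := by
        have h1 : (1 ⊔ Submodule.span k (Set.range x) : Submodule k B) ≤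
            (Finsupp.supported k k {a : Fin n →₀ ℕ | a.degree ≤ 1}).comap
            (M.e.repr : B →ₗ[k] (Fin n →₀ ℕ) →₀ k) := by
          refine sup_le ?_ ?_
          · rw [Submodule.one_le, Submodule.mem_comap, LinearEquiv.coe_coe, ← M.one,
              M.e.repr_self]
            exact Finsupp.single_mem_supported _ _ (by simp)
          · rw [Submodule.span_le]
            rintro _ ⟨i, rfl⟩
            rw [SetLike.mem_coe, Submodule.mem_comap, LinearEquiv.coe_coe, ← hx, M.e.repr_self]
            exact Finsupp.single_mem_supported _ _ (by simp)
        have h2 := h1 hg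
        rw [Submodule.mem_comap, Finsupp.mem_supported] at h2
        exact h2 (Finsupp.mem_support_iff.mpr hb)
      change (a + b).degree ≤ m + 1
      rw [map_add]
      exact add_le_add ha' hb'
  · intro h
    rw [M.eq_sum f]
    refine sum_mem fun a ha => Submodule.smul_mem _ _ ?_
    have h1 := h a (Finsupp.mem_support_iff.mp ha)
    have h2 : M.e a * 1 ∈ stdFiltration (k := k) x (a.degree + (m - a.degree)) := by
      rw [stdFiltration, pow_add]
      refine Submodule.mul_mem_mul (M.e_mem_stdFiltration hx a) ?_
      have := Submodule.pow_mem_pow (1 ⊔ Submodule.span k (Set.range x))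
        (Submodule.mem_sup_left (Submodule.one_le.mp le_rfl)) (m - a.degree)
      rwa [one_pow] at this
    rwa [mul_one, Nat.add_sub_cancel' h1] at h2

theorem mem_below_stdFiltration {f : B} {m : ℕ} :
    f ∈ below (stdFiltration (k := k) x) m ↔ ∀ a, M.e.repr f a ≠ 0 → a.degree < m := by
  cases m with
  | zero =>
    simp only [below, Submodule.mem_bot, not_lt_zero, imp_false, not_not]
    constructor
    · rintro rfl; simp
    · intro h
      apply M.e.repr.injective
      ext a
      simpa using h a
  | succ m =>
    simp only [below, Nat.lt_succ_iff]
    exact M.mem_stdFiltration hx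

theorem isAlgFiltration_stdFiltration : IsAlgFiltration (stdFiltration (k := k) x) where
  mono i j hij f hf := by
    rw [M.mem_stdFiltration hx] at hf ⊢
    exact fun a ha => (hf a ha).trans hij
  one_mem := by
    rw [stdFiltration, pow_zero]
    exact Submodule.one_le.mp le_rfl
  mul_mem i j a ha b hb := by
    rw [stdFiltration, pow_add]
    exact Submodule.mul_mem_mul ha hb
  exhaustive f := by
    refine ⟨(M.e.repr f).support.sup Finsupp.degree, (M.mem_stdFiltration hx).mpr ?_⟩
    exact fun a ha => Finset.le_sup (f := Finsupp.degree) (Finsupp.mem_support_iff.mpr ha)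

theorem mem_stdFiltration_zero {f : B} :
    f ∈ stdFiltration (k := k) x 0 ↔ f ∈ Set.range (algebraMap k B) := by
  rw [M.mem_stdFiltration hx]
  constructor
  · intro h
    refine ⟨M.e.repr f 0, ?_⟩
    apply M.e.repr.injective
    ext a
    rw [Algebra.algebraMap_eq_smul_one, ← M.one, map_smul, M.e.repr_self]
    by_cases ha : a = 0
    · subst ha; simp
    · have : M.e.repr f a = 0 := by
        by_contra hne
        exact ha ((Finsupp.degree_eq_zero_iff a).mp (Nat.le_zero.mp (h a hne)))
      rw [this]
      simp [ha]
  · rintro ⟨c, rfl⟩ a ha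
    rw [Algebra.algebraMap_eq_smul_one, ← M.one, map_smul, M.e.repr_self, Finsupp.smul_single,
      Finsupp.single_apply_ne_zero] at ha
    rw [ha.1]
    exact (map_zero Finsupp.degree).le

/-- The domain property comes from a unique sum between the top-degree parts of the supports. -/
theorem grConnectedDomain_stdFiltration [IsDomain k] :
    GrConnectedDomain (stdFiltration (k := k) x) where
  injective := by
    have := M.isDomain
    intro c d h
    rw [Algebra.algebraMap_eq_smul_one, Algebra.algebraMap_eq_smul_one, ← M.one] at h
    have := congrArg (fun z => M.e.repr z 0) h
    simpa using this
  zero_eq _ := M.mem_stdFiltration_zero hx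
  domain i j f hf g hg hf' hg' := by
    rw [M.mem_stdFiltration hx] at hf hg
    rw [M.mem_below_stdFiltration hx] at hf' hg' ⊢
    push Not at hf' hg' ⊢
    obtain ⟨a₁, ha₁, ha₁'⟩ := hf'
    obtain ⟨b₁, hb₁, hb₁'⟩ := hg'
    obtain ⟨a, ha, b, hb, hu⟩ := UniqueSums.uniqueAdd_of_nonempty
      (A := (M.e.repr f).support.filter fun a => a.degree = i)
      (B := (M.e.repr g).support.filter fun b => b.degree = j)
      ⟨a₁, Finset.mem_filter.mpr ⟨Finsupp.mem_support_iff.mpr ha₁, (hf a₁ ha₁).antisymm ha₁'⟩⟩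
      ⟨b₁, Finset.mem_filter.mpr ⟨Finsupp.mem_support_iff.mpr hb₁, (hg b₁ hb₁).antisymm hb₁'⟩⟩
    rw [Finset.mem_filter, Finsupp.mem_support_iff] at ha hb
    -- Uniqueness extends to the full supports: degrees are at most i and j, so a pair of total
    -- degree i + j consists of top-degree exponents.
    have hu' : UniqueAdd (M.e.repr f).support (M.e.repr g).support a b := by
      intro a' b' ha' hb' hab
      have h1 := hf a' (Finsupp.mem_support_iff.mp ha')
      have h2 := hg b' (Finsupp.mem_support_iff.mp hb')
      have h3 := congrArg Finsupp.degree hab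
      rw [map_add, map_add, ha.2, hb.2] at h3
      exact hu (Finset.mem_filter.mpr ⟨ha', by omega⟩) (Finset.mem_filter.mpr ⟨hb', by omega⟩) hab
    refine ⟨a + b, ?_, ?_⟩
    · rw [M.repr_mul_of_uniqueAdd hu']
      simp [ha.1, hb.1]
    · rw [map_add, ha.2, hb.2]

theorem deg_e [IsDomain k] (a : Fin n →₀ ℕ) : deg (stdFiltration (k := k) x) (M.e a) = a.degree := by
  refine (M.isAlgFiltration_stdFiltration hx).deg_eq (M.e_mem_stdFiltration hx a) ?_
  rw [M.mem_below_stdFiltration hx]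
  intro h
  exact lt_irrefl _ (h a (by simp))

theorem deg_smul [IsDomain k] {c : k} (hc : c ≠ 0) (f : B) :
    deg (stdFiltration (k := k) x) (c • f) = deg (stdFiltration (k := k) x) f := by
  unfold deg
  congr 1
  ext m
  simp only [Set.mem_ofPred_eq, M.mem_stdFiltration hx, map_smul, Finsupp.smul_apply, smul_eq_mul,
    ne_eq, mul_eq_zero, hc, false_or]

omit hx in
/-- A nonzero multiple of a monomial in which all variables occur is dominating. -/
theorem isDominating_of_eq_smul {k B : Type u} [CommRing k] [IsDomain k] [Ring B] [Algebra k B]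
    {n : ℕ} (M : MonomialBasis k B n) {x : Fin n → B}
    (hx : ∀ i, M.e (Finsupp.single i 1) = x i) {c : k} (hc : c ≠ 0) {v : Fin n →₀ ℕ}
    (hv : ∀ i, 1 ≤ v i) : IsDominating.{u, v} (k := k) x (c • M.e v) := by
  refine ⟨?_, ?_⟩
  · intro h
    have := congrArg (fun z => M.e.repr z v) h
    simp [hc] at this
  intro T _ _ F _ hF hG y hy
  -- Independence modulo F_0 makes every y_i nonconstant, hence of degree at least 1.
  have hy0 : ∀ i, y i ∉ F 0 := by
    intro i hi
    exact hy.ne_zero i (by simpa using hi)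
  have hyne : ∀ i, y i ≠ 0 := fun i h => hy0 i (h ▸ zero_mem _)
  have hy1 : ∀ i, 1 ≤ deg F (y i) := by
    intro i
    by_contra hlt
    have h0 : deg F (y i) = 0 := by omega
    exact hy0 i (h0 ▸ hF.mem_deg (y i))
  have : Nontrivial T := hG.injective.nontrivial
  have hpow : ∀ i, ∃ u : kˣ, x i ^ v i = (u : k) • M.e (Finsupp.single i (v i)) := by
    intro i
    obtain ⟨u, hu⟩ := M.e_pow (Finsupp.single i 1) (v i)
    exact ⟨u, by rw [← hx, hu, Finsupp.smul_single, smul_eq_mul, mul_one]⟩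
  have hprod : ∃ u : kˣ, ((List.finRange n).map fun i => x i ^ v i).prod = (u : k) • M.e v := by
    choose u hu using hpow
    have h1 : ∀ L : List (Fin n), ∃ w : kˣ, (L.map fun i => x i ^ v i).prod =
        (w : k) • M.e (L.map fun i => Finsupp.single i (v i)).sum := by
      intro L
      induction L with
      | nil => exact ⟨1, by simp [M.one]⟩
      | cons i L ih =>
        obtain ⟨w, hw⟩ := ih
        refine ⟨u i * w * M.χ (Finsupp.single i (v i))
          (L.map fun i => Finsupp.single i (v i)).sum, ?_⟩
        rw [List.map_cons, List.prod_cons, hw, hu, smul_mul_smul_comm, M.mul, smul_smul,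
          List.map_cons, List.sum_cons, Units.val_mul, Units.val_mul]
    obtain ⟨w, hw⟩ := h1 (List.finRange n)
    refine ⟨w, ?_⟩
    rw [hw]
    congr 2
    rw [← List.ofFn_eq_map, List.sum_ofFn, Finsupp.univ_sum_single]
  obtain ⟨u, hu⟩ := hprod
  have hcu : c * ((u⁻¹ : kˣ) : k) ≠ 0 := mul_ne_zero hc (Units.ne_zero _)
  -- The lift is a scalar times a single word, with u correcting for the order of the letters. Its
  -- value at y cannot cancel, since degrees add in T.
  refine ⟨(c * ((u⁻¹ : kˣ) : k)) •
    ((List.finRange n).map fun i => FreeAlgebra.ι k i ^ v i).prod, ?_, Or.inr ?_⟩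
  · rw [map_smul, map_list_prod, List.map_map]
    have : (FreeAlgebra.lift k x) ∘ (fun i => FreeAlgebra.ι k i ^ v i) = fun i => x i ^ v i := by
      funext i; simp
    rw [this, hu, smul_smul, mul_assoc, Units.inv_mul, mul_one]
  have hval : FreeAlgebra.lift k y ((c * ((u⁻¹ : kˣ) : k)) •
      ((List.finRange n).map fun i => FreeAlgebra.ι k i ^ v i).prod) =
      algebraMap k T (c * ((u⁻¹ : kˣ) : k)) * ((List.finRange n).map fun i => y i ^ v i).prod := by
    rw [map_smul, map_list_prod, List.map_map, Algebra.smul_def]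
    congr 3
    funext i; simp
  have hdp := hG.deg_list_prod hF (List.finRange n) (fun i => y i ^ v i)
    (fun i => (hG.deg_pow hF (hyne i) _).1)
  have hne : algebraMap k T (c * ((u⁻¹ : kˣ) : k)) ≠ 0 := by
    intro h
    exact hcu (hG.injective (by rw [h, map_zero]))
  have hsum : (List.map (fun i => deg F (y i ^ v i)) (List.finRange n)).sum =
      ∑ i, v i * deg F (y i) := by
    rw [← List.ofFn_eq_map, List.sum_ofFn]
    exact Finset.sum_congr rfl fun i _ => (hG.deg_pow hF (hyne i) _).2
  have hdeg : deg F (FreeAlgebra.lift k y ((c * ((u⁻¹ : kˣ) : k)) •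
      ((List.finRange n).map fun i => FreeAlgebra.ι k i ^ v i).prod)) ≥
        ∑ i, v i * deg F (y i) := by
    rw [hval, hG.deg_mul hF hne hdp.1, hdp.2, hsum]
    exact Nat.le_add_left _ _
  have hle : ∀ i, v i ≤ v i * deg F (y i) := fun i => Nat.le_mul_of_pos_right _ (hy1 i)
  rw [M.deg_smul hx hc, M.deg_e hx, Finsupp.degree_eq_sum]
  refine ⟨(Finset.sum_le_sum fun i _ => hle i).trans hdeg, ?_⟩
  rintro ⟨i, hi⟩
  refine lt_of_lt_of_le (Finset.sum_lt_sum (fun i _ => hle i) ⟨i, Finset.mem_univ i, ?_⟩) hdeg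
  have := hv i
  nlinarith

omit hx in
/-- The algebra is a finite module over its center as soon as `ℓ`-th powers are central. -/
theorem finite_center [IsDomain k] {ℓ : ℕ} [NeZero ℓ] (hexp : ∀ b, M.IsCentral (ℓ • b)) :
    Module.Finite (Subalgebra.center k B) B := by
  refine ⟨⟨(Set.finite_range fun a : Fin n → ZMod ℓ => M.e (res a)).toFinset, ?_⟩⟩
  rw [Set.Finite.coe_toFinset]
  exact top_le_iff.mp (M.span_res hexp)

end MonomialBasis

/-! ### Polynomial identities -/

/-- The standard polynomial of degree `m`. -/
def standardPoly (m : ℕ) : FreeAlgebra ℤ ℕ :=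
  ∑ σ : Equiv.Perm (Fin m), (Equiv.Perm.sign σ : ℤ) •
    (List.ofFn fun i => FreeAlgebra.ι ℤ (σ i : ℕ)).prod

open Classical in
theorem coeff_standardPoly (m : ℕ) (w : FreeMonoid ℕ) :
    (FreeAlgebra.equivMonoidAlgebraFreeMonoid (standardPoly m)).coeff w =
      ∑ σ : Equiv.Perm (Fin m), if FreeMonoid.ofList (List.ofFn fun i => (σ i : ℕ)) = w then
        (Equiv.Perm.sign σ : ℤ) else 0 := by
  rw [standardPoly, map_sum, MonoidAlgebra.coeff_sum, Finsupp.finsetSum_apply]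
  refine Finset.sum_congr rfl fun σ _ => ?_
  have h1 : FreeAlgebra.equivMonoidAlgebraFreeMonoid
      (List.ofFn fun i => FreeAlgebra.ι ℤ (σ i : ℕ)).prod =
      MonoidAlgebra.of ℤ (FreeMonoid ℕ)
        (FreeMonoid.ofList (List.ofFn fun i => (σ i : ℕ))) := by
    have h2 : FreeMonoid.ofList (List.ofFn fun i => (σ i : ℕ)) =
        (List.ofFn fun i => FreeMonoid.of (σ i : ℕ)).prod := by
      have h3 : ∀ L : List ℕ, FreeMonoid.ofList L = (L.map FreeMonoid.of).prod := by
        intro L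
        induction L with
        | nil => rfl
        | cons a L ih => rw [FreeMonoid.ofList_cons, ih, List.map_cons, List.prod_cons]
      rw [h3, List.map_ofFn]
      rfl
    rw [h2, map_list_prod, map_list_prod, List.map_ofFn, List.map_ofFn]
    congr 2
    funext i
    simp [FreeAlgebra.equivMonoidAlgebraFreeMonoid]
  rw [map_zsmul, h1, MonoidAlgebra.coeff_smul_apply]
  simp [MonoidAlgebra.of, Finsupp.single_apply]

/-- Distinct permutations give distinct words of the same length, and the identity has sign 1. -/
theorem standardPoly_monic (m : ℕ) : ∃ w : FreeMonoid ℕ,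
    (FreeAlgebra.equivMonoidAlgebraFreeMonoid (standardPoly m)).coeff w = 1 ∧
      ∀ w' : FreeMonoid ℕ,
        (FreeAlgebra.equivMonoidAlgebraFreeMonoid (standardPoly m)).coeff w' ≠ 0 →
          w'.length ≤ w.length := by
  refine ⟨FreeMonoid.ofList (List.ofFn fun i : Fin m => (i : ℕ)), ?_, ?_⟩
  · rw [coeff_standardPoly, Finset.sum_eq_single 1]
    · simp
    · intro σ _ hσ
      rw [if_neg]
      intro h
      apply hσ
      have h1 := List.ofFn_injective (FreeMonoid.ofList.injective h)
      ext i
      simpa using congrFun h1 i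
    · simp
  · intro w' hw'
    rw [coeff_standardPoly] at hw'
    obtain ⟨σ, -, hσ⟩ := Finset.exists_ne_zero_of_sum_ne_zero hw'
    have : FreeMonoid.ofList (List.ofFn fun i => (σ i : ℕ)) = w' := by
      by_contra h
      exact hσ (if_neg h)
    rw [← this]
    simp [FreeMonoid.length]

/-- A domain which is a finite module over its center satisfies a standard identity. -/
theorem isPI_of_finite_center (k : Type*) {B : Type*} [CommRing k] [Ring B] [IsDomain B]
    [Algebra k B] [Module.Finite (Subalgebra.center k B) B] : IsPI B := by
  let _ : Algebra (Subalgebra.center k B) B := Algebra.ofModule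
    (fun r a b => by simp only [Subalgebra.smul_def, smul_eq_mul, mul_assoc])
    (fun r a b => by
      simp only [Subalgebra.smul_def, smul_eq_mul]
      rw [← mul_assoc, Subalgebra.mem_center_iff.mp r.2 a, mul_assoc])
  have : Module.IsTorsionFree (Subalgebra.center k B) B :=
    Module.IsTorsionFree.of_smul_eq_zero fun r b h => by
      rw [Subalgebra.smul_def, smul_eq_mul] at h
      exact (mul_eq_zero.mp h).imp Subtype.ext id
  set m := Module.finrank (Subalgebra.center k B) B + 1 with hm
  refine ⟨standardPoly m, standardPoly_monic m, fun y => ?_⟩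
  -- The standard polynomial is the alternatization of the product map. It vanishes on linearly
  -- dependent families, and m exceeds the rank by one.
  have h1 := (MultilinearMap.alternatization
    (MultilinearMap.mkPiAlgebraFin (Subalgebra.center k B) m B)).map_linearDependent
    (fun i => y i) (by
      intro hli
      have := hli.fintype_card_le_finrank
      rw [Fintype.card_fin, hm] at this
      omega)
  rw [MultilinearMap.alternatization_apply] at h1
  rw [standardPoly, map_sum, ← h1]
  refine Finset.sum_congr rfl fun σ _ => ?_
  rw [map_zsmul, map_list_prod, List.map_ofFn, Units.smul_def]
  simp [Function.comp_def]

theorem IsPI.of_ringEquiv {B C : Type*} [Ring B] [Ring C] (g : B ≃+* C) (h : IsPI B) :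
    IsPI C := by
  obtain ⟨f, hf, hy⟩ := h
  refine ⟨f, hf, fun y => ?_⟩
  have h1 := hy (fun i => g.symm (y i))
  have h2 : ((g : B →+* C).toIntAlgHom.comp (FreeAlgebra.lift ℤ fun i => g.symm (y i))) =
      FreeAlgebra.lift ℤ y := by
    ext i; simp
  rw [← h2, AlgHom.comp_apply, h1, map_zero]


/-! ### The regular trace -/

section Trace

variable {k B : Type*} [CommRing k] [Ring B] [Algebra k B]

/-- Left multiplication, as a linear map over the center. -/
def lmulCenter (k : Type*) {B : Type*} [CommRing k] [Ring B] [Algebra k B] (a : B) :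
    Module.End (Subalgebra.center k B) B where
  toFun b := a * b
  map_add' b c := mul_add a b c
  map_smul' r b := by
    simp only [Subalgebra.smul_def, smul_eq_mul, RingHom.id_apply, ← mul_assoc]
    rw [Subalgebra.mem_center_iff.mp r.2 a]

theorem regularTrace_eq (a : B) : regularTrace k a =
    LinearMap.trace (FractionRing (Subalgebra.center k B))
      (FractionRing (Subalgebra.center k B) ⊗[Subalgebra.center k B] B)
      (LinearMap.baseChange (FractionRing (Subalgebra.center k B)) (lmulCenter k a)) := rfl

theorem regularTrace_add (a b : B) :
    regularTrace k (a + b) = regularTrace k a + regularTrace k b := by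
  have : lmulCenter k (a + b) = lmulCenter k a + lmulCenter k b := by
    ext c; exact add_mul a b c
  rw [regularTrace_eq, this, LinearMap.baseChange_add, map_add]; rfl

theorem regularTrace_mul_comm (a b : B) : regularTrace k (a * b) = regularTrace k (b * a) := by
  have h : ∀ a b : B, lmulCenter k (a * b) = lmulCenter k a * lmulCenter k b := by
    intro a b
    ext c; exact mul_assoc a b c
  rw [regularTrace_eq, regularTrace_eq, h, h, LinearMap.baseChange_mul, LinearMap.baseChange_mul,
    LinearMap.trace_mul_comm]

theorem regularTrace_center_mul (r : Subalgebra.center k B) (a : B) :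
    regularTrace k (r * a) =
      algebraMap _ (FractionRing (Subalgebra.center k B)) r * regularTrace k a := by
  have : lmulCenter k ((r : B) * a) = r • lmulCenter k a := by
    ext c; exact mul_assoc (r : B) a c
  rw [regularTrace_eq, this, LinearMap.baseChange_smul, ← algebraMap_smul
    (FractionRing (Subalgebra.center k B)) r, map_smul, smul_eq_mul]; rfl

theorem isDomain_center [IsDomain B] : IsDomain (Subalgebra.center k B) :=
  (Subalgebra.center k B).toSubring.instIsDomainSubtypeMem

theorem regularTrace_one [IsDomain B] [Module.Finite (Subalgebra.center k B) B] :
    regularTrace k (1 : B) = centerRank k B := by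
  have := isDomain_center (k := k) (B := B)
  have h : lmulCenter k (1 : B) = 1 := by
    ext c; exact one_mul c
  have : Module.Free (FractionRing (Subalgebra.center k B))
      (FractionRing (Subalgebra.center k B) ⊗[Subalgebra.center k B] B) :=
    Module.Free.of_divisionRing _ _
  rw [regularTrace_eq, h, LinearMap.baseChange_one, LinearMap.trace_one]; rfl

end Trace

/-! ### Discriminants over the center -/

namespace MonomialBasis

variable {k B : Type*} [CommRing k] [Ring B] [Algebra k B] {n : ℕ} (M : MonomialBasis k B n)
  [IsDomain k] {ℓ : ℕ} [NeZero ℓ]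

/-- The regular trace is the rank times the projection to the center. -/
theorem regularTrace_eq_proj (hexp : ∀ b, M.IsCentral (ℓ • b)) (a : B) :
    regularTrace k a = algebraMap (Subalgebra.center k B) (FractionRing (Subalgebra.center k B))
      ((centerRank k B : Subalgebra.center k B) * M.projCenter a) := by
  have := M.isDomain
  have := isDomain_center (k := k) (B := B)
  have := M.finite_center hexp
  let τ : B →+ FractionRing (Subalgebra.center k B) :=
    AddMonoidHom.mk' (regularTrace k) regularTrace_add
  have h0 : M.proj (a - M.proj a) = 0 := by
    rw [map_sub, M.proj_of_mem_center (M.proj_mem_center a), sub_self]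
  -- The trace is a trace-like map, torsion-free over the center, so it factors through the
  -- projection: tr(a) = tr(π(a)) = π(a) tr(1).
  have h1 : τ (a - M.proj a) = 0 := by
    refine M.eq_zero_of_proj_eq_zero τ (NeZero.pos ℓ) hexp regularTrace_mul_comm ?_ h0
    intro r hr hr0 h hh
    change regularTrace k (((⟨r, hr⟩ : Subalgebra.center k B) : B) * h) = 0 at hh
    rw [regularTrace_center_mul] at hh
    refine (mul_eq_zero.mp hh).resolve_left ?_
    exact fun h => hr0 (congrArg Subtype.val
      (IsFractionRing.injective _ (FractionRing (Subalgebra.center k B)) (h.trans (map_zero _).symm)))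
  rw [map_sub, sub_eq_zero] at h1
  change regularTrace k a = regularTrace k (M.proj a) at h1
  rw [h1, ← mul_one (M.proj a), ← M.coe_projCenter, regularTrace_center_mul, regularTrace_one,
    mul_comm, map_mul, map_natCast]

/-- Each matrix entry carries the factor rank, which leaves the determinant as an m-th power. This
also removes the fraction field from the discriminants. -/
theorem mem_discriminants_iff (hexp : ∀ b, M.IsCentral (ℓ • b)) {m : ℕ} {d : B} :
    d ∈ discriminants k B m ↔ ∃ Z Z' : Fin m → B,
      d = (((centerRank k B : Subalgebra.center k B) ^ m *
        (Matrix.of fun i j => M.projCenter (Z i * Z' j)).det : Subalgebra.center k B) : B) := by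
  have := M.isDomain
  have := isDomain_center (k := k) (B := B)
  have key : ∀ Z Z' : Fin m → B, (Matrix.of fun i j => regularTrace k (Z i * Z' j)).det =
      algebraMap (Subalgebra.center k B) (FractionRing (Subalgebra.center k B))
        ((centerRank k B : Subalgebra.center k B) ^ m *
          (Matrix.of fun i j => M.projCenter (Z i * Z' j)).det) := by
    intro Z Z'
    have h1 : (centerRank k B : Subalgebra.center k B) ^ m *
        (Matrix.of fun i j => M.projCenter (Z i * Z' j)).det =
        ((centerRank k B : Subalgebra.center k B) •
          (Matrix.of fun i j => M.projCenter (Z i * Z' j))).det := by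
      rw [Matrix.det_smul, Fintype.card_fin]
    rw [h1, RingHom.map_det]
    congr 1
    ext1 i j
    rw [Matrix.of_apply, M.regularTrace_eq_proj hexp]; rfl
  constructor
  · rintro ⟨Z, Z', r, rfl, hr⟩
    rw [key] at hr
    exact ⟨Z, Z', congrArg Subtype.val (IsFractionRing.injective _ _ hr)⟩
  · rintro ⟨Z, Z', rfl⟩
    exact ⟨Z, Z', _, rfl, (key Z Z').symm⟩

theorem map_mem_discriminants (hexp : ∀ b, M.IsCentral (ℓ • b)) {m : ℕ} (g : B ≃+* B) {d : B}
    (hd : d ∈ discriminants k B m) : g d ∈ discriminants k B m := by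
  rw [M.mem_discriminants_iff hexp] at hd ⊢
  obtain ⟨Z, Z', rfl⟩ := hd
  refine ⟨fun i => g (Z i), fun i => g (Z' i), ?_⟩
  rw [← M.centerMap_det (NeZero.pos ℓ) hexp, ← coe_centerMap (k := k) g, map_mul, map_pow,
    map_natCast]

theorem isCommonDivisor_map (hexp : ∀ b, M.IsCentral (ℓ • b)) {m : ℕ} (g : B ≃+* B) {d : B}
    (hd : IsCommonDivisor (discriminants k B m) d) :
    IsCommonDivisor (discriminants k B m) (g d) := by
  obtain ⟨hn, hd⟩ := hd
  refine ⟨fun a => ⟨?_, ?_⟩, fun a ha => ?_⟩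
  · obtain ⟨c, hc⟩ := (hn (g.symm a)).1
    exact ⟨g c, by rw [← map_mul, ← hc, map_mul, g.apply_symm_apply]⟩
  · obtain ⟨c, hc⟩ := (hn (g.symm a)).2
    exact ⟨g c, by rw [← map_mul, ← hc, map_mul, g.apply_symm_apply]⟩
  · obtain ⟨c, hc⟩ := hd _ (M.map_mem_discriminants hexp g.symm ha)
    exact ⟨g c, by rw [← map_mul, ← hc, g.apply_symm_apply]⟩

/-- The discriminant is invariant under automorphisms up to units. -/
theorem exists_map_discriminant (hexp : ∀ b, M.IsCentral (ℓ • b)) {m : ℕ} (g : B ≃+* B) {d : B}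
    (hd : IsGcd (discriminants k B m) d) (hd0 : d ≠ 0) : ∃ u : kˣ, g d = (u : k) • d := by
  have := M.isDomain
  -- Automorphisms permute the discriminants, so d and g(d) are both gcds and divide each other;
  -- they differ by a unit, which is a constant.
  obtain ⟨c, hc⟩ := hd.2 _ (M.isCommonDivisor_map hexp g.symm hd.1)
  obtain ⟨c', hc'⟩ := hd.2 _ (M.isCommonDivisor_map hexp g hd.1)
  have h1 : g d = g c * d := by
    conv_lhs => rw [hc, map_mul, g.apply_symm_apply]
  have h2 : g c * c' = 1 := by
    apply mul_right_cancel₀ (b := g d) (by simpa using hd0)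
    rw [mul_assoc, ← hc', ← h1, one_mul]
  obtain ⟨u, hu⟩ := M.exists_eq_smul_one_of_mul_eq_one h2
  exact ⟨u, by rw [h1, hu, smul_one_mul]⟩

theorem centerRank_eq (hK : ∀ a, M.IsCentral a ↔ ∀ i, ℓ ∣ a i) : centerRank k B = ℓ ^ n := by
  have := M.isDomain
  have := isDomain_center (k := k) (B := B)
  have := Module.Free.of_basis (M.centerBasis hK)
  rw [centerRank, Module.finrank_baseChange, Module.finrank_eq_card_basis (M.centerBasis hK)]
  simp

/-- The element is itself a discriminant, that of the reduced monomials, and divides all the others;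
being central, it is normal. -/
theorem isDiscriminant_resDet [Fact (1 < ℓ)] (hK : ∀ a, M.IsCentral a ↔ ∀ i, ℓ ∣ a i) :
    IsDiscriminant k (centerRank k B)
      (((centerRank k B : Subalgebra.center k B) ^ (centerRank k B) * M.resDet ℓ :
        Subalgebra.center k B) : B) := by
  have hexp : ∀ b, M.IsCentral (ℓ • b) := fun b => (hK _).mpr fun i => by simp
  have hcard : Fintype.card (Fin n → ZMod ℓ) = centerRank k B := by
    rw [M.centerRank_eq hK]; simp
  let e : Fin (centerRank k B) ≃ (Fin n → ZMod ℓ) := (Fintype.equivFinOfCardEq hcard).symm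
  have hdet : ∀ Z Z' : Fin (centerRank k B) → B,
      (Matrix.of fun i j => M.projCenter (Z i * Z' j)).det =
      (Matrix.of fun i j => M.projCenter (Z (e.symm i) * Z' (e.symm j))).det := by
    intro Z Z'
    rw [← Matrix.det_submatrix_equiv_self e.symm]
    rfl
  refine ⟨fun a => ⟨_, (M.regularTrace_eq_proj hexp a).symm⟩, ⟨fun a => ⟨⟨a, ?_⟩, ⟨a, ?_⟩⟩, ?_⟩,
    fun c hc => hc.2 _ ?_⟩
  · exact (Subalgebra.mem_center_iff.mp (Subtype.prop _) a).symm
  · exact Subalgebra.mem_center_iff.mp (Subtype.prop _) a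
  · intro a ha
    obtain ⟨Z, Z', rfl⟩ := (M.mem_discriminants_iff hexp).mp ha
    obtain ⟨r, hr⟩ := M.det_eq_mul_resDet hK (fun i => Z (e.symm i)) (fun i => Z' (e.symm i))
    refine ⟨r, ?_⟩
    rw [hdet, hr, ← MulMemClass.coe_mul, mul_left_comm]
  · rw [M.mem_discriminants_iff hexp]
    refine ⟨fun i => M.e (res (e i)), fun i => M.e (res (e i)), ?_⟩
    rw [hdet]
    simp only [Equiv.apply_symm_apply]
    rfl

/-- If exactly the `ℓ`-th powers of monomials are central then the discriminant is dominating. -/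
theorem exists_isDominating {k B : Type u} [CommRing k] [Ring B] [Algebra k B] {n : ℕ}
    (M : MonomialBasis k B n) [IsDomain k] {ℓ : ℕ} [NeZero ℓ] [Fact (1 < ℓ)]
    (hK : ∀ a, M.IsCentral a ↔ ∀ i, ℓ ∣ a i) (hℓk : (ℓ : k) ≠ 0) {x : Fin n → B}
    (hx : ∀ i, M.e (Finsupp.single i 1) = x i) :
    ∃ d : B, IsDiscriminant k (centerRank k B) d ∧ IsDominating.{u, v} (k := k) x d := by
  refine ⟨_, M.isDiscriminant_resDet hK, ?_⟩
  obtain ⟨u, v, hv, hd⟩ := M.coe_resDet hK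
  have : (((centerRank k B : Subalgebra.center k B) ^ (centerRank k B) * M.resDet ℓ :
      Subalgebra.center k B) : B) = ((centerRank k B : k) ^ (centerRank k B) * u) • M.e v := by
    rw [MulMemClass.coe_mul, hd, mul_smul, Algebra.smul_def (_ ^ _)]
    simp
  rw [this]
  refine M.isDominating_of_eq_smul hx (mul_ne_zero (pow_ne_zero _ ?_) u.ne_zero) hv
  rw [M.centerRank_eq hK, Nat.cast_pow]
  exact pow_ne_zero _ hℓk

omit [IsDomain k] in
theorem eq_zero_of_sum_smul_eq_algebraMap {x : Fin n → B}
    (hx : ∀ i, M.e (Finsupp.single i 1) = x i) {c : Fin n → k} {r : k}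
    (h : ∑ i, c i • x i = algebraMap k B r) (i : Fin n) : c i = 0 := by
  classical
  have h1 := congrArg (fun z => M.e.repr z (Finsupp.single i 1)) h
  simp only [← hx, Algebra.algebraMap_eq_smul_one, ← M.one] at h1
  simpa [Finsupp.single_apply, Finsupp.single_left_inj] using h1

/-- A dominating discriminant forces automorphisms to be affine. -/
theorem isAffine_of_isDominating {k B : Type u} [CommRing k] [Ring B] [Algebra k B] {n : ℕ}
    (M : MonomialBasis k B n) [IsDomain k] {ℓ : ℕ} [NeZero ℓ] (hexp : ∀ b, M.IsCentral (ℓ • b))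
    {x : Fin n → B} (hx : ∀ i, M.e (Finsupp.single i 1) = x i) {m : ℕ} {d : B}
    (hd : IsDiscriminant k m d) (hdom : IsDominating.{u, v} (k := k) x d) (g : B ≃ₐ[k] B) :
    IsAffine x g := by
  have := M.isDomain
  have hF := M.isAlgFiltration_stdFiltration hx
  have hG := M.grConnectedDomain_stdFiltration hx
  have hconst : ∀ (c : Fin n → k), ∑ i, c i • g (x i) ∈ stdFiltration (k := k) x 0 →
      ∀ i, c i = 0 := by
    intro c hc
    rw [M.mem_stdFiltration_zero hx] at hc
    obtain ⟨r, hr⟩ := hc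
    refine M.eq_zero_of_sum_smul_eq_algebraMap hx (r := r) ?_
    apply g.injective
    rw [map_sum, AlgEquiv.commutes, hr]
    simp
  -- Domination quantifies over algebras in a larger universe, so B is tested through its universe
  -- lift with the transported filtration.
  let F : ℕ → Submodule k (ULift.{v} B) := fun m =>
    (stdFiltration (k := k) x m).comap (ULift.algEquiv (R := k) (A := B)).toLinearMap
  have hbelow : ∀ m, below F m =
      (below (stdFiltration (k := k) x) m).comap (ULift.algEquiv (R := k) (A := B)).toLinearMap := by
    intro m
    cases m with
    | zero =>
      ext a
      simp only [below, Submodule.mem_bot, Submodule.mem_comap, AlgEquiv.toLinearMap_apply]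
      exact (map_eq_zero_iff _ (ULift.algEquiv (R := k) (A := B)).injective).symm
    | succ m => rfl
  have hF' : IsAlgFiltration F :=
    { mono := fun i j hij a ha => hF.mono hij ha
      one_mem := hF.one_mem
      mul_mem := fun i j a ha b hb => hF.mul_mem i j _ ha _ hb
      exhaustive := fun a => hF.exhaustive a.down }
  have hG' : GrConnectedDomain F :=
    { injective := fun a b hab => hG.injective (congrArg ULift.down hab)
      zero_eq := fun a => by
        refine (hG.zero_eq a.down).trans ⟨?_, ?_⟩
        · rintro ⟨r, hr⟩
          exact ⟨r, ULift.down_injective hr⟩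
        · rintro ⟨r, hr⟩
          exact ⟨r, congrArg ULift.down hr⟩
      domain := fun i j a ha b hb ha' hb' => by
        rw [hbelow] at ha' hb' ⊢
        exact hG.domain i j _ ha _ hb ha' hb' }
  have hPI : IsPI (ULift.{v} B) := by
    have := M.finite_center hexp
    exact (isPI_of_finite_center k (B := B)).of_ringEquiv ULift.ringEquiv.symm
  -- g fixes the constants, so the independence of the x_i modulo k passes to the g(x_i).
  have hli : LinearIndependent k (fun i => (F 0).mkQ (ULift.up.{v} (g (x i)))) := by
    rw [Fintype.linearIndependent_iff]
    intro c hc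
    apply hconst c
    simp_rw [← map_smul] at hc
    rw [← map_sum, Submodule.mkQ_apply, Submodule.Quotient.mk_eq_zero] at hc
    have h1 : (ULift.algEquiv (R := k) (A := B)) (∑ i, c i • ULift.up.{v} (g (x i))) =
        ∑ i, c i • g (x i) := by
      rw [map_sum]; rfl
    rw [← h1]
    exact hc
  obtain ⟨f, hf, hdeg⟩ := hdom.2 (ULift.{v} B) F hPI hF' hG' _ hli
  have hval : FreeAlgebra.lift k (fun i => ULift.up.{v} (g (x i))) f = ULift.up (g d) := by
    have : FreeAlgebra.lift k (fun i => ULift.up.{v} (g (x i))) =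
        ((ULift.algEquiv (R := k) (A := B)).symm.toAlgHom.comp g.toAlgHom).comp
          (FreeAlgebra.lift k x) := by
      ext i; simp
    rw [this, AlgHom.comp_apply, hf]; rfl
  rw [hval] at hdeg
  obtain ⟨u, hu⟩ := M.exists_map_discriminant hexp g.toRingEquiv hd.2 hdom.1
  change g d = _ at hu
  have hgd : deg F (ULift.up (g d)) = deg (stdFiltration (k := k) x) d := by
    change deg (stdFiltration (k := k) x) (g d) = _
    rw [hu, M.deg_smul hx u.ne_zero]
  rw [hgd] at hdeg
  have hne : (ULift.up.{v} (g d)) ≠ 0 := by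
    intro h
    have h2 : g d = 0 := congrArg ULift.down h
    exact hdom.1 (by simpa using h2)
  -- Any lift of d, evaluated at the g(x_i), gives g(d), a unit multiple of d. Its degree is that of
  -- d, which excludes the strict inequality and so any g(x_i) of degree above 1.
  have hle := (hdeg.resolve_left hne).2
  intro i
  have h1 : deg (stdFiltration (k := k) x) (g (x i)) ≤ 1 := by
    by_contra hlt
    exact lt_irrefl _ (hle ⟨i, not_le.mp hlt⟩)
  have h2 : deg (stdFiltration (k := k) x) (g (x i)) ≠ 0 := by
    intro h0
    have h3 := hF.mem_deg (g (x i))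
    rw [h0] at h3
    have := hconst (Pi.single i 1) (by simpa [Pi.single_apply] using h3) i
    simp at this
  omega

end MonomialBasis


/-! ### Central monomials, freeness over the center, polynomial centers -/

namespace MonomialBasis

variable {k B : Type*} [CommRing k] [Ring B] [Algebra k B] {n : ℕ} (M : MonomialBasis k B n)
  [IsDomain k]

theorem isCentral_zero : M.IsCentral 0 := by
  rw [← M.e_mem_center_iff, M.one]; exact one_mem _

theorem IsCentral.nsmul {M : MonomialBasis k B n} {a : Fin n →₀ ℕ} (ha : M.IsCentral a) (t : ℕ) :
    M.IsCentral (t • a) := by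
  induction t with
  | zero => rw [zero_smul]; exact M.isCentral_zero
  | succ t ih => rw [succ_nsmul, M.isCentral_add_iff ih]; exact ha

/-- If ℓ did not divide j, some power of x_s^j would be x_s times an ℓ-th power, making x_s central.
-/
theorem dvd_of_isCentral_single {ℓ : ℕ} (hℓ : ℓ.Prime) (hexp : ∀ b, M.IsCentral (ℓ • b))
    {s : Fin n} (hs : ¬ M.IsCentral (Finsupp.single s 1)) {j : ℕ}
    (hj : M.IsCentral (Finsupp.single s j)) : ℓ ∣ j := by
  by_contra hnd
  apply hs
  have hcop : Nat.Coprime j ℓ := ((Nat.Prime.coprime_iff_not_dvd hℓ).mpr hnd).symm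
  obtain ⟨t, -, ht⟩ := Nat.exists_mul_mod_eq_one_of_coprime hcop hℓ.one_lt
  have h1 : t • Finsupp.single s j =
      ℓ • Finsupp.single s (j * t / ℓ) + Finsupp.single s 1 := by
    rw [Finsupp.smul_single, Finsupp.smul_single, ← Finsupp.single_add, smul_eq_mul, smul_eq_mul,
      ← ht, Nat.div_add_mod, mul_comm]
  have h2 := hj.nsmul t
  rwa [h1, M.isCentral_add_iff (hexp _)] at h2

/-- If the center is larger than the algebra generated by `ℓ`-th powers, some monomial not
involving `x_s` commutes with the variables in the same way as `x_s`. -/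
theorem exists_isCentral_add_single {ℓ : ℕ} (hℓ : ℓ.Prime) (hexp : ∀ b, M.IsCentral (ℓ • b))
    (h : ¬ ∀ a, M.IsCentral a → ∀ i, ℓ ∣ a i) :
    ∃ (s : Fin n) (m : Fin n →₀ ℕ), m s = 0 ∧ M.IsCentral (m + Finsupp.single s (ℓ - 1)) := by
  classical
  push Not at h
  obtain ⟨u, hu, s, hs⟩ := h
  have hcop : Nat.Coprime (u s) ℓ := ((Nat.Prime.coprime_iff_not_dvd hℓ).mpr hs).symm
  obtain ⟨t, -, ht⟩ := Nat.exists_mul_mod_eq_one_of_coprime hcop hℓ.one_lt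
  -- t inverts u_s modulo ℓ, so this multiple of u has s-entry -1 modulo ℓ. The surplus ℓ-th powers
  -- of x_s are then split off.
  have hmod : (t * (ℓ - 1)) * u s % ℓ = ℓ - 1 := by
    have : (t * (ℓ - 1)) * u s = (u s * t) * (ℓ - 1) := by ring
    rw [this, Nat.mul_mod, ht, one_mul, Nat.mod_mod, Nat.mod_eq_of_lt (by have := hℓ.pos; omega)]
  set v := (t * (ℓ - 1)) • u with hv
  have hvs : v s % ℓ = ℓ - 1 := by simpa [hv] using hmod
  refine ⟨s, v.erase s, Finsupp.erase_same, ?_⟩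
  have h1 : v = ℓ • Finsupp.single s (v s / ℓ) + (v.erase s + Finsupp.single s (ℓ - 1)) := by
    conv_lhs => rw [← Finsupp.erase_add_single s v]
    have h3 : v s = ℓ * (v s / ℓ) + (ℓ - 1) := by
      conv_lhs => rw [← Nat.div_add_mod (v s) ℓ, hvs]
    conv_lhs => rw [h3]
    rw [Finsupp.single_add, Finsupp.smul_single, smul_eq_mul]
    abel
  have h2 := hu.nsmul (t * (ℓ - 1))
  rw [← hv, h1] at h2
  rwa [M.isCentral_add_iff (hexp _)] at h2

/-- Freeness over the center forces the center to be generated by `ℓ`-th powers. -/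
theorem dvd_of_free_center {ℓ : ℕ} (hℓ : ℓ.Prime) (hexp : ∀ b, M.IsCentral (ℓ • b))
    (H1 : ∀ i, ¬ M.IsCentral (Finsupp.single i 1))
    (hfree : Module.Free (Subalgebra.center k B) B) :
    ∀ a, M.IsCentral a → ∀ i, ℓ ∣ a i := by
  classical
  by_contra hnot
  obtain ⟨s, m, hms, hm⟩ := M.exists_isCentral_add_single hℓ hexp hnot
  set a := m + Finsupp.single s (ℓ - 1) with ha
  let b := Module.Free.chooseBasis (Subalgebra.center k B) B
  have hsℓ : M.IsCentral (Finsupp.single s ℓ) := by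
    have := hexp (Finsupp.single s 1)
    rwa [Finsupp.smul_single, smul_eq_mul, mul_one] at this
  let za : Subalgebra.center k B := ⟨_, M.e_mem_center_iff.mpr hm⟩
  let zs : Subalgebra.center k B := ⟨_, M.e_mem_center_iff.mpr hsℓ⟩
  have hadd : Finsupp.single s ℓ + m = a + Finsupp.single s 1 := by
    rw [ha, add_assoc, ← Finsupp.single_add, Nat.sub_add_cancel hℓ.one_lt.le, add_comm]
  -- Both sides are x_s^ℓ e_m up to units: grouped as (e_m x_s^(ℓ-1)) x_s, and as x_s^ℓ · e_m.
  have hrel : (za • M.e (Finsupp.single s 1) : B) =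
      (((M.χ a (Finsupp.single s 1) * (M.χ (Finsupp.single s ℓ) m)⁻¹ : kˣ) : k) • zs :
        Subalgebra.center k B) • M.e m := by
    rw [Subalgebra.smul_def, Subalgebra.smul_def, SetLike.val_smul, smul_eq_mul, smul_eq_mul]
    change M.e a * _ = (_ • M.e (Finsupp.single s ℓ)) * _
    rw [smul_mul_assoc, M.mul, M.mul, smul_smul, hadd, ← Units.val_mul, inv_mul_cancel_right]
  have hx : (M.e (Finsupp.single s 1) : B) =
      ∑ j ∈ (b.repr (M.e (Finsupp.single s 1))).support,
        b.repr (M.e (Finsupp.single s 1)) j • b j := by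
    conv_lhs => rw [← b.linearCombination_repr (M.e (Finsupp.single s 1)),
      Finsupp.linearCombination_apply, Finsupp.sum]
  have h1 := congrArg (fun z => M.e.repr z (Finsupp.single s 1)) hx
  simp only [M.e.repr_self, Finsupp.single_eq_same, map_sum, Finsupp.finsetSum_apply] at h1
  -- Some basis element j contributes to the coefficient of x_s. The central factor contributes 1 or
  -- x_s, and x_s is not central, so the j-th coordinate of x_s has a nonzero constant term.
  obtain ⟨j, -, hj⟩ := Finset.exists_ne_zero_of_sum_ne_zero (h1 ▸ one_ne_zero)
  rw [Subalgebra.smul_def, smul_eq_mul] at hj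
  obtain ⟨w, w', hw, -, hww⟩ := M.exists_of_repr_mul_ne_zero hj
  have hwc := M.mem_center_iff.mp (Subtype.prop _) w hw
  have hw0 : w = 0 := by
    have hle : w ≤ Finsupp.single s 1 := hww ▸ le_self_add
    have hws : w = Finsupp.single s (w s) := by
      ext i
      by_cases his : i = s
      · subst his; simp
      · have := hle i
        rw [Finsupp.single_eq_of_ne his] at this ⊢
        omega
    have h2 : w s ≤ 1 := by simpa using hle s
    have h3 : w s ≠ 1 := by
      intro h3
      rw [h3] at hws
      exact H1 s (hws ▸ hwc)
    rw [hws, show w s = 0 by omega, Finsupp.single_zero]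
  subst hw0
  -- On j-th coordinates, the left side contains the monomial a, whose s-exponent is ℓ - 1, while
  -- every monomial on the right is a multiple of x_s^ℓ.
  have h4 := congrArg (fun z => b.repr z j) hrel
  simp only [map_smul, Finsupp.smul_apply, smul_eq_mul] at h4
  have h5 := congrArg (fun z : Subalgebra.center k B => M.e.repr (z : B) (a + 0)) h4
  simp only [MulMemClass.coe_mul] at h5
  rw [M.repr_e_mul] at h5
  have h6 := h5 ▸ mul_ne_zero hw (Units.ne_zero _)
  rw [SetLike.val_smul, smul_mul_assoc, map_smul, Finsupp.smul_apply, smul_eq_mul] at h6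
  obtain ⟨c, d, hc, -, hcd⟩ := M.exists_of_repr_mul_ne_zero (right_ne_zero_of_mul h6)
  change M.e.repr (M.e (Finsupp.single s ℓ)) c ≠ 0 at hc
  rw [M.e.repr_self, Finsupp.single_apply_ne_zero] at hc
  rw [hc.1] at hcd
  have h7 := DFunLike.congr_fun hcd s
  have := hℓ.pos
  simp [ha, hms] at h7
  omega

/-- The central element `x_i ^ ℓ`. -/
def centralPow {ℓ : ℕ} (hexp : ∀ b, M.IsCentral (ℓ • b)) (i : Fin n) : Subalgebra.center k B :=
  ⟨M.e (ℓ • Finsupp.single i 1), M.e_mem_center_iff.mpr (hexp _)⟩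

theorem coe_prod_centralPow {ℓ : ℕ} (hexp : ∀ b, M.IsCentral (ℓ • b)) (a : Fin n →₀ ℕ) :
    ∃ u : kˣ, ((∏ i, M.centralPow hexp i ^ a i : Subalgebra.center k B) : B) =
      (u : k) • M.e (ℓ • a) := by
  obtain ⟨u, hu⟩ := M.coe_prod_center Finset.univ (fun i => M.centralPow hexp i ^ a i)
    (fun i => a i • ℓ • Finsupp.single i 1) (fun i => by
      obtain ⟨u, hu⟩ := M.e_pow (ℓ • Finsupp.single i 1) (a i)
      exact ⟨u, hu⟩)
  refine ⟨u, ?_⟩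
  rw [hu]
  congr 2
  simp_rw [smul_comm _ ℓ]
  rw [← Finset.smul_sum]
  congr 1
  conv_rhs => rw [← Finsupp.univ_sum_single a]
  simp

/-- The center is a polynomial ring when it is generated by the `ℓ`-th powers. -/
theorem exists_center_algEquiv {ℓ : ℕ} (hℓ : 0 < ℓ)
    (hK : ∀ a, M.IsCentral a ↔ ∀ i, ℓ ∣ a i) :
    Nonempty (Subalgebra.center k B ≃ₐ[k] MvPolynomial (Fin n) k) := by
  classical
  have hexp : ∀ b, M.IsCentral (ℓ • b) := fun b => (hK _).mpr fun i => by simp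
  choose u hu using M.coe_prod_centralPow hexp
  let f : MvPolynomial (Fin n) k →ₐ[k] Subalgebra.center k B :=
    MvPolynomial.aeval (M.centralPow hexp)
  have hf : ∀ a c, ((f (MvPolynomial.monomial a c) : Subalgebra.center k B) : B) =
      (c * u a) • M.e (ℓ • a) := by
    intro a c
    rw [MvPolynomial.aeval_monomial, Finsupp.prod_fintype _ _ (by simp), MulMemClass.coe_mul, hu,
      mul_smul, Algebra.smul_def c]
    rfl
  refine ⟨(AlgEquiv.ofBijective f ⟨?_, ?_⟩).symm⟩
  · rw [injective_iff_map_eq_zero]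
    intro g hg
    ext a
    have h1 : M.e.repr ((f g : Subalgebra.center k B) : B) (ℓ • a) = g.coeff a * u a := by
      conv_lhs => rw [g.as_sum]
      rw [map_sum, AddSubmonoidClass.coe_finsetSum, map_sum, Finsupp.finsetSum_apply,
        Finset.sum_eq_single a]
      · rw [hf]; simp
      · intro b _ hb
        have : ℓ • b ≠ ℓ • a := fun h => hb (by
          ext i
          have := DFunLike.congr_fun h i
          simpa [hℓ.ne'] using this)
        rw [hf]; simp [this]
      · intro ha
        rw [hf, MvPolynomial.notMem_support_iff.mp ha]; simp
    rw [hg] at h1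
    simpa using h1.symm
  · intro r
    suffices h : (r : B) ∈ f.range.map (Subalgebra.center k B).val by
      obtain ⟨r', ⟨g, hg⟩, hr'⟩ := h
      exact ⟨g, Subtype.ext ((congrArg Subtype.val hg).trans hr')⟩
    rw [M.eq_sum (r : B)]
    refine sum_mem fun c hc => Subalgebra.smul_mem _ ?_ _
    have hdvd := (hK c).mp (M.mem_center_iff.mp r.2 c (Finsupp.mem_support_iff.mp hc))
    choose q hq using hdvd
    have hcq : c = ℓ • Finsupp.equivFunOnFinite.symm q := by
      ext i; simp [← hq]
    set a := Finsupp.equivFunOnFinite.symm q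
    refine ⟨f (MvPolynomial.monomial a ((u a)⁻¹ : kˣ)), ⟨_, rfl⟩, ?_⟩
    change ((f _ : Subalgebra.center k B) : B) = _
    rw [hf, Units.inv_mul, one_smul, hcq]

/-- If the center is a polynomial ring, it is generated by the `ℓ`-th powers. -/
theorem dvd_of_center_algEquiv {ℓ : ℕ} (hℓ : ℓ.Prime) (hexp : ∀ b, M.IsCentral (ℓ • b))
    (H1 : ∀ i, ¬ M.IsCentral (Finsupp.single i 1)) {σ : Type*} [Finite σ]
    (ψ : Subalgebra.center k B ≃ₐ[k] MvPolynomial σ k) :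
    ∀ a, M.IsCentral a → ∀ i, ℓ ∣ a i := by
  classical
  -- k need not be factorial, so factorizations are studied over its fraction field; `hclear` brings
  -- them back to the center after clearing denominators.
  let K := FractionRing k
  let φ : MvPolynomial σ k →+* MvPolynomial σ K := MvPolynomial.map (algebraMap k K)
  have hφ : Function.Injective φ :=
    MvPolynomial.map_injective _ (IsFractionRing.injective k K)
  have hclear : ∀ Q : MvPolynomial σ K, ∃ (c : k) (q : Subalgebra.center k B), c ≠ 0 ∧
      φ (ψ q) = MvPolynomial.C (algebraMap k K c) * Q := by
    intro Q
    obtain ⟨⟨c, hc⟩, h⟩ := IsLocalization.exist_integer_multiples_of_finset (nonZeroDivisors k)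
      (Q.support.image fun a => Q.coeff a)
    have h' : ∀ a, ∃ r : k, algebraMap k K r = algebraMap k K c * Q.coeff a := by
      intro a
      by_cases ha : a ∈ Q.support
      · obtain ⟨r, hr⟩ := h _ (Finset.mem_image_of_mem _ ha)
        exact ⟨r, by rw [hr, Algebra.smul_def]⟩
      · exact ⟨0, by rw [MvPolynomial.notMem_support_iff.mp ha]; simp⟩
    choose r hr using h'
    refine ⟨c, ψ.symm (∑ a ∈ Q.support, MvPolynomial.monomial a (r a)),
      nonZeroDivisors.ne_zero hc, ?_⟩
    rw [ψ.apply_symm_apply, map_sum]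
    conv_rhs => rw [Q.as_sum, Finset.mul_sum]
    refine Finset.sum_congr rfl fun a _ => ?_
    rw [MvPolynomial.map_monomial, hr, MvPolynomial.C_mul_monomial]
  have hC : ∀ (c : k) (q : Subalgebra.center k B),
      MvPolynomial.C (algebraMap k K c) * φ (ψ q) = φ (ψ (c • q)) := by
    intro c q
    rw [map_smul, MvPolynomial.smul_eq_C_mul, map_mul, MvPolynomial.map_C]
  have hinj : ∀ q q' : Subalgebra.center k B, φ (ψ q) = φ (ψ q') → (q : B) = q' :=
    fun q q' h => congrArg Subtype.val (ψ.injective (hφ h))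
  have hCne : ∀ c : k, c ≠ 0 → IsUnit (MvPolynomial.C (algebraMap k K c) : MvPolynomial σ K) :=
    fun c hc => (IsUnit.mk0 _ (by
      rw [Ne, IsFractionRing.to_map_eq_zero_iff]; exact hc)).map MvPolynomial.C
  have hsingle : ∀ i : Fin n, ℓ • Finsupp.single i 1 = (Finsupp.single i ℓ : Fin n →₀ ℕ) := by
    intro i; simp
  let P : Fin n → MvPolynomial σ K := fun i => φ (ψ (M.centralPow hexp i))
  -- divisibility among the images
  have hPdvd : ∀ i (Q : Subalgebra.center k B) (c : k) (v : Fin n →₀ ℕ), c ≠ 0 →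
      (Q : B) = c • M.e v → P i ∣ φ (ψ Q) → ℓ ≤ v i := by
    rintro i Q c v hc hQ ⟨G, hG⟩
    obtain ⟨d, g, hd, hg⟩ := hclear G
    have h1 : φ (ψ (d • Q)) = φ (ψ (M.centralPow hexp i * g)) := by
      rw [map_mul, map_mul, hg, ← hC, hG]; ring
    have h2 := hinj _ _ h1
    rw [SetLike.val_smul, hQ, smul_smul, MulMemClass.coe_mul] at h2
    obtain ⟨a, b, r, s, ha, -, hab, hrs⟩ := M.factors_of_mul_eq (mul_ne_zero hd hc) h2.symm
    change M.e (ℓ • Finsupp.single i 1) = _ at ha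
    rw [← one_smul k (M.e _)] at ha
    have := M.eq_of_smul_e_eq one_ne_zero ha
    rw [← hab, ← this]
    simp
  -- A factorization of P_i comes from central monomials x_i^a and x_i^b with a + b = ℓ. Since x_i
  -- is not central and ℓ is prime, ℓ divides a, so one factor is constant.
  have hirr : ∀ i, Irreducible (P i) := by
    intro i
    refine ⟨fun hu => ?_, fun F G hFG => ?_⟩
    · have := hPdvd i 1 1 0 one_ne_zero (by rw [M.one, one_smul]; rfl) (hu.dvd)
      have := hℓ.pos
      simp at *
      omega
    · obtain ⟨c, f, hc, hf⟩ := hclear F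
      obtain ⟨d, g, hd, hg⟩ := hclear G
      have h1 : φ (ψ (f * g)) = φ (ψ ((c * d) • M.centralPow hexp i)) := by
        rw [← hC, map_mul, map_mul, hf, hg]
        change _ = _ * P i
        rw [hFG, map_mul, MvPolynomial.C_mul]; ring
      have h2 := hinj _ _ h1
      rw [SetLike.val_smul, MulMemClass.coe_mul] at h2
      change (f : B) * g = (c * d) • M.e (ℓ • Finsupp.single i 1) at h2
      obtain ⟨a, b, r, s, ha, hb, hab, hrs⟩ := M.factors_of_mul_eq (mul_ne_zero hc hd) h2
      have hrs' : r * s ≠ 0 := by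
        intro h
        rw [h, zero_mul] at hrs
        exact mul_ne_zero hc hd hrs.symm
      have hr := left_ne_zero_of_mul hrs'
      have hs := right_ne_zero_of_mul hrs'
      rw [hsingle] at hab
      have hunit : ∀ (q : Subalgebra.center k B) (t e : k) (Q : MvPolynomial σ K), t ≠ 0 →
          e ≠ 0 → (q : B) = t • M.e 0 → φ (ψ q) = MvPolynomial.C (algebraMap k K e) * Q →
          IsUnit Q := by
        intro q t e Q ht he hq hQ
        have h3 : q = t • 1 := Subtype.ext (by rw [hq, M.one]; rfl)
        have h4 : IsUnit (φ (ψ q)) := by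
          rw [h3, ← hC, map_one, map_one, mul_one]; exact hCne t ht
        rw [hQ] at h4
        exact isUnit_of_mul_isUnit_right h4
      have hac : M.IsCentral a := M.mem_center_iff.mp f.2 a (by rw [ha]; simpa using hr)
      have has : ∀ j, j ≠ i → a j = 0 ∧ b j = 0 := by
        intro j hj
        have := DFunLike.congr_fun hab j
        rw [Finsupp.add_apply, Finsupp.single_eq_of_ne hj] at this
        omega
      have hai : a i + b i = ℓ := by
        simpa using DFunLike.congr_fun hab i
      have ha' : a = Finsupp.single i (a i) := by
        ext j
        by_cases hj : j = i
        · subst hj; simp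
        · rw [Finsupp.single_eq_of_ne hj, (has j hj).1]
      have hdvd := M.dvd_of_isCentral_single hℓ hexp (H1 i) (ha' ▸ hac)
      rcases Nat.eq_zero_or_pos (a i) with h0 | hpos
      · left
        have : a = 0 := by rw [ha', h0, Finsupp.single_zero]
        exact hunit f r c F hr hc (this ▸ ha) hf
      · right
        have h5 := Nat.le_of_dvd hpos hdvd
        have : b = 0 := by
          ext j
          by_cases hj : j = i
          · subst hj; simp; omega
          · exact (has j hj).2
        exact hunit g s d G hs hd (this ▸ hb) hg
  have hprime : ∀ i, Prime (P i) := fun i => (hirr i).prime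
  intro a ha i
  let za : Subalgebra.center k B := ⟨M.e a, M.e_mem_center_iff.mpr ha⟩
  obtain ⟨u, hu⟩ := M.e_pow a ℓ
  obtain ⟨w, hw⟩ := M.coe_prod_centralPow hexp a
  -- Up to units, (x^a)^ℓ is the product of the (x_j^ℓ)^(a_j). Taking multiplicities at the prime
  -- P_i gives ℓ times the multiplicity of x^a equal to a_i.
  have hpow : (w : k) • za ^ ℓ = (u : k) • ∏ i, M.centralPow hexp i ^ a i := by
    apply Subtype.ext
    rw [SetLike.val_smul, SetLike.val_smul, hw, SubmonoidClass.coe_pow]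
    change (w : k) • M.e a ^ ℓ = _
    rw [hu, smul_smul, smul_smul, mul_comm]
  have hpow' : MvPolynomial.C (algebraMap k K w) * φ (ψ za) ^ ℓ =
      MvPolynomial.C (algebraMap k K u) * ∏ j, P j ^ a j := by
    have := congrArg (fun z => φ (ψ z)) hpow
    simp only [← hC] at this
    rw [map_pow, map_pow, map_prod, map_prod] at this
    simp_rw [map_pow] at this
    exact this
  have hm := congrArg (emultiplicity (P i)) hpow'
  rw [emultiplicity_mul (hprime i), emultiplicity_mul (hprime i), emultiplicity_pow (hprime i),
    Finset.emultiplicity_prod (hprime i)] at hm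
  have hzero : ∀ v : kˣ, emultiplicity (P i) (MvPolynomial.C (algebraMap k K v)) = 0 := by
    intro v
    rw [emultiplicity_eq_zero]
    intro h
    exact (hprime i).not_isUnit (isUnit_of_dvd_unit h (hCne v v.ne_zero))
  rw [hzero, hzero, zero_add, zero_add, Finset.sum_eq_single i] at hm
  · rw [emultiplicity_pow (hprime i), (FiniteMultiplicity.of_prime_left (hprime i)
      (hprime i).ne_zero).emultiplicity_self, mul_one] at hm
    have hfin : emultiplicity (P i) (φ (ψ za)) ≠ ⊤ := by
      intro h
      rw [h, ENat.mul_top (by exact_mod_cast hℓ.ne_zero)] at hm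
      exact ENat.natCast_ne_top _ hm.symm
    obtain ⟨t, ht⟩ := ENat.ne_top_iff_exists.mp hfin
    rw [← ht] at hm
    exact ⟨t, by exact_mod_cast hm.symm⟩
  · intro j _ hj
    rw [emultiplicity_eq_zero]
    intro h
    have h1 := (hprime i).dvd_of_dvd_pow h
    have h2 := hPdvd i (M.centralPow hexp j) 1 (ℓ • Finsupp.single j 1) one_ne_zero
      (one_smul _ _).symm h1
    have := hℓ.pos
    simp [hj] at h2
    omega
  · simp

end MonomialBasis


/-! ### Locally nilpotent derivations -/

section Derivation

variable {k B : Type*} [CommRing k] [Ring B] [Algebra k B] {δ : B →ₗ[k] B}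

/-- In the Leibniz expansion of δ^(i+j) only the term with i derivatives on a and j on b is not
killed. -/
theorem iterate_mul_of_top (hδ : ∀ a b, δ (a * b) = δ a * b + a * δ b) {i j : ℕ} {a b : B}
    (ha : (δ ^ (i + 1)) a = 0) (hb : (δ ^ (j + 1)) b = 0) :
    (δ ^ (i + j)) (a * b) = (i + j).choose i • ((δ ^ i) a * (δ ^ j) b) := by
  have hs : ∀ (m : ℕ) (c : B), (δ ^ (m + 1)) c = (δ ^ m) (δ c) := fun m c => by
    rw [pow_succ, Module.End.mul_apply]
  induction h : i + j generalizing i j a b with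
  | zero =>
    obtain rfl : i = 0 := by omega
    obtain rfl : j = 0 := by omega
    simp
  | succ N ih =>
    rw [hs, hδ, map_add]
    rcases i with _ | i
    · obtain rfl : j = N + 1 := by omega
      have ha' : δ a = 0 := by simpa using ha
      rw [ha', zero_mul, map_zero, zero_add,
        ih (i := 0) (j := N) ha (by rw [← hs]; exact hb) (by omega)]
      simp [hs]
    rcases j with _ | j
    · obtain rfl : i = N := by omega
      have hb' : δ b = 0 := by simpa using hb
      rw [hb', mul_zero, map_zero, add_zero,
        ih (i := i) (j := 0) (by rw [← hs]; exact ha) hb (by omega)]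
      simp [hs]
    · rw [ih (i := i) (j := j + 1) (by rw [← hs]; exact ha) hb (by omega),
        ih (i := i + 1) (j := j) ha (by rw [← hs]; exact hb) (by omega),
        ← hs, ← hs, ← add_smul, Nat.choose_succ_succ]

theorem iterate_mul_eq_zero (hδ : ∀ a b, δ (a * b) = δ a * b + a * δ b) {i j : ℕ} {a b : B}
    (ha : (δ ^ i) a = 0) (hb : (δ ^ j) b = 0) : (δ ^ (i + j)) (a * b) = 0 := by
  have h1 := iterate_mul_of_top hδ (i := i) (j := j) (a := a) (b := b)
    (by rw [pow_succ', Module.End.mul_apply, ha, map_zero])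
    (by rw [pow_succ', Module.End.mul_apply, hb, map_zero])
  rw [h1, ha, zero_mul, smul_zero]

theorem exists_top (hnil : ∀ a, ∃ m : ℕ, (δ ^ m) a = 0) {a : B} (ha : a ≠ 0) :
    ∃ i, (δ ^ i) a ≠ 0 ∧ (δ ^ (i + 1)) a = 0 := by
  classical
  have h := Nat.find_spec (hnil a)
  have h0 : Nat.find (hnil a) ≠ 0 := by
    intro h0
    rw [h0] at h
    exact ha (by simpa using h)
  refine ⟨Nat.find (hnil a) - 1, Nat.find_min (hnil a) (by omega), ?_⟩
  rwa [Nat.sub_add_cancel (by omega)]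

/-- Differentiating bz = zb and cancelling the terms with δ b. -/
theorem map_mem_center_of_derivation (hδ : ∀ a b, δ (a * b) = δ a * b + a * δ b) {z : B}
    (hz : z ∈ Subalgebra.center k B) : δ z ∈ Subalgebra.center k B := by
  rw [Subalgebra.mem_center_iff] at hz ⊢
  intro b
  have h := congrArg δ (hz b)
  rw [hδ, hδ, hz (δ b), add_comm (δ z * b)] at h
  exact add_left_cancel h

end Derivation

namespace MonomialBasis

variable {k B : Type*} [CommRing k] [Ring B] [Algebra k B] {n : ℕ} (M : MonomialBasis k B n)
  [IsDomain k]

-- In characteristic 0 the binomial coefficient is nonzero, so the order of nilpotency is additive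
-- on products, like a degree.
include M in
theorem iterate_mul_ne_zero [CharZero k] {δ : B →ₗ[k] B}
    (hδ : ∀ a b, δ (a * b) = δ a * b + a * δ b) {i j : ℕ} {a b : B}
    (ha : (δ ^ (i + 1)) a = 0) (hb : (δ ^ (j + 1)) b = 0) (ha' : (δ ^ i) a ≠ 0)
    (hb' : (δ ^ j) b ≠ 0) : (δ ^ (i + j)) (a * b) ≠ 0 := by
  have := M.isDomain
  rw [iterate_mul_of_top hδ ha hb]
  intro h
  rw [← Nat.cast_smul_eq_nsmul k] at h
  have h1 := congrArg M.e.repr h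
  rw [map_smul, map_zero, smul_eq_zero] at h1
  rcases h1 with h1 | h1
  · exact (Nat.choose_pos (Nat.le_add_right i j)).ne' (by exact_mod_cast h1)
  · exact mul_ne_zero ha' hb' (by simpa using h1)

/-- Locally nilpotent derivations vanish if exactly the `ℓ`-th powers are central. -/
theorem eq_zero_of_isLND [CharZero k] {ℓ : ℕ} (hℓ : 1 < ℓ)
    (hK : ∀ a, M.IsCentral a ↔ ∀ i, ℓ ∣ a i) {δ : B →ₗ[k] B} (h : IsLND δ) : δ = 0 := by
  classical
  obtain ⟨hδ, hnil⟩ := h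
  have := M.isDomain
  have hexp : ∀ b, M.IsCentral (ℓ • b) := fun b => (hK _).mpr fun i => by simp
  have hx : ∀ s, δ (M.e (Finsupp.single s 1)) = 0 := by
    intro s
    set X := M.e (Finsupp.single s 1) with hX
    -- By the Leibniz rule every term of δ(X^(m+1)) retains m factors X.
    have hsupp : ∀ (m : ℕ) (c : Fin n →₀ ℕ), M.e.repr (δ (X ^ (m + 1))) c ≠ 0 → m ≤ c s := by
      intro m
      induction m with
      | zero => intros; exact Nat.zero_le _
      | succ m ih =>
        intro c hc
        rw [pow_succ, hδ, map_add, Finsupp.add_apply] at hc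
        by_cases h1 : M.e.repr (δ (X ^ (m + 1)) * X) c = 0
        · rw [h1, zero_add] at hc
          obtain ⟨a, b, ha, -, rfl⟩ := M.exists_of_repr_mul_ne_zero hc
          obtain ⟨u, hu⟩ := M.e_pow (Finsupp.single s 1) (m + 1)
          rw [hX, hu, map_smul, M.e.repr_self, Finsupp.smul_single,
            Finsupp.single_apply_ne_zero] at ha
          rw [ha.1]
          simp
        · obtain ⟨a, b, ha, hb, rfl⟩ := M.exists_of_repr_mul_ne_zero h1
          rw [hX, M.e.repr_self, Finsupp.single_apply_ne_zero] at hb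
          rw [hb.1]
          simpa using ih a ha
    obtain ⟨u, hu⟩ := M.e_pow (Finsupp.single s 1) ℓ
    have hXc : X ^ ℓ ∈ Subalgebra.center k B := by
      rw [hX, hu]
      exact Subalgebra.smul_mem _ (M.e_mem_center_iff.mpr (hexp _)) _
    have hX0 : X ≠ 0 := M.e_ne_zero _
    -- The s-exponents in δ(X^ℓ) are at least ℓ - 1; since δ(X^ℓ) is central they are multiples of
    -- ℓ, hence at least ℓ.
    have hdiv : ∃ g, δ (X ^ ℓ) = X ^ ℓ * g := by
      obtain ⟨g, hg⟩ := M.exists_eq_e_mul (f := δ (X ^ ℓ)) (v := ℓ • Finsupp.single s 1) (by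
        intro c hc
        have h1 := hsupp (ℓ - 1) c (by rwa [Nat.sub_add_cancel hℓ.le])
        have h2 := (hK c).mp (M.mem_center_iff.mp (map_mem_center_of_derivation hδ hXc) c hc) s
        have h3 := Nat.le_of_dvd (by omega) h2
        rw [Finsupp.smul_single, smul_eq_mul, mul_one, Finsupp.single_le_iff]
        exact h3)
      refine ⟨((u⁻¹ : kˣ) : k) • g, ?_⟩
      rw [hg, hX, hu, smul_mul_smul_comm, Units.mul_inv, one_smul]
    obtain ⟨g, hg⟩ := hdiv
    -- If X^ℓ g = δ(X^ℓ) were nonzero, its nilpotency degree would be at least that of X^ℓ, but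
    -- applying δ lowers that degree by one.
    have hz : δ (X ^ ℓ) = 0 := by
      by_contra hne
      have hg0 : g ≠ 0 := by
        rintro rfl
        exact hne (by rw [hg, mul_zero])
      obtain ⟨i, hi, hi'⟩ := exists_top hnil (pow_ne_zero ℓ hX0)
      obtain ⟨j, hj, hj'⟩ := exists_top hnil hg0
      refine M.iterate_mul_ne_zero hδ hi' hj' hi hj ?_
      rw [← hg, ← Module.End.mul_apply, ← pow_succ, add_right_comm, add_comm, pow_add,
        Module.End.mul_apply, hi', map_zero]
    obtain ⟨i, hi, hi'⟩ := exists_top hnil hX0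
    obtain ⟨j, hj, hj'⟩ := exists_top hnil (pow_ne_zero (ℓ - 1) hX0)
    have h1 := M.iterate_mul_ne_zero hδ hi' hj' hi hj
    rw [← pow_succ', Nat.sub_add_cancel hℓ.le] at h1
    -- The degrees of X and X^(ℓ-1) add up to that of X^ℓ, which is 0 because δ(X^ℓ) = 0.
    have hij : i + j = 0 := by
      by_contra hne
      obtain ⟨t, ht⟩ := Nat.exists_eq_succ_of_ne_zero hne
      rw [ht, Nat.succ_eq_add_one, pow_succ, Module.End.mul_apply, hz, map_zero] at h1
      exact h1 rfl
    obtain rfl : i = 0 := by omega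
    simpa using hi'
  have h1 : δ 1 = 0 := by
    have := hδ 1 1
    simpa using this
  have hpow : ∀ s m, δ (M.e (Finsupp.single s 1) ^ m) = 0 := by
    intro s m
    induction m with
    | zero => rw [pow_zero, h1]
    | succ m ih => rw [pow_succ, hδ, ih, hx, zero_mul, mul_zero, add_zero]
  refine M.e.ext fun a => ?_
  rw [LinearMap.zero_apply]
  induction a using Finsupp.induction_linear with
  | zero => rw [M.one, h1]
  | add a b ha hb => rw [M.smul_e_add, map_smul, hδ, ha, hb, zero_mul, mul_zero, add_zero, smul_zero]
  | single i m =>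
    obtain ⟨u, hu⟩ := M.e_pow (Finsupp.single i 1) m
    have h2 : M.e (Finsupp.single i m) = ((u⁻¹ : kˣ) : k) • M.e (Finsupp.single i 1) ^ m := by
      rw [hu, smul_smul, Units.inv_mul, one_smul, Finsupp.smul_single, smul_eq_mul, mul_one]
    rw [h2, map_smul, hpow, smul_zero]

/-! ### Base change -/

/-- Base change of a monomial basis. -/
def baseChange (C : Type*) [CommRing C] [Algebra k C] : MonomialBasis C (C ⊗[k] B) n where
  e := M.e.baseChange C
  χ a b := Units.map (algebraMap k C).toMonoidHom (M.χ a b)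
  mul a b := by
    rw [Module.Basis.baseChange_apply, Module.Basis.baseChange_apply,
      Module.Basis.baseChange_apply, Algebra.TensorProduct.tmul_mul_tmul, M.mul, mul_one,
      TensorProduct.tmul_smul]
    exact (algebraMap_smul C _ _).symm
  one := by
    rw [Module.Basis.baseChange_apply, M.one]; rfl

omit [IsDomain k] in
theorem isCentral_baseChange_iff {C : Type*} [CommRing C] [Algebra k C]
    (hC : Function.Injective (algebraMap k C)) (a : Fin n →₀ ℕ) :
    (M.baseChange C).IsCentral a ↔ M.IsCentral a :=
  forall_congr' fun _ => (Units.map_injective (f := (algebraMap k C).toMonoidHom) hC).eq_iff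

/-- Ring automorphisms of the base change along a flat extension permute the variables up to
units. -/
theorem exists_perm_of_tensor {ℓ : ℕ} [Fact (1 < ℓ)]
    (hK : ∀ a, M.IsCentral a ↔ ∀ i, ℓ ∣ a i) {x : Fin n → B}
    (hx : ∀ i, M.e (Finsupp.single i 1) = x i) {C : Type*} [CommRing C] [IsDomain C] [Algebra k C]
    [Module.Flat k C] (g : (B ⊗[k] C) ≃ₐ[k] (B ⊗[k] C)) :
    ∃ (σ : Equiv.Perm (Fin n)) (c : Fin n → Cˣ), ∀ i,
      g (x i ⊗ₜ 1) = x (σ i) ⊗ₜ (c i : C) := by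
  -- Flat modules over a domain are torsion-free, so k embeds in C and centrality of monomials is
  -- unchanged by base change.
  have hC : Function.Injective (algebraMap k C) := by
    have : Module.IsTorsionFree k C := inferInstance
    exact FaithfulSMul.algebraMap_injective k C
  have hK' : ∀ a, (M.baseChange C).IsCentral a ↔ ∀ i, ℓ ∣ a i := fun a =>
    (M.isCentral_baseChange_iff hC a).trans (hK a)
  let τ := Algebra.TensorProduct.comm k C B
  -- The transported map is only k-linear, not C-linear; the rigidity statement for ring
  -- automorphisms still applies, with units now in C.
  obtain ⟨σ, c, hσ⟩ := (M.baseChange C).exists_perm_of_ringEquiv hK'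
    ((τ.trans g).trans τ.symm).toRingEquiv
  refine ⟨σ, c, fun i => ?_⟩
  have h1 := congrArg τ (hσ i)
  simp only [baseChange, Module.Basis.baseChange_apply, hx] at h1
  have h2 : τ (((τ.trans g).trans τ.symm).toRingEquiv (1 ⊗ₜ x i)) = g (x i ⊗ₜ 1) :=
    τ.apply_symm_apply _
  rw [h2] at h1
  rw [h1, TensorProduct.smul_tmul', smul_eq_mul, mul_one]
  rfl

end MonomialBasis


/-! ### Elementary homomorphisms -/

theorem commute_neg_one {S : Type*} [Ring S] (a : S) : Commute (-1) a :=
  (Commute.one_left a).neg_left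

/-- A homomorphism `A → A[t]` depending on a central parameter, and inverse to itself up to the sign
of that parameter, extends to an automorphism of `A[t]` fixing `t`. -/
theorem exists_polynomial_algEquiv {k A : Type*} [CommRing k] [Ring A] [Algebra k A]
    (E : ∀ c : Polynomial A, (∀ a, Commute c ((Polynomial.CAlgHom : A →ₐ[k] Polynomial A) a)) →
      (A →ₐ[k] Polynomial A))
    (hE : ∀ c hc d hd (F : Polynomial A →ₐ[k] Polynomial A),
      (∀ a, F ((Polynomial.CAlgHom : A →ₐ[k] Polynomial A) a) = E d hd a) → F c = c →
        c + d = 0 → F.comp (E c hc) = Polynomial.CAlgHom) :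
    ∃ h : Polynomial A ≃ₐ[k] Polynomial A,
      ∀ a, h (Polynomial.C a) = E Polynomial.X (fun _ => Polynomial.commute_X _) a := by
  have hX : ∀ a : A, Commute (Polynomial.X : Polynomial A)
      ((Polynomial.CAlgHom : A →ₐ[k] _) a) := fun a => Polynomial.commute_X _
  have hX' : ∀ a : A, Commute (-Polynomial.X : Polynomial A)
      ((Polynomial.CAlgHom : A →ₐ[k] _) a) := fun a => (hX a).neg_left
  let H := E Polynomial.X hX
  let H' := E (-Polynomial.X) hX'
  let F : Polynomial A →ₐ[k] Polynomial A := Polynomial.eval₂AlgHom H Polynomial.X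
    fun a => (Polynomial.commute_X _).symm
  let F' : Polynomial A →ₐ[k] Polynomial A := Polynomial.eval₂AlgHom H' Polynomial.X
    fun a => (Polynomial.commute_X _).symm
  have hFC : ∀ a, F (Polynomial.C a) = H a := fun a => Polynomial.eval₂_C _ _
  have hFC' : ∀ a, F' (Polynomial.C a) = H' a := fun a => Polynomial.eval₂_C _ _
  have hFX : F Polynomial.X = Polynomial.X := Polynomial.eval₂_X _ _
  have hFX' : F' Polynomial.X = Polynomial.X := Polynomial.eval₂_X _ _
  -- The parameters t and -t sum to 0, so the two extensions undo each other on constants, and both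
  -- fix t.
  have h1 := hE _ hX' _ hX F hFC (by rw [map_neg, hFX]) (neg_add_cancel _)
  have h2 := hE _ hX _ hX' F' hFC' hFX' (add_neg_cancel _)
  have e1 : F.comp F' = AlgHom.id k _ := by
    refine Polynomial.algHom_ext' ?_ (by simp [hFX, hFX'])
    exact AlgHom.ext fun a => (congrArg F (hFC' a)).trans (DFunLike.congr_fun h1 a)
  have e2 : F'.comp F = AlgHom.id k _ := by
    refine Polynomial.algHom_ext' ?_ (by simp [hFX, hFX'])
    exact AlgHom.ext fun a => (congrArg F' (hFC a)).trans (DFunLike.congr_fun h2 a)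
  exact ⟨AlgEquiv.ofAlgHom F F' e1 e2, hFC⟩

section Elementary

variable {k : Type u} [CommRing k] {n : ℕ} {p : Fin n → Fin n → kˣ}

/-- `z` commutes with the variables in the same way as `x_s`. -/
def CommutesLike (p : Fin n → Fin n → kˣ) (s : Fin n) (z : Alg p) : Prop :=
  ∀ j, x p j * z = (p s j : k) • (z * x p j)

/-- The homomorphism fixing `x_j` for `j ≠ s` and sending `x_s` to `x_s + c z`. -/
def elementaryHom (hp_diag : ∀ i, p i i = 1) (hp_inv : ∀ i j, p j i = (p i j)⁻¹) {s : Fin n}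
    {z : Alg p} (hz : CommutesLike p s z) {S : Type*} [Ring S] [Algebra k S] (ψ : Alg p →ₐ[k] S)
    (c : S) (hc : ∀ a, Commute c (ψ a)) : Alg p →ₐ[k] S :=
  liftHom p (fun j => if j = s then ψ (x p s) + c * ψ z else ψ (x p j)) fun i j hij => by
    have hx : ψ (x p j) * ψ (x p i) = (p i j : k) • (ψ (x p i) * ψ (x p j)) := by
      rw [← map_mul, x_mul_x p hp_diag hp_inv, map_smul, map_mul]
    have hzl : ∀ j, ψ (x p j) * ψ z = (p s j : k) • (ψ z * ψ (x p j)) := fun j => by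
      rw [← map_mul, hz, map_smul, map_mul]
    by_cases hj : j = s
    · have hi : i ≠ s := by rintro rfl; exact hij.ne hj.symm
      subst hj
      have h1 : ψ z * ψ (x p i) = (p i j : k) • (ψ (x p i) * ψ z) := by
        rw [hzl, smul_smul, hp_inv j i, Units.inv_mul, one_smul]
      rw [if_pos rfl, if_neg hi, add_mul, mul_add, hx, mul_assoc, h1, mul_smul_comm,
        ← mul_assoc (ψ (x p i)), ← (hc (x p i)).eq, mul_assoc, smul_add]
    · by_cases hi : i = s
      · subst hi
        rw [if_pos rfl, if_neg hj, mul_add, add_mul, hx, ← mul_assoc, ← (hc (x p j)).eq, mul_assoc,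
          hzl, mul_smul_comm, smul_add, mul_assoc]
      · rw [if_neg hi, if_neg hj, hx]

section

variable (hp_diag : ∀ i, p i i = 1) (hp_inv : ∀ i j, p j i = (p i j)⁻¹) {s : Fin n}
  {z : Alg p} (hz : CommutesLike p s z) {S : Type*} [Ring S] [Algebra k S] (ψ : Alg p →ₐ[k] S)
  (c : S) (hc : ∀ a, Commute c (ψ a))

theorem elementaryHom_x_self :
    elementaryHom hp_diag hp_inv hz ψ c hc (x p s) = ψ (x p s) + c * ψ z := by
  rw [elementaryHom, liftHom_x, if_pos rfl]

theorem elementaryHom_x_of_ne {j : Fin n} (hj : j ≠ s) :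
    elementaryHom hp_diag hp_inv hz ψ c hc (x p j) = ψ (x p j) := by
  rw [elementaryHom, liftHom_x, if_neg hj]

/-- Only x_s is moved. Applied to z itself, this is what lets opposite parameters c and -c undo each
other. -/
theorem elementaryHom_of_apply_eq_zero (a : Fin n →₀ ℕ) (ha : a s = 0) :
    elementaryHom hp_diag hp_inv hz ψ c hc ((algBasis p hp_diag hp_inv).e a) =
      ψ ((algBasis p hp_diag hp_inv).e a) := by
  set M := algBasis p hp_diag hp_inv with hM
  induction a using Finsupp.induction_linear with
  | zero => rw [M.one, map_one, map_one]
  | add a b iha ihb =>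
    rw [Finsupp.add_apply] at ha
    rw [M.smul_e_add, map_smul, map_smul, map_mul, map_mul, iha (by omega), ihb (by omega)]
  | single i m =>
    by_cases hi : i = s
    · subst hi
      rw [Finsupp.single_eq_same] at ha
      rw [ha, Finsupp.single_zero, M.one, map_one, map_one]
    · obtain ⟨u, hu⟩ := M.e_pow (Finsupp.single i 1) m
      have h2 : M.e (Finsupp.single i m) = ((u⁻¹ : kˣ) : k) • M.e (Finsupp.single i 1) ^ m := by
        rw [hu, smul_smul, Units.inv_mul, one_smul, Finsupp.smul_single, smul_eq_mul, mul_one]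
      rw [h2, map_smul, map_smul, map_pow, map_pow, hM, algBasis_single,
        elementaryHom_x_of_ne _ _ _ _ _ _ hi]

end

variable [IsDomain k] (hp_diag : ∀ i, p i i = 1) (hp_inv : ∀ i j, p j i = (p i j)⁻¹)

/-- Centrality says that the commutation scalar of e_m with x_j times p_sj^(ℓ-1) is 1. As p_sj^ℓ =
1, that scalar is p_sj. -/
theorem commutesLike_of_isCentral {ℓ : ℕ} (hℓ : 0 < ℓ)
    (hexp : ∀ b, (algBasis p hp_diag hp_inv).IsCentral (ℓ • b)) {s : Fin n} {m : Fin n →₀ ℕ}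
    (hm : (algBasis p hp_diag hp_inv).IsCentral (m + Finsupp.single s (ℓ - 1))) :
    CommutesLike p s ((algBasis p hp_diag hp_inv).e m) := by
  intro j
  rw [x_mul_algBasis]
  congr 2
  have h1 := (isCentral_algBasis_iff p hp_diag hp_inv _).mp hm j
  have h2 := (isCentral_algBasis_iff p hp_diag hp_inv _).mp (hexp (Finsupp.single s 1)) j
  have h3 : ∀ t : ℕ, ∏ l, p l j ^ (Finsupp.single s t : Fin n →₀ ℕ) l = p s j ^ t := by
    intro t
    rw [Finset.prod_eq_single s]
    · simp
    · intro l _ hl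
      simp [hl]
    · simp
  rw [Finsupp.smul_single, smul_eq_mul, mul_one, h3] at h2
  simp only [Finsupp.add_apply, pow_add, Finset.prod_mul_distrib] at h1
  rw [h3] at h1
  rw [← mul_left_inj (p s j ^ (ℓ - 1)), h1, ← pow_succ', Nat.sub_add_cancel hℓ, h2]

/-- If the center is larger than the algebra generated by `ℓ`-th powers, some monomial of degree at
least two not involving `x_s` commutes with the variables in the same way as `x_s`. -/
theorem exists_commutesLike {ℓ : ℕ} (hℓ : ℓ.Prime)
    (hexp : ∀ b, (algBasis p hp_diag hp_inv).IsCentral (ℓ • b))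
    (H1 : ∀ i, x p i ∉ Subalgebra.center k (Alg p))
    (h : ¬ ∀ a, (algBasis p hp_diag hp_inv).IsCentral a → ∀ i, ℓ ∣ a i) :
    ∃ (s : Fin n) (m : Fin n →₀ ℕ), m s = 0 ∧ 2 ≤ m.degree ∧
      CommutesLike p s ((algBasis p hp_diag hp_inv).e m) := by
  obtain ⟨s, m, hms, hm⟩ := (algBasis p hp_diag hp_inv).exists_isCentral_add_single hℓ hexp h
  -- If x_s were the only variable it would be central.
  have hj : ∃ j, j ≠ s := by
    by_contra! hj
    apply H1 s
    have hadj : Algebra.adjoin k (Set.range (x p)) ≤ Subalgebra.centralizer k {x p s} := by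
      refine Algebra.adjoin_le ?_
      rintro _ ⟨i, rfl⟩
      rw [SetLike.mem_coe, Subalgebra.mem_centralizer_iff]
      rintro _ rfl
      rw [hj i]
    rw [adjoin_range_x] at hadj
    rw [Subalgebra.mem_center_iff]
    intro b
    exact (Subalgebra.mem_centralizer_iff k |>.mp (hadj (Algebra.mem_top (x := b))) _ rfl).symm
  obtain ⟨j, hj⟩ := hj
  -- The central factor x_j^ℓ leaves commutation unchanged and raises the degree to at least 2, so m
  -- is not merely another variable.
  refine ⟨s, ℓ • Finsupp.single j 1 + m, ?_, ?_,
    commutesLike_of_isCentral hp_diag hp_inv hℓ.pos hexp ?_⟩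
  · simp [hms, hj.symm]
  · rw [map_add, map_nsmul, Finsupp.degree_single]
    have := hℓ.two_le
    simp only [smul_eq_mul, mul_one]; omega
  · rw [add_assoc, MonomialBasis.isCentral_add_iff _ (hexp _)]
    exact hm

section

variable {s : Fin n} {m : Fin n →₀ ℕ} (hms : m s = 0)
  (hm : CommutesLike p s ((algBasis p hp_diag hp_inv).e m))

-- The target S and the parameter c are free so that one construction covers c = 1 or -1 in A and c
-- = t or -t in A[t].
include hms in
omit [IsDomain k] in
theorem elementaryHom_comp {S : Type*} [Ring S] [Algebra k S] (ψ : Alg p →ₐ[k] S) (c : S)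
    (hc : ∀ a, Commute c (ψ a)) (f : S →ₐ[k] S) (d : S) (hd : ∀ a, Commute d (ψ a))
    (hf : ∀ a, f (ψ a) = elementaryHom hp_diag hp_inv hm ψ d hd a) (hfc : f c = c)
    (hcd : c + d = 0) : f.comp (elementaryHom hp_diag hp_inv hm ψ c hc) = ψ := by
  apply algHom_ext
  intro i
  rw [AlgHom.comp_apply]
  by_cases hi : i = s
  · subst hi
    rw [elementaryHom_x_self, map_add, map_mul, hfc, hf, hf, elementaryHom_x_self,
      elementaryHom_of_apply_eq_zero _ _ _ _ _ _ _ hms, add_assoc, ← add_mul, add_comm d, hcd,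
      zero_mul, add_zero]
  · rw [elementaryHom_x_of_ne _ _ _ _ _ _ hi, hf, elementaryHom_x_of_ne _ _ _ _ _ _ hi]

include hms hm in
theorem exists_not_isAffine (hdeg : 2 ≤ m.degree) :
    ∃ g : Alg p ≃ₐ[k] Alg p, ¬ IsAffine (x p) g := by
  set M := algBasis p hp_diag hp_inv with hM
  let f : Alg p →ₐ[k] Alg p := elementaryHom hp_diag hp_inv hm (AlgHom.id k _) 1
    fun a => Commute.one_left _
  let f' : Alg p →ₐ[k] Alg p := elementaryHom hp_diag hp_inv hm (AlgHom.id k _) (-1)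
    fun a => commute_neg_one _
  have h1 : f.comp f' = AlgHom.id k _ := elementaryHom_comp hp_diag hp_inv hms hm _ _ _ f 1
    (fun a => Commute.one_left _) (fun a => rfl) (by simp) (by simp)
  have h2 : f'.comp f = AlgHom.id k _ := elementaryHom_comp hp_diag hp_inv hms hm _ _ _ f' (-1)
    (fun a => commute_neg_one _) (fun a => rfl) (by simp) (by simp)
  refine ⟨AlgEquiv.ofAlgHom f f' h1 h2, fun h => ?_⟩
  have hx := algBasis_single p hp_diag hp_inv
  have hs := h s
  have h3 := (M.isAlgFiltration_stdFiltration hx).mem_deg (f (x p s))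
  change deg _ (f (x p s)) = 1 at hs
  rw [hs, M.mem_stdFiltration hx] at h3
  have h4 := h3 m (by
    change M.e.repr (elementaryHom hp_diag hp_inv hm (AlgHom.id k _) 1 _ (x p s)) m ≠ 0
    rw [elementaryHom_x_self, ← hx s, ← hM]
    have : Finsupp.single s 1 ≠ m := by
      rintro rfl
      simp at hms
    simp [this])
  omega

-- Under x_s ↦ x_s + t e_m the image of x_s has t-coefficient e_m ≠ 0, so A is not preserved.
include hms hm in
theorem exists_not_isTriangular :
    ∃ h : Polynomial (Alg p) ≃ₐ[k] Polynomial (Alg p), ¬ IsTriangular h := by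
  set M := algBasis p hp_diag hp_inv with hM
  obtain ⟨h, hh⟩ := exists_polynomial_algEquiv (k := k)
    (fun c hc => elementaryHom hp_diag hp_inv hm Polynomial.CAlgHom c hc)
    (fun c hc d hd F hF hFc hcd =>
      elementaryHom_comp hp_diag hp_inv hms hm _ c hc F d hd hF hFc hcd)
  refine ⟨h, ?_⟩
  rintro ⟨g, c, r, -, -, hg⟩
  have h3 := congrArg (fun q => Polynomial.coeff q 1) (hg (x p s))
  rw [hh, elementaryHom_x_self] at h3
  simp only [Polynomial.CAlgHom_apply, Polynomial.coeff_add, Polynomial.coeff_C_succ, zero_add,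
    Polynomial.coeff_X_mul, Polynomial.coeff_C_zero] at h3
  exact M.e_ne_zero m h3

-- The derivation is the ε-part of the homomorphism into the dual numbers. Its square kills every
-- generator, since e_m does not involve x_s, and nilpotency spreads to sums and products.
include hms hm in
theorem exists_isLND_ne_zero : ∃ δ : Alg p →ₗ[k] Alg p, IsLND δ ∧ δ ≠ 0 := by
  set M := algBasis p hp_diag hp_inv with hM
  let H : Alg p →ₐ[k] DualNumber (Alg p) := elementaryHom hp_diag hp_inv hm
    (TrivSqZeroExt.inlAlgHom k (Alg p) (Alg p)) DualNumber.eps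
    fun a => DualNumber.commute_eps_left _
  have hfst : ∀ a, (H a).fst = a := by
    intro a
    have : (TrivSqZeroExt.fstHom k (Alg p) (Alg p)).comp H = AlgHom.id k _ := by
      apply algHom_ext
      intro i
      by_cases hi : i = s
      · subst hi
        simp [H, elementaryHom_x_self]
      · simp [H, elementaryHom_x_of_ne _ _ _ _ _ _ hi]
    exact DFunLike.congr_fun this a
  let δ : Alg p →ₗ[k] Alg p :=
    { toFun := fun a => (H a).snd
      map_add' := fun a b => by rw [map_add, TrivSqZeroExt.snd_add]
      map_smul' := fun c a => by rw [map_smul, TrivSqZeroExt.snd_smul, RingHom.id_apply] }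
  have hδ : ∀ a b, δ (a * b) = δ a * b + a * δ b := by
    intro a b
    change (H (a * b)).snd = (H a).snd * b + a * (H b).snd
    rw [map_mul, TrivSqZeroExt.snd_mul, hfst, hfst, add_comm]
    rfl
  have hδs : δ (x p s) = M.e m := by
    change (H (x p s)).snd = _
    simp [H, elementaryHom_x_self]
  have hδm : δ (M.e m) = 0 := by
    change (H (M.e m)).snd = _
    have := elementaryHom_of_apply_eq_zero hp_diag hp_inv hm
      (TrivSqZeroExt.inlAlgHom k (Alg p) (Alg p)) DualNumber.eps
      (fun a => DualNumber.commute_eps_left _) m hms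
    rw [← hM] at this
    rw [this]
    simp
  have hδj : ∀ j, j ≠ s → δ (x p j) = 0 := by
    intro j hj
    change (H (x p j)).snd = _
    simp [H, elementaryHom_x_of_ne _ _ _ _ _ _ hj]
  have hle : ∀ (i t : ℕ) (a : Alg p), (δ ^ i) a = 0 → (δ ^ (t + i)) a = 0 := by
    intro i t a h
    rw [pow_add, Module.End.mul_apply, h, map_zero]
  refine ⟨δ, ⟨hδ, fun a => ?_⟩, fun h => ?_⟩
  · have ha : a ∈ Algebra.adjoin k (Set.range (x p)) := by
      rw [adjoin_range_x]; exact Algebra.mem_top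
    induction ha using Algebra.adjoin_induction with
    | mem y hy =>
      obtain ⟨j, rfl⟩ := hy
      refine ⟨2, ?_⟩
      rw [pow_two, Module.End.mul_apply]
      by_cases hj : j = s
      · rw [hj, hδs, hδm]
      · rw [hδj j hj, map_zero]
    | algebraMap r =>
      refine ⟨1, ?_⟩
      have h1 : δ 1 = 0 := by
        have := hδ 1 1
        simpa using this
      rw [pow_one, Algebra.algebraMap_eq_smul_one, map_smul, h1, smul_zero]
    | add a b _ _ ha hb =>
      obtain ⟨i, hi⟩ := ha
      obtain ⟨j, hj⟩ := hb
      refine ⟨j + i, ?_⟩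
      rw [map_add, hle i j a hi, zero_add, add_comm j, hle j i b hj]
    | mul a b _ _ ha hb =>
      obtain ⟨i, hi⟩ := ha
      obtain ⟨j, hj⟩ := hb
      exact ⟨i + j, iterate_mul_eq_zero hδ hi hj⟩
  · rw [h, LinearMap.zero_apply] at hδs
    exact M.e_ne_zero m hδs.symm

end

/-- Automorphisms of `A[t]` are triangular if exactly the `ℓ`-th powers are central. -/
theorem isTriangular_of_isCentral_iff {ℓ : ℕ} [Fact (1 < ℓ)]
    (hK : ∀ a, (algBasis p hp_diag hp_inv).IsCentral a ↔ ∀ i, ℓ ∣ a i)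
    (h : Polynomial (Alg p) ≃ₐ[k] Polynomial (Alg p)) : IsTriangular h := by
  set M := algBasis p hp_diag hp_inv with hM
  have := M.isDomain
  have hx := algBasis_single p hp_diag hp_inv
  -- A[t] is A ⊗ k[t], and k[t] is a flat domain whose units are constants. So h sends each x_i to a
  -- constant multiple of a variable, and therefore A into A.
  have hmap : ∀ h : Polynomial (Alg p) ≃ₐ[k] Polynomial (Alg p), ∀ a, ∃ b,
      h (Polynomial.C a) = Polynomial.C b := by
    intro h a
    let τ := polyEquivTensor k (Alg p)
    obtain ⟨σ, c, hσ⟩ := M.exists_perm_of_tensor hK hx ((τ.symm.trans h).trans τ)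
    have hgen : ∀ i, ∃ b, h (Polynomial.C (x p i)) = Polynomial.C b := by
      intro i
      have h1 := congrArg τ.symm (hσ i)
      rw [AlgEquiv.trans_apply, AlgEquiv.trans_apply, τ.symm_apply_apply] at h1
      obtain ⟨r, -, hr⟩ := Polynomial.isUnit_iff.mp (c i).isUnit
      rw [← hr] at h1
      have h2 : ∀ (b : Alg p) (t : k), τ.symm (b ⊗ₜ Polynomial.C t) =
          Polynomial.C (b * algebraMap k _ t) := by
        intro b t
        simp [τ, polyEquivTensor_symm_apply_tmul_eq_smul, Polynomial.smul_C]
      rw [← Polynomial.C_1, h2, h2, map_one, mul_one] at h1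
      exact ⟨_, h1⟩
    have hadj : Algebra.adjoin k (Set.range (x p)) ≤
        (Polynomial.CAlgHom : Alg p →ₐ[k] _).range.comap
          (h.toAlgHom.comp Polynomial.CAlgHom) := by
      refine Algebra.adjoin_le ?_
      rintro _ ⟨i, rfl⟩
      obtain ⟨b, hb⟩ := hgen i
      exact ⟨b, hb.symm⟩
    rw [adjoin_range_x] at hadj
    obtain ⟨b, hb⟩ := hadj (Algebra.mem_top (x := a))
    exact ⟨b, hb.symm⟩
  have hC := Polynomial.C_injective (R := Alg p)
  choose g hg using hmap h
  choose g' hg' using hmap h.symm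
  let G : Alg p ≃ₐ[k] Alg p :=
    { toFun := g
      invFun := g'
      left_inv := fun a => hC (by rw [← hg', ← hg, h.symm_apply_apply])
      right_inv := fun a => hC (by rw [← hg, ← hg', h.apply_symm_apply])
      map_mul' := fun a b => hC (by rw [← hg, map_mul, map_mul, hg, hg, map_mul])
      map_add' := fun a b => hC (by rw [← hg, map_add, map_add, hg, hg, map_add])
      commutes' := fun r => hC (by
        rw [← hg]
        exact h.commutes r) }
  have hG : ∀ a, h (Polynomial.C a) = Polynomial.C (G a) := hg
  set P := h Polynomial.X with hP
  -- h is substitution of P = h(t) after applying G to the coefficients. Since t is in the image,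
  -- multiplicativity of degrees and of leading coefficients makes P linear with unit leading
  -- coefficient.
  have hcomp : ∀ Q, h Q = (Q.map (G : Alg p →+* Alg p)).comp P := by
    intro Q
    induction Q using Polynomial.induction_on' with
    | add p q hp hq => rw [map_add, hp, hq, Polynomial.map_add, Polynomial.add_comp]
    | monomial m a =>
      rw [← Polynomial.C_mul_X_pow_eq_monomial, map_mul, map_pow, hG, ← hP]
      simp
  obtain ⟨Q, hQ⟩ := h.surjective Polynomial.X
  rw [hcomp] at hQ
  have hnd := congrArg Polynomial.natDegree hQ
  rw [Polynomial.natDegree_comp, Polynomial.natDegree_X] at hnd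
  have hQ1 := Nat.dvd_one.mp (Dvd.intro _ hnd)
  have hP1 := Nat.dvd_one.mp (Dvd.intro_left _ hnd)
  have hlc := congrArg Polynomial.leadingCoeff hQ
  rw [Polynomial.leadingCoeff_comp (by omega), hQ1, pow_one, Polynomial.leadingCoeff_X] at hlc
  have hlc' := mul_eq_one_symm hlc
  rw [Polynomial.leadingCoeff, hP1] at hlc'
  obtain ⟨c, hc⟩ := M.exists_eq_smul_one_of_mul_eq_one hlc'
  refine ⟨G, c, P.coeff 0, ?_, ?_, hG⟩
  · rw [Subalgebra.mem_center_iff]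
    intro b
    -- t commutes with A, so P commutes with h(A) = A, and so does its constant term.
    have h1 : h (Polynomial.C (G.symm b)) * P = P * h (Polynomial.C (G.symm b)) := by
      rw [hP, ← map_mul, ← map_mul, (Polynomial.commute_X _).eq]
    rw [hG, G.apply_symm_apply] at h1
    have h2 := congrArg (fun q => Polynomial.coeff q 0) h1
    simpa using h2
  · have h2 := Polynomial.eq_X_add_C_of_natDegree_le_one hP1.le
    rw [hc, ← Polynomial.smul_C, Polynomial.C_1, smul_mul_assoc, one_mul] at h2
    exact h2

end Elementary


/-! ### Affine and monomial automorphisms -/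

namespace MonomialBasis

variable {k B : Type*} [CommRing k] [IsDomain k] [Ring B] [Algebra k B] {n : ℕ}
  (M : MonomialBasis k B n) {x : Fin n → B} (hx : ∀ i, M.e (Finsupp.single i 1) = x i)

include hx

theorem deg_x (i : Fin n) : deg (stdFiltration (k := k) x) (x i) = 1 := by
  rw [← hx i, M.deg_e hx, Finsupp.degree_single]

theorem isAffine_of_isMonomial {g : B ≃ₐ[k] B} (hg : IsMonomial x g) : IsAffine x g := by
  obtain ⟨σ, c, h⟩ := hg
  intro i
  rw [h, M.deg_smul hx (c i).ne_zero, M.deg_x hx]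

/-- Degree 0 is excluded because g fixes the constants, so g(x_i) constant would make x_i constant.
-/
theorem isAffine_of_mem_stdFiltration_one {g : B ≃ₐ[k] B}
    (hg : ∀ i, g (x i) ∈ stdFiltration (k := k) x 1) : IsAffine x g := by
  intro i
  have h1 := deg_le_of_mem (hg i)
  by_contra h
  have h0 : deg (stdFiltration (k := k) x) (g (x i)) = 0 := by omega
  have h2 := (M.isAlgFiltration_stdFiltration hx).mem_deg (g (x i))
  rw [h0, M.mem_stdFiltration_zero hx] at h2
  obtain ⟨c, hc⟩ := h2
  rw [← g.commutes, g.injective.eq_iff] at hc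
  have h3 := deg_le_of_mem ((M.mem_stdFiltration_zero hx).mpr ⟨c, hc⟩)
  rw [M.deg_x hx] at h3
  omega

/-- If all automorphisms stay affine after base change to `k` itself, they are affine. -/
theorem isAffine_of_isAffineOver (C : Type*) [CommRing C] [Algebra k C] (τ : C ≃ₐ[k] k)
    (g : B ≃ₐ[k] B)
    (hg : IsAffineOver x C (Algebra.TensorProduct.congr g (AlgEquiv.refl : C ≃ₐ[k] C))) :
    IsAffine x g := by
  refine M.isAffine_of_mem_stdFiltration_one hx fun i => ?_
  let L : B ⊗[k] C →ₗ[k] B :=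
    (TensorProduct.rid k B : B ⊗[k] k →ₗ[k] B) ∘ₗ TensorProduct.map LinearMap.id τ.toLinearMap
  have hL : ∀ b c, L (b ⊗ₜ c) = τ c • b := by
    intro b c
    simp [L]
  obtain ⟨y, hy⟩ := hg i
  have h1 : L (g (x i) ⊗ₜ 1) = g (x i) := by rw [hL, map_one, one_smul]
  rw [Algebra.TensorProduct.congr_apply, Algebra.TensorProduct.map_tmul, map_one] at hy
  change _ = g (x i) ⊗ₜ[k] (1 : C) at hy
  rw [← h1, ← hy, stdFiltration, pow_one]
  clear hy h1
  induction y using TensorProduct.induction_on with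
  | zero => rw [map_zero, map_zero]; exact Submodule.zero_mem _
  | add y z hy hz => rw [map_add, map_add]; exact Submodule.add_mem _ hy hz
  | tmul b c =>
    rw [TensorProduct.map_tmul, hL]
    exact Submodule.smul_mem _ _ b.2

end MonomialBasis

theorem isAffineOver_of_eq_tmul {k B : Type*} [CommRing k] [Ring B] [Algebra k B] {n : ℕ}
    {x : Fin n → B} {C : Type*} [CommRing C] [Algebra k C] {g : (B ⊗[k] C) ≃ₐ[k] (B ⊗[k] C)}
    {σ : Fin n → Fin n} {c : Fin n → C} (h : ∀ i, g (x i ⊗ₜ 1) = x (σ i) ⊗ₜ c i) :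
    IsAffineOver x C g := by
  intro i
  rw [h]
  exact ⟨⟨x (σ i), Submodule.mem_sup_right (Submodule.subset_span ⟨_, rfl⟩)⟩ ⊗ₜ c i,
    by rw [TensorProduct.map_tmul]; rfl⟩

theorem exists_isDiagonal {k : Type u} [CommRing k] {n : ℕ} {p : Fin n → Fin n → kˣ}
    (hp_diag : ∀ i, p i i = 1) (hp_inv : ∀ i j, p j i = (p i j)⁻¹) (c : Fin n → kˣ) :
    ∃ g : Alg p ≃ₐ[k] Alg p, IsDiagonal (x p) c g := by
  let f : (Fin n → kˣ) → (Alg p →ₐ[k] Alg p) := fun c =>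
    liftHom p (fun i => (c i : k) • x p i) fun i j _ => by
      rw [smul_mul_smul_comm, smul_mul_smul_comm, x_mul_x p hp_diag hp_inv i j, smul_smul,
        smul_smul]
      congr 1
      ring
  have hf : ∀ c i, f c (x p i) = (c i : k) • x p i := fun c i => liftHom_x _ _ _ _
  have hff : ∀ c d, c * d = 1 → (f c).comp (f d) = AlgHom.id k _ := by
    intro c d hcd
    apply algHom_ext
    intro i
    rw [AlgHom.comp_apply, hf, map_smul, hf, smul_smul, ← Units.val_mul, mul_comm (d i),
      ← Pi.mul_apply, hcd]
    simp
  exact ⟨AlgEquiv.ofAlgHom (f c) (f c⁻¹) (hff _ _ (mul_inv_cancel c))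
    (hff _ _ (inv_mul_cancel c)), hf c⟩

/-! ### The exponent matrix -/

/-- Over the field of ℓ elements, an invertible determinant means no left kernel. Kernel vectors are
turned into exponent vectors by taking representatives in ℕ. -/
theorem isUnit_intCast_det_iff {ℓ : ℕ} [Fact ℓ.Prime] {n : ℕ} (φ : Matrix (Fin n) (Fin n) ℤ) :
    IsUnit ((φ.det : ℤ) : ZMod ℓ) ↔
      ∀ a : Fin n →₀ ℕ, (∀ i, (ℓ : ℤ) ∣ ∑ j, φ j i * a j) → ∀ i, ℓ ∣ a i := by
  set ψ : Matrix (Fin n) (Fin n) (ZMod ℓ) := φ.map (Int.cast : ℤ → ZMod ℓ) with hψ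
  have hdet : ((φ.det : ℤ) : ZMod ℓ) = ψ.det := Int.cast_det φ
  have hvec : ∀ (a : Fin n →₀ ℕ), (∀ i, (ℓ : ℤ) ∣ ∑ j, φ j i * a j) ↔
      Matrix.vecMul (fun j => (a j : ZMod ℓ)) ψ = 0 := by
    intro a
    rw [funext_iff]
    refine forall_congr' fun i => ?_
    rw [← ZMod.intCast_zmod_eq_zero_iff_dvd]
    simp [Matrix.vecMul, dotProduct, hψ, mul_comm]
  rw [isUnit_iff_ne_zero, hdet, ne_eq, ← Matrix.exists_vecMul_eq_zero_iff]
  push Not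
  constructor
  · intro h a ha i
    rw [hvec] at ha
    by_contra hi
    refine h _ ?_ ha
    intro h0
    exact hi ((ZMod.natCast_eq_zero_iff _ _).mp (congrFun h0 i))
  · intro h v hv h0
    apply hv
    have h1 := h (Finsupp.equivFunOnFinite.symm fun i => (v i).val) ((hvec _).mpr (by simpa using h0))
    funext i
    have h2 := (ZMod.natCast_eq_zero_iff _ _).mpr (h1 i)
    simpa using h2

theorem isCentral_algBasis_iff_dvd {k : Type u} [CommRing k] [IsDomain k] {n : ℕ}
    {p : Fin n → Fin n → kˣ} (hp_diag : ∀ i, p i i = 1) (hp_inv : ∀ i j, p j i = (p i j)⁻¹)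
    {ℓ : ℕ} {q : kˣ} (hq : IsPrimitiveRoot q ℓ) {φ : Matrix (Fin n) (Fin n) ℤ}
    (hφ : ∀ i j, p i j = q ^ φ i j) (a : Fin n →₀ ℕ) :
    (algBasis p hp_diag hp_inv).IsCentral a ↔ ∀ i, (ℓ : ℤ) ∣ ∑ j, φ j i * a j := by
  rw [isCentral_algBasis_iff]
  refine forall_congr' fun i => ?_
  rw [← hq.zpow_eq_one_iff_dvd]
  have : ∏ j, p j i ^ a j = q ^ ∑ j, φ j i * (a j : ℤ) := by
    have h := map_sum (zmultiplesHom (Additive kˣ) (Additive.ofMul q))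
      (fun j => φ j i * (a j : ℤ)) Finset.univ
    simp only [zmultiplesHom_apply, ← ofMul_zpow, ← ofMul_prod] at h
    rw [Additive.ofMul.injective h]
    refine Finset.prod_congr rfl fun j _ => ?_
    rw [hφ, zpow_mul, zpow_natCast]
  rw [this]

theorem exists_exponents {k : Type u} [CommRing k] {n : ℕ} {p : Fin n → Fin n → kˣ}
    (hp_diag : ∀ i, p i i = 1) (hp_inv : ∀ i j, p j i = (p i j)⁻¹) {q : kˣ}
    (hpq : Subgroup.closure {a : kˣ | ∃ i j, i < j ∧ a = p i j} ≤ Subgroup.zpowers q) :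
    ∃ φ : Matrix (Fin n) (Fin n) ℤ, ∀ i j, p i j = q ^ φ i j := by
  have hlt : ∀ i j, i < j → p i j ∈ Subgroup.zpowers q := fun i j hij =>
    hpq (Subgroup.subset_closure ⟨i, j, hij, rfl⟩)
  have h : ∀ i j, p i j ∈ Subgroup.zpowers q := by
    intro i j
    rcases lt_trichotomy i j with hij | rfl | hij
    · exact hlt i j hij
    · rw [hp_diag]
      exact one_mem _
    · rw [hp_inv]
      exact inv_mem (hlt j i hij)
  choose φ hφ using fun i j => Subgroup.mem_zpowers_iff.mp (h i j)
  exact ⟨Matrix.of φ, fun i j => (hφ i j).symm⟩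

end SkewPoly

end

/-! ### The equivalences, each compared with K -/

theorem theorem3p10 {k : Type u} [CommRing k] [IsDomain k] {n : ℕ}
    (p : Fin n → Fin n → kˣ)
    (hp_diag : ∀ i, p i i = 1) (hp_inv : ∀ i j, p j i = (p i j)⁻¹)
    (H1 : ∀ i, SkewPoly.x p i ∉ Subalgebra.center k (SkewPoly.Alg p))
    (H2 : ∀ i j, i < j → ∃ m : ℕ, 0 < m ∧ p i j ^ m = 1)
    (ℓ : ℕ) (hℓ : ℓ.Prime) (q : kˣ) (hq : IsPrimitiveRoot q ℓ)
    (hpq : Subgroup.closure {a : kˣ | ∃ i j, i < j ∧ a = p i j} = Subgroup.zpowers q) :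
    List.TFAE [
      -- (1) `Aut(A)` is affine
      ∀ g : SkewPoly.Alg p ≃ₐ[k] SkewPoly.Alg p, SkewPoly.IsAffine (SkewPoly.x p) g,
      -- (2) automorphisms of `A ⊗ C` are `C`-affine, for all `k`-flat commutative domains `C`
      ∀ (C : Type (max u v)) [CommRing C] [IsDomain C] [Algebra k C] [Module.Flat k C]
        (g : (SkewPoly.Alg p ⊗[k] C) ≃ₐ[k] (SkewPoly.Alg p ⊗[k] C)),
        SkewPoly.IsAffineOver (SkewPoly.x p) C g,
      -- (3) `(k^×)^n ⊆ Aut(A) ⊆ S_n ⋉ (k^×)^n`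
      (∀ c : Fin n → kˣ, ∃ g : SkewPoly.Alg p ≃ₐ[k] SkewPoly.Alg p,
          SkewPoly.IsDiagonal (SkewPoly.x p) c g) ∧
        (∀ g : SkewPoly.Alg p ≃ₐ[k] SkewPoly.Alg p, SkewPoly.IsMonomial (SkewPoly.x p) g),
      -- (4) `C(A)` is isomorphic to a polynomial ring
      ∃ m : ℕ, Nonempty
        (Subalgebra.center k (SkewPoly.Alg p) ≃ₐ[k] MvPolynomial (Fin m) k),
      -- (5) `A` is free over `C(A)`
      Module.Free (Subalgebra.center k (SkewPoly.Alg p)) (SkewPoly.Alg p),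
      -- (6) `det (φ_ij)` is invertible modulo `ℓ`, where `p_ij = q ^ φ_ij`
      ∃ φ : Matrix (Fin n) (Fin n) ℤ, (∀ i j, p i j = q ^ φ i j) ∧
        IsUnit ((φ.det : ℤ) : ZMod ℓ),
      -- (7) `d_w(A/C(A))` is dominating, where `w = rk(A/C(A))`
      ∃ d : SkewPoly.Alg p,
        SkewPoly.IsDiscriminant k (SkewPoly.centerRank k (SkewPoly.Alg p)) d ∧
        SkewPoly.IsDominating.{u, v} (k := k) (SkewPoly.x p) d] ∧
    (CharZero k → List.TFAE [
      -- (1) `Aut(A)` is affine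
      ∀ g : SkewPoly.Alg p ≃ₐ[k] SkewPoly.Alg p, SkewPoly.IsAffine (SkewPoly.x p) g,
      -- (8) `Aut(A[t]) = Aut_tr(A[t])`
      ∀ h : Polynomial (SkewPoly.Alg p) ≃ₐ[k] Polynomial (SkewPoly.Alg p),
        SkewPoly.IsTriangular h,
      -- (9) every locally nilpotent derivation of `A` is zero
      ∀ δ : SkewPoly.Alg p →ₗ[k] SkewPoly.Alg p, SkewPoly.IsLND δ → δ = 0]) := by

  have : Fact ℓ.Prime := ⟨hℓ⟩
  have : Fact (1 < ℓ) := ⟨hℓ.one_lt⟩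
  have : NeZero ℓ := ⟨hℓ.ne_zero⟩
  obtain ⟨φ₀, hφ₀⟩ := SkewPoly.exists_exponents hp_diag hp_inv hpq.le
  set M := SkewPoly.algBasis p hp_diag hp_inv with hM
  have hx : ∀ i, M.e (Finsupp.single i 1) = SkewPoly.x p i :=
    SkewPoly.algBasis_single p hp_diag hp_inv
  have hcen : ∀ φ : Matrix (Fin n) (Fin n) ℤ, (∀ i j, p i j = q ^ φ i j) → ∀ a,
      M.IsCentral a ↔ ∀ i, (ℓ : ℤ) ∣ ∑ j, φ j i * a j :=
    fun φ hφ => SkewPoly.isCentral_algBasis_iff_dvd hp_diag hp_inv hq hφ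
  have hexp : ∀ b, M.IsCentral (ℓ • b) := fun b => (hcen φ₀ hφ₀ _).mpr fun i =>
    Finset.dvd_sum fun j _ => by
      rw [Finsupp.smul_apply, smul_eq_mul, Nat.cast_mul]
      exact (dvd_mul_right _ _).mul_left _
  have H1M : ∀ i, ¬ M.IsCentral (Finsupp.single i 1) := by
    intro i
    rw [← M.e_mem_center_iff, hx]
    exact H1 i
  -- A domain containing a primitive ℓ-th root of unity cannot have characteristic ℓ; this keeps the
  -- discriminant nonzero.
  have hℓk : (ℓ : k) ≠ 0 := by
    have hq' : IsPrimitiveRoot (q : k) ℓ := IsPrimitiveRoot.coe_units_iff.mpr hq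
    exact hq'.neZero'.ne
  have hKiff : (∀ a, M.IsCentral a → ∀ i, ℓ ∣ a i) → ∀ a, M.IsCentral a ↔ ∀ i, ℓ ∣ a i := by
    refine fun hK a => ⟨hK a, fun h => ?_⟩
    choose b hb using h
    have : a = ℓ • Finsupp.equivFunOnFinite.symm b := by
      ext i
      simpa using hb i
    rw [this]
    exact hexp _
  have hdet : ∀ φ : Matrix (Fin n) (Fin n) ℤ, (∀ i j, p i j = q ^ φ i j) →
      (IsUnit ((φ.det : ℤ) : ZMod ℓ) ↔ ∀ a, M.IsCentral a → ∀ i, ℓ ∣ a i) := by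
    intro φ hφ
    rw [SkewPoly.isUnit_intCast_det_iff]
    exact forall_congr' fun a => by rw [hcen φ hφ]
  have hK_of_isAffine : (∀ g : SkewPoly.Alg p ≃ₐ[k] SkewPoly.Alg p,
      SkewPoly.IsAffine (SkewPoly.x p) g) → ∀ a, M.IsCentral a → ∀ i, ℓ ∣ a i := by
    intro haff
    by_contra hK
    obtain ⟨s, m, hms, hdeg, hm⟩ := SkewPoly.exists_commutesLike hp_diag hp_inv hℓ hexp H1 hK
    obtain ⟨g, hg⟩ := SkewPoly.exists_not_isAffine hp_diag hp_inv hms hm hdeg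
    exact hg (haff g)
  have hmon_of_hK : (∀ a, M.IsCentral a → ∀ i, ℓ ∣ a i) →
      ∀ g : SkewPoly.Alg p ≃ₐ[k] SkewPoly.Alg p, SkewPoly.IsMonomial (SkewPoly.x p) g := by
    intro hK g
    obtain ⟨σ, c, h⟩ := M.exists_perm_of_ringEquiv (hKiff hK) g.toRingEquiv
    refine ⟨σ, c, fun i => ?_⟩
    rw [← hx, ← hx]
    exact h i
  refine ⟨?_, fun _ => ?_⟩
  · tfae_have 1 → 6 := fun h => ⟨φ₀, hφ₀, (hdet φ₀ hφ₀).mpr (hK_of_isAffine h)⟩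
    tfae_have 6 → 3 := fun ⟨φ, hφ, h⟩ => ⟨SkewPoly.exists_isDiagonal hp_diag hp_inv,
      hmon_of_hK ((hdet φ hφ).mp h)⟩
    tfae_have 3 → 1 := fun h g => M.isAffine_of_isMonomial hx (h.2 g)
    tfae_have 6 → 2 := by
      rintro ⟨φ, hφ, h⟩ C _ _ _ _ g
      obtain ⟨σ, c, hσ⟩ := M.exists_perm_of_tensor (hKiff ((hdet φ hφ).mp h)) hx g
      exact SkewPoly.isAffineOver_of_eq_tmul hσ
    tfae_have 2 → 1 := by
      intro h g
      -- The test algebra is k itself, lifted to the universe in which C ranges.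
      have : IsDomain (ULift.{v, u} k) := ULift.ringEquiv.isDomain
      have : Module.Flat k (ULift.{v, u} k) := .of_linearEquiv ULift.moduleEquiv
      exact M.isAffine_of_isAffineOver hx (ULift.{v, u} k) ULift.algEquiv g (h _ _)
    tfae_have 6 → 4 := fun ⟨φ, hφ, h⟩ =>
      ⟨n, M.exists_center_algEquiv hℓ.pos (hKiff ((hdet φ hφ).mp h))⟩
    tfae_have 4 → 6 := fun ⟨_, ⟨ψ⟩⟩ =>
      ⟨φ₀, hφ₀, (hdet φ₀ hφ₀).mpr (M.dvd_of_center_algEquiv hℓ hexp H1M ψ)⟩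
    tfae_have 6 → 5 := fun ⟨φ, hφ, h⟩ =>
      Module.Free.of_basis (M.centerBasis (hKiff ((hdet φ hφ).mp h)))
    tfae_have 5 → 6 := fun h =>
      ⟨φ₀, hφ₀, (hdet φ₀ hφ₀).mpr (M.dvd_of_free_center hℓ hexp H1M h)⟩
    tfae_have 6 → 7 := fun ⟨φ, hφ, h⟩ =>
      M.exists_isDominating.{u, v} (hKiff ((hdet φ hφ).mp h)) hℓk hx
    tfae_have 7 → 1 := fun ⟨_, hd, hdom⟩ g => M.isAffine_of_isDominating.{u, v} hexp hx hd hdom g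
    tfae_finish
  · tfae_have 1 → 2 := fun h =>
      SkewPoly.isTriangular_of_isCentral_iff hp_diag hp_inv (hKiff (hK_of_isAffine h))
    tfae_have 1 → 3 := fun h δ hδ =>
      M.eq_zero_of_isLND hℓ.one_lt (hKiff (hK_of_isAffine h)) hδ
    tfae_have 2 → 1 := by
      intro htri g
      refine M.isAffine_of_isMonomial hx (hmon_of_hK ?_ g)
      by_contra hK
      obtain ⟨s, m, hms, -, hm⟩ := SkewPoly.exists_commutesLike hp_diag hp_inv hℓ hexp H1 hK
      obtain ⟨h, hh⟩ := SkewPoly.exists_not_isTriangular hp_diag hp_inv hms hm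
      exact hh (htri h)
    tfae_have 3 → 1 := by
      intro hlnd g
      refine M.isAffine_of_isMonomial hx (hmon_of_hK ?_ g)
      by_contra hK
      obtain ⟨s, m, hms, -, hm⟩ := SkewPoly.exists_commutesLike hp_diag hp_inv hℓ hexp H1 hK
      obtain ⟨δ, hδ, hne⟩ := SkewPoly.exists_isLND_ne_zero hp_diag hp_inv hms hm
      exact hne (hlnd δ hδ)
    tfae_finish
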